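/- Let $0<\alpha,\beta\le 1$. For $t>0$ the conformable derivative of order $\alpha$ is $D^{\alpha}f(t)=\lim_{\varepsilon\to0}\frac{f(t+\varepsilon t^{1-\alpha})-f(t)}{\varepsilon}$; write $u_t^{(\beta)}$, $u_x^{(\alpha)}$ for the conformable partial derivatives of $u=u(t,x)$ and $u_x^{(3\alpha)}$ for the threefold iterate of $u\mapsto u_x^{(\alpha)}$. Consider the fractional KdV equation $$\Delta[u]:=u_t^{(\beta)}+6u\,u_x^{(\alpha)}+u_x^{(3\alpha)}=0,\qquad t>0,\ x>0. \tag{1}$$ Let $\Omega$ be a nonempty connected open subset of $\{(t,x,u)\in\mathbb R^3: t>0,\ x>0\}$ and let $V=\tau\,\partial_t+\xi\,\partial_x+\eta\,\partial_u$ be a vector field on $\Omega$ whose coefficients $\tau,\xi,\eta$ are $C^\infty$ functions of $(t,x,u)\in\Omega$. We say that $V$ generates a point symmetry group of (1) if $V$ is the generator of a smooth local one-parameter group of transformations $\Phi_\varepsilon$ of $\Omega$ (i.e. $\frac{d}{d\varepsilon}\Phi_\varepsilon=V(\Phi_\varepsilon)$, $\Phi_0=\mathrm{id}$) and, for every such local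 group, whenever $\Phi_\varepsilon$ carries the graph of a smooth solution of (1) over an open set onto the graph of a smooth function over an open set, the latter function is also a solution of (1). We say that $V$ satisfies the infinitesimal criterion if $$6\eta\,u_x^{(\alpha)}+\eta^t_\beta+6u\,\eta^x_\alpha+\eta^{xxx}_\alpha=0 \quad\text{at every jet of a smooth function } u \text{ over } \Omega \text{ at which } \Delta[u]=0,$$ where, with total derivatives $D_t,D_x$, $$\eta^t=D_t\eta-u_xD_t\xi-u_tD_t\tau,\quad \eta^x=D_x\eta-u_xD_x\xi-u_tD_x\tau,$$ $$\eta^{xx}=D_x\eta^x-u_{xx}D_x\xi-u_{xt}D_x\tau,\quad \eta^{xxx}=D_x\eta^{xx}-u_{xxx}D_x\xi-u_{xxt}D_x\tau,$$ $$\eta^t_\beta=t^{1-\beta}\eta^t+(1-\beta)\tau t^{-\beta}u_t,\qquad \eta^x_\alpha=x^{1-\alpha}\eta^x+(1-\alpha)\xi x^{-\alpha}u_x,$$ $$\begin{aligned}\eta^{xxx}_\alpha={}&x^{3-3\alpha}\eta^{xxx}+(3-3\alpha)x^{2-3\alpha}\eta^{xx}+(1-\alpha)(1-2\alpha)x^{1-3\alpha}\eta^x+(3-3\alpha)\xi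 x^{2-3\alpha}u_{xxx}\\&+(3-3\alpha)(2-3\alpha)\xi x^{1-3\alpha}u_{xx}+(1-\alpha)(1-2\alpha)(1-3\alpha)\xi x^{-3\alpha}u_x.\end{aligned}$$ Then the following hold. (a) The following are equivalent: (i) $V$ generates a point symmetry group of (1); (ii) $V$ satisfies the infinitesimal criterion; (iii) there are constants $c_1,c_2,c_3,c_4\in\mathbb R$ such that on $\Omega$ $$\tau=-\frac{3c_1}{2\beta}t+c_2t^{1-\beta},\qquad \xi=-\frac{c_1}{2\alpha}x+\frac{6c_3}{\beta}t^{\beta}x^{1-\alpha}+c_4x^{1-\alpha},\qquad \eta=c_1u+c_3 .$$ (b) The set of all smooth vector fields on $\Omega$ that generate point symmetry groups of (1) is the real linear span of the restrictions to $\Omega$ of $$V_1=t^{1-\beta}\partial_t,\quad V_2=x^{1-\alpha}\partial_x,\quad V_3=\frac{6t^{\beta}x^{1-\alpha}}{\beta}\partial_x+\partial_u,\quad V_4=-\frac{3t}{2\beta}\partial_t-\frac{x}{2\alpha}\partial_x+u\,\partial_u .$$ (c) With $[\rho,\sigma]=\rho\sigma-\sigma\rho$, for $t>0$, $x>0$,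 $$[V_1,V_2]=0,\quad [V_1,V_3]=6V_2,\quad [V_1,V_4]=-\tfrac32V_1,\quad [V_2,V_3]=0,\quad [V_2,V_4]=-\tfrac12V_2,\quad [V_3,V_4]=V_3 .$$ -/

import Mathlib

open scoped ContDiff

noncomputable section

namespace FracKdV

/-- The conformable fractional derivative `D^α f (t) = lim_{ε → 0} (f (t + ε t^{1-α}) - f t) / ε`
at a point `t > 0`.  The limit is written as the derivative at `ε = 0` of `ε ↦ f (t + ε t^{1-α})`,
which is by definition the limit of this difference quotient. -/
def conformableDeriv (α : ℝ) (f : ℝ → ℝ) (t : ℝ) : ℝ :=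
  deriv (fun ε : ℝ => f (t + ε * t ^ (1 - α))) 0

/-- The conformable partial derivative `∂^β u / ∂t^β` of a function `u` of `(t, x)`. -/
def conformableT (β : ℝ) (u : ℝ × ℝ → ℝ) : ℝ × ℝ → ℝ :=
  fun p => conformableDeriv β (fun s => u (s, p.2)) p.1

/-- The conformable partial derivative `∂^α u / ∂x^α` of a function `u` of `(t, x)`.  The sequential
derivative `∂^{nα} u / ∂x^{nα}` is the `n`-th iterate `(conformableX α)^[n] u`. -/
def conformableX (α : ℝ) (u : ℝ × ℝ → ℝ) : ℝ × ℝ → ℝ :=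
  fun p => conformableDeriv α (fun y => u (p.1, y)) p.2

/-- The left-hand side `u_t^{(β)} + 6 u u_x^{(α)} + u_x^{(3α)}` of the fractional KdV equation. -/
def kdv (α β : ℝ) (u : ℝ × ℝ → ℝ) (p : ℝ × ℝ) : ℝ :=
  conformableT β u p + 6 * u p * conformableX α u p + (conformableX α)^[3] u p

/-- `u` is a (smooth) solution of the fractional KdV equation on the open set `W` of points
`(t, x)`. -/
def IsSolution (α β : ℝ) (W : Set (ℝ × ℝ)) (u : ℝ × ℝ → ℝ) : Prop :=
  ContDiffOn ℝ ∞ u W ∧ ∀ p ∈ W, kdv α β u p = 0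

/-- The open set of `(t, x, u)` with `t > 0` and `x > 0`. -/
def quadrant : Set (ℝ × ℝ × ℝ) := {p | 0 < p.1 ∧ 0 < p.2.1}

/-- The graph `{(t, x, u (t, x)) | (t, x) ∈ W}` of `u` over `W`. -/
def graphOver (W : Set (ℝ × ℝ)) (u : ℝ × ℝ → ℝ) : Set (ℝ × ℝ × ℝ) :=
  (fun p : ℝ × ℝ => (p.1, p.2, u p)) '' W

/-!
A vector field `τ ∂_t + ξ ∂_x + η ∂_u` is given by its coefficients
`V (t, x, u) = (τ (t, x, u), ξ (t, x, u), η (t, x, u))`.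
-/

/-- `Φ`, with domain `D`, is a smooth local one-parameter group of transformations of `Ω` with
infinitesimal generator `V`: it is obtained by integrating the Lie equations
`dΦ/dε = V (Φ)`, `Φ|_{ε = 0} = id`. -/
structure IsLocalFlow (Ω : Set (ℝ × ℝ × ℝ)) (V : ℝ × ℝ × ℝ → ℝ × ℝ × ℝ)
    (D : Set (ℝ × (ℝ × ℝ × ℝ))) (Φ : ℝ × (ℝ × ℝ × ℝ) → ℝ × ℝ × ℝ) : Prop where
  isOpen : IsOpen D
  zero_mem : ∀ q ∈ Ω, ((0 : ℝ), q) ∈ D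
  source_mem : ∀ ε q, (ε, q) ∈ D → q ∈ Ω
  target_mem : ∀ ε q, (ε, q) ∈ D → Φ (ε, q) ∈ Ω
  ordConnected : ∀ q, {ε : ℝ | (ε, q) ∈ D}.OrdConnected
  smooth : ContDiffOn ℝ ∞ Φ D
  initial : ∀ q ∈ Ω, Φ (0, q) = q
  lie_equation : ∀ ε q, (ε, q) ∈ D → HasDerivAt (fun s => Φ (s, q)) (V (Φ (ε, q))) ε

/-- The transformations `Φ (ε, ·)` are symmetries of the fractional KdV equation: whenever the graph
of a solution `u` is carried by `Φ (ε, ·)` onto the graph of a smooth function `v`, then `v` is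
a solution as well. -/
def MapsSolutions (α β : ℝ) (D : Set (ℝ × (ℝ × ℝ × ℝ)))
    (Φ : ℝ × (ℝ × ℝ × ℝ) → ℝ × ℝ × ℝ) : Prop :=
  ∀ (ε : ℝ) (W W' : Set (ℝ × ℝ)) (u v : ℝ × ℝ → ℝ),
    IsOpen W → IsOpen W' → IsSolution α β W u → ContDiffOn ℝ ∞ v W' →
    (∀ q ∈ graphOver W u, (ε, q) ∈ D) →
    (fun q => Φ (ε, q)) '' graphOver W u = graphOver W' v →
    IsSolution α β W' v

/-- `V` generates a local one-parameter group of point symmetries of the fractional KdV equation on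
`Ω`: the Lie equations can be integrated to a smooth local one-parameter group, and every such
group consists of symmetries. -/
def GeneratesSymmetry (α β : ℝ) (Ω : Set (ℝ × ℝ × ℝ)) (V : ℝ × ℝ × ℝ → ℝ × ℝ × ℝ) : Prop :=
  (∃ D Φ, IsLocalFlow Ω V D Φ) ∧ ∀ D Φ, IsLocalFlow Ω V D Φ → MapsSolutions α β D Φ

/-- `∂f/∂t`. -/
def partialT (f : ℝ × ℝ → ℝ) : ℝ × ℝ → ℝ := fun p => deriv (fun s => f (s, p.2)) p.1

/-- `∂f/∂x`. -/
def partialX (f : ℝ × ℝ → ℝ) : ℝ × ℝ → ℝ := fun p => deriv (fun y => f (p.1, y)) p.2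

/-! Prolongation coefficients of `V`, evaluated on the jets of a function `u`.  The total derivatives
`D_t` and `D_x` of a function of the jet coordinates are the partial derivatives of the function
of `(t, x)` that results from inserting `u` and its derivatives. -/

/-- The coefficient `τ (t, x, u (t, x))`. -/
def tauOn (V : ℝ × ℝ × ℝ → ℝ × ℝ × ℝ) (u : ℝ × ℝ → ℝ) : ℝ × ℝ → ℝ :=
  fun p => (V (p.1, p.2, u p)).1

/-- The coefficient `ξ (t, x, u (t, x))`. -/
def xiOn (V : ℝ × ℝ × ℝ → ℝ × ℝ × ℝ) (u : ℝ × ℝ → ℝ) : ℝ × ℝ → ℝ :=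
  fun p => (V (p.1, p.2, u p)).2.1

/-- The coefficient `η (t, x, u (t, x))`. -/
def etaOn (V : ℝ × ℝ × ℝ → ℝ × ℝ × ℝ) (u : ℝ × ℝ → ℝ) : ℝ × ℝ → ℝ :=
  fun p => (V (p.1, p.2, u p)).2.2

/-- `η^t = D_t η - u_x D_t ξ - u_t D_t τ`. -/
def etaT (V : ℝ × ℝ × ℝ → ℝ × ℝ × ℝ) (u : ℝ × ℝ → ℝ) : ℝ × ℝ → ℝ := fun p =>
  partialT (etaOn V u) p - partialX u p * partialT (xiOn V u) p
    - partialT u p * partialT (tauOn V u) p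

/-- `η^x = D_x η - u_x D_x ξ - u_t D_x τ`. -/
def etaX (V : ℝ × ℝ × ℝ → ℝ × ℝ × ℝ) (u : ℝ × ℝ → ℝ) : ℝ × ℝ → ℝ := fun p =>
  partialX (etaOn V u) p - partialX u p * partialX (xiOn V u) p
    - partialT u p * partialX (tauOn V u) p

/-- `η^{xx} = D_x η^x - u_{xx} D_x ξ - u_{xt} D_x τ`. -/
def etaXX (V : ℝ × ℝ × ℝ → ℝ × ℝ × ℝ) (u : ℝ × ℝ → ℝ) : ℝ × ℝ → ℝ := fun p =>
  partialX (etaX V u) p - partialX (partialX u) p * partialX (xiOn V u) p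
    - partialT (partialX u) p * partialX (tauOn V u) p

/-- `η^{xxx} = D_x η^{xx} - u_{xxx} D_x ξ - u_{xxt} D_x τ`. -/
def etaXXX (V : ℝ × ℝ × ℝ → ℝ × ℝ × ℝ) (u : ℝ × ℝ → ℝ) : ℝ × ℝ → ℝ := fun p =>
  partialX (etaXX V u) p - partialX (partialX (partialX u)) p * partialX (xiOn V u) p
    - partialT (partialX (partialX u)) p * partialX (tauOn V u) p

/-- The coefficient `η^t_β` of the prolongation belonging to `∂^β u / ∂t^β`. -/
def fracEtaT (β : ℝ) (V : ℝ × ℝ × ℝ → ℝ × ℝ × ℝ) (u : ℝ × ℝ → ℝ) (p : ℝ × ℝ) : ℝ :=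
  p.1 ^ (1 - β) * etaT V u p + (1 - β) * tauOn V u p * p.1 ^ (-β) * partialT u p

/-- The coefficient `η^x_α` of the prolongation belonging to `∂^α u / ∂x^α`. -/
def fracEtaX (α : ℝ) (V : ℝ × ℝ × ℝ → ℝ × ℝ × ℝ) (u : ℝ × ℝ → ℝ) (p : ℝ × ℝ) : ℝ :=
  p.2 ^ (1 - α) * etaX V u p + (1 - α) * xiOn V u p * p.2 ^ (-α) * partialX u p

/-- The coefficient `η^{xxx}_α` of the prolongation belonging to `∂^{3α} u / ∂x^{3α}`. -/
def fracEtaXXX (α : ℝ) (V : ℝ × ℝ × ℝ → ℝ × ℝ × ℝ) (u : ℝ × ℝ → ℝ) (p : ℝ × ℝ) : ℝ :=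
  p.2 ^ (3 - 3 * α) * etaXXX V u p
    + (3 - 3 * α) * p.2 ^ (2 - 3 * α) * etaXX V u p
    + (1 - α) * (1 - 2 * α) * p.2 ^ (1 - 3 * α) * etaX V u p
    + (3 - 3 * α) * xiOn V u p * p.2 ^ (2 - 3 * α) * partialX (partialX (partialX u)) p
    + (3 - 3 * α) * (2 - 3 * α) * xiOn V u p * p.2 ^ (1 - 3 * α) * partialX (partialX u) p
    + (1 - α) * (1 - 2 * α) * (1 - 3 * α) * xiOn V u p * p.2 ^ (-3 * α) * partialX u p

/-- Lie's infinitesimal criterion `pr^{(3α, β)} V (Δ) |_{Δ = 0} = 0` on `Ω`, where `Δ` is the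
left-hand side of the fractional KdV equation: it is imposed at every jet over a point of `Ω` on
which `Δ` vanishes.  Each jet is the jet of a smooth function `u` at a point `(t, x)`; the
equation is required at that point only. -/
def LieCriterion (α β : ℝ) (Ω : Set (ℝ × ℝ × ℝ)) (V : ℝ × ℝ × ℝ → ℝ × ℝ × ℝ) : Prop :=
  ∀ (u : ℝ × ℝ → ℝ) (p : ℝ × ℝ), ContDiff ℝ ∞ u → (p.1, p.2, u p) ∈ Ω → kdv α β u p = 0 →
    6 * etaOn V u p * conformableX α u p + fracEtaT β V u p + 6 * u p * fracEtaX α V u p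
      + fracEtaXXX α V u p = 0

/-- The set of smooth vector fields on `Ω` that generate point symmetries of the fractional KdV
equation. -/
def symmetryAlgebra (α β : ℝ) (Ω : Set (ℝ × ℝ × ℝ)) : Set (Ω → ℝ × ℝ × ℝ) :=
  {X | ∃ V : ℝ × ℝ × ℝ → ℝ × ℝ × ℝ,
    ContDiffOn ℝ ∞ V Ω ∧ GeneratesSymmetry α β Ω V ∧ Ω.domRestrict V = X}

/-- `V₁ = t^{1-β} ∂_t`. -/
def V₁ (β : ℝ) : ℝ × ℝ × ℝ → ℝ × ℝ × ℝ := fun p => (p.1 ^ (1 - β), 0, 0)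

/-- `V₂ = x^{1-α} ∂_x`. -/
def V₂ (α : ℝ) : ℝ × ℝ × ℝ → ℝ × ℝ × ℝ := fun p => (0, p.2.1 ^ (1 - α), 0)

/-- `V₃ = (6 t^β x^{1-α} / β) ∂_x + ∂_u`. -/
def V₃ (α β : ℝ) : ℝ × ℝ × ℝ → ℝ × ℝ × ℝ :=
  fun p => (0, 6 * p.1 ^ β * p.2.1 ^ (1 - α) / β, 1)

/-- `V₄ = -(3 t / (2 β)) ∂_t - (x / (2 α)) ∂_x + u ∂_u`. -/
def V₄ (α β : ℝ) : ℝ × ℝ × ℝ → ℝ × ℝ × ℝ :=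
  fun p => (-3 * p.1 / (2 * β), -p.2.1 / (2 * α), p.2.2)

end FracKdV

end

/-! In the variables `T = t^β/β`, `X = x^α/α` the conformable derivatives become `∂_T` and `∂_X`, so
the equation is the classical KdV equation `u_T + 6uu_X + u_XXX = 0`, and a vector field has
components `a = t^{β-1}τ`, `b = x^{α-1}ξ`, `c = η`. For most of the proof this substitution is
purely algebraic: `t^{1-β}∂_t` and `x^{1-α}∂_x` are commuting derivations of the ring of smooth
functions on an open set, so prolongation identities become ring identities. `ev_lieForm` shows that
the conformable prolongation coefficients are the classical ones for these weighted derivations.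

Both (i) ⇒ (iii) and (ii) ⇒ (iii) pass through one condition, `CriticalOnSolutions`: the linearized
expression `lieForm` vanishes along every solution with graph in `Ω`. From (ii) it is immediate.
From (i) it is obtained by differentiating at `ε = 0` the KdV expression in the transformed
variables (`map_derivation_newKdv`, `criticalOnSolutions_of_mapsSolutions`); the inverse function
theorem shows that the transformed surface is locally a graph.

To extract the determining equations, enough jets must come from genuine solutions. The solutions `u
= cT + f(X - vT - 3cT²)`, with `f` solving a third-order ODE, leave `u`, `u_X`, `u_XX`, `u_T` and
`v` free (`exists_solution`). Comparing coefficients gives `a_X = a_u = b_u = 0`, `a_T = 3b_X`, and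
then that `b_X`, `b_T` are constant and `6c = b_T - 12u b_X`. On the connected set `Ω` this
integrates to the four-parameter family (`CriticalOnSolutions.exists_constants`).

Conversely, for a field of the family `lieForm` is `5c₁/2` times the KdV expression
(`lieForm_affine`), which gives (ii). For (i), the field is affine in `(T, X, u)`; its flow is
explicit, every local flow agrees with it by uniqueness for linear ODEs (`flatten_flow_eq`), and its
finite transformations multiply the KdV expression by a constant (`newKdv_affine`). Part (b)
rewrites (iii) as a linear combination of the four fields; part (c) is a direct computation. -/

noncomputable section

namespace FracKdV

open TopologicalSpace

/-! ### The ring of smooth functions on an open set and its weighted derivations. -/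

section SmoothFn

variable {E F : Type*} [NormedAddCommGroup E] [NormedSpace ℝ E]
  [NormedAddCommGroup F] [NormedSpace ℝ F]

/-- The algebra of smooth real functions on an open subset `U` of a normed space. -/
def smoothAlgebra (U : Opens E) : Subalgebra ℝ (U → ℝ) where
  carrier := {f | ∃ g : E → ℝ, ContDiffOn ℝ ∞ g U ∧ ∀ p : U, g p = f p}
  mul_mem' := by
    rintro f₁ f₂ ⟨g₁, h₁, e₁⟩ ⟨g₂, h₂, e₂⟩
    exact ⟨fun p => g₁ p * g₂ p, h₁.mul h₂, fun p => by simp [e₁, e₂]⟩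
  add_mem' := by
    rintro f₁ f₂ ⟨g₁, h₁, e₁⟩ ⟨g₂, h₂, e₂⟩
    exact ⟨fun p => g₁ p + g₂ p, h₁.add h₂, fun p => by simp [e₁, e₂]⟩
  algebraMap_mem' r := ⟨fun _ => r, contDiffOn_const, fun _ => rfl⟩

/-- Smooth real functions on the open set `U`. -/
def SmoothFn (U : Opens E) : Type _ := smoothAlgebra U

namespace SmoothFn

variable {U : Opens E} {U' : Opens F}

instance : CommRing (SmoothFn U) := inferInstanceAs (CommRing (smoothAlgebra U))

instance : Algebra ℝ (SmoothFn U) := inferInstanceAs (Algebra ℝ (smoothAlgebra U))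

/-- The inclusion into all functions on `U`. -/
def incl : SmoothFn U →ₐ[ℝ] (U → ℝ) := (smoothAlgebra U).val

/-- The restriction to `U` of a function that is smooth on `U`. -/
def of (g : E → ℝ) (hg : ContDiffOn ℝ ∞ g U) : SmoothFn U :=
  (⟨fun p => g p, g, hg, fun _ => rfl⟩ : smoothAlgebra U)

/-- The extension by zero. -/
def rep (f : SmoothFn U) : E → ℝ := open Classical in
  fun p => if h : p ∈ U then incl f ⟨p, h⟩ else 0

/-- Evaluation at a point of `U`. -/
def ev {p : E} (hp : p ∈ U) : SmoothFn U →ₐ[ℝ] ℝ :=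
  (Pi.evalAlgHom ℝ (fun _ : U => ℝ) ⟨p, hp⟩).comp incl

theorem ext_ev {f g : SmoothFn U} (h : ∀ p (hp : p ∈ U), ev hp f = ev hp g) : f = g :=
  Subtype.ext (funext fun p => h p.1 p.2)

@[simp] theorem ev_of {g : E → ℝ} (hg : ContDiffOn ℝ ∞ g U) {p : E} (hp : p ∈ U) :
    ev hp (of g hg) = g p := rfl

theorem rep_eq (f : SmoothFn U) {p : E} (hp : p ∈ U) : rep f p = ev hp f :=
  dif_pos hp

theorem contDiffOn_rep (f : SmoothFn U) : ContDiffOn ℝ ∞ (rep f) U := by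
  obtain ⟨g, hg, e⟩ := Subtype.property (f : smoothAlgebra U)
  refine hg.congr fun p hp => ?_
  rw [rep_eq f hp]
  exact (e ⟨p, hp⟩).symm

theorem differentiableAt_of {g : E → ℝ} (hg : ContDiffOn ℝ ∞ g U) {p : E} (hp : p ∈ U) :
    DifferentiableAt ℝ g p :=
  (hg.contDiffAt (U.isOpen.mem_nhds hp)).differentiableAt (by simp)

/-- Since `pd` differentiates the zero extension `rep`, derivatives of `of g` reduce to those of `g`
through equality of germs on the open set `U`. -/
theorem rep_of_eventuallyEq {g : E → ℝ} (hg : ContDiffOn ℝ ∞ g U) {p : E} (hp : p ∈ U) :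
    rep (of g hg) =ᶠ[nhds p] g := by
  filter_upwards [U.isOpen.mem_nhds hp] with q hq
  rw [rep_eq _ hq, ev_of]

theorem contDiffOn_fderiv_apply {g : E → ℝ} (hg : ContDiffOn ℝ ∞ g U) (v : E) :
    ContDiffOn ℝ ∞ (fun p => fderiv ℝ g p v) U :=
  ((contDiffOn_infty_iff_fderiv_of_isOpen U.isOpen).1 hg).2.clm_apply contDiffOn_const

/-- The derivative in the constant direction `v`. -/
def pd (v : E) : Derivation ℝ (SmoothFn U) (SmoothFn U) where
  toFun f := of (fun p => fderiv ℝ (rep f) p v) (contDiffOn_fderiv_apply (contDiffOn_rep f) v)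
  map_add' f g := by
    refine ext_ev fun p hp => ?_
    have h : rep (f + g) =ᶠ[nhds p] rep f + rep g := by
      filter_upwards [U.isOpen.mem_nhds hp] with q hq
      simp [rep_eq _ hq]
    rw [map_add]
    simp only [ev_of]
    rw [h.fderiv_eq, fderiv_add (differentiableAt_of (contDiffOn_rep f) hp)
      (differentiableAt_of (contDiffOn_rep g) hp)]
    rfl
  map_smul' r f := by
    refine ext_ev fun p hp => ?_
    have h : rep (r • f) =ᶠ[nhds p] r • rep f := by
      filter_upwards [U.isOpen.mem_nhds hp] with q hq
      simp [rep_eq _ hq]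
    simp only [map_smul, ev_of, RingHom.id_apply]
    rw [h.fderiv_eq, fderiv_const_smul (differentiableAt_of (contDiffOn_rep f) hp)]
    rfl
  map_one_eq_zero' := by
    refine ext_ev fun p hp => ?_
    have h : rep (1 : SmoothFn U) =ᶠ[nhds p] fun _ => 1 := by
      filter_upwards [U.isOpen.mem_nhds hp] with q hq
      simp [rep_eq _ hq]
    simp [h.fderiv_eq]
  leibniz' f g := by
    refine ext_ev fun p hp => ?_
    have h : rep (f * g) =ᶠ[nhds p] rep f * rep g := by
      filter_upwards [U.isOpen.mem_nhds hp] with q hq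
      simp [rep_eq _ hq]
    simp only [map_add, smul_eq_mul, map_mul, LinearMap.coe_mk, AddHom.coe_mk, ev_of]
    rw [h.fderiv_eq, fderiv_mul (differentiableAt_of (contDiffOn_rep f) hp)
      (differentiableAt_of (contDiffOn_rep g) hp)]
    simp [rep_eq _ hp]

theorem ev_pd (v : E) (f : SmoothFn U) {p : E} (hp : p ∈ U) :
    ev hp (pd v f) = fderiv ℝ (rep f) p v := rfl

theorem ev_pd_of (v : E) {g : E → ℝ} (hg : ContDiffOn ℝ ∞ g U) {p : E} (hp : p ∈ U) :
    ev hp (pd v (of g hg)) = fderiv ℝ g p v := by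
  rw [ev_pd, (rep_of_eventuallyEq hg hp).fderiv_eq]

theorem pd_of (v : E) {g : E → ℝ} (hg : ContDiffOn ℝ ∞ g U) :
    pd v (of g hg) = of (fun p => fderiv ℝ g p v) (contDiffOn_fderiv_apply hg v) :=
  ext_ev fun p hp => by rw [ev_pd_of, ev_of]

theorem of_rep (f : SmoothFn U) : of (rep f) (contDiffOn_rep f) = f :=
  ext_ev fun p hp => by rw [ev_of, rep_eq]

theorem pd_comm (v w : E) (f : SmoothFn U) : pd v (pd w f) = pd w (pd v f) := by
  refine ext_ev fun p hp => ?_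
  have hc := (contDiffOn_rep f).contDiffAt (U.isOpen.mem_nhds hp)
  have hd : DifferentiableAt ℝ (fderiv ℝ (rep f)) p :=
    (((contDiffOn_infty_iff_fderiv_of_isOpen U.isOpen).1 (contDiffOn_rep f)).2.contDiffAt
      (U.isOpen.mem_nhds hp)).differentiableAt (by simp)
  have key : ∀ v w : E, ev hp (pd v (pd w f)) = fderiv ℝ (fderiv ℝ (rep f)) p v w := by
    intro v w
    rw [← of_rep f, pd_of, ev_pd_of, of_rep, fderiv_clm_apply hd (by fun_prop)]
    simp
  rw [key, key]
  exact hc.isSymmSndFDerivAt (by simpa using ENat.LEInfty.out) v w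

theorem derivation_ofNat (D : Derivation ℝ (SmoothFn U) (SmoothFn U)) (n : ℕ) [n.AtLeastTwo] :
    D (no_index (OfNat.ofNat n : SmoothFn U)) = 0 := by
  simpa only [map_ofNat] using D.map_algebraMap (OfNat.ofNat n : ℝ)

/-- Composition with a smooth map. -/
def pull (γ : F → E) (hγ : ContDiffOn ℝ ∞ γ U') (hm : ∀ p ∈ U', γ p ∈ U) :
    SmoothFn U →ₐ[ℝ] SmoothFn U' where
  toFun f := of (fun p => rep f (γ p)) ((contDiffOn_rep f).comp hγ hm)
  map_one' := ext_ev fun p hp => by simp [rep_eq _ (hm p hp)]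
  map_mul' f g := ext_ev fun p hp => by simp [rep_eq _ (hm p hp)]
  map_zero' := ext_ev fun p hp => by simp [rep_eq _ (hm p hp)]
  map_add' f g := ext_ev fun p hp => by simp [rep_eq _ (hm p hp)]
  commutes' r := ext_ev fun p hp => by simp [rep_eq _ (hm p hp)]

theorem ev_pull {γ : F → E} (hγ : ContDiffOn ℝ ∞ γ U') (hm : ∀ p ∈ U', γ p ∈ U)
    (f : SmoothFn U) {p : F} (hp : p ∈ U') :
    ev hp (pull γ hγ hm f) = ev (hm p hp) f :=
  rep_eq f (hm p hp)

theorem ev_pd_pull {γ : F → E} (hγ : ContDiffOn ℝ ∞ γ U') (hm : ∀ p ∈ U', γ p ∈ U)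
    (f : SmoothFn U) (v : F) {p : F} (hp : p ∈ U') :
    ev hp (pd v (pull γ hγ hm f)) = fderiv ℝ (rep f) (γ p) (fderiv ℝ γ p v) := by
  have h := fderiv_comp p (differentiableAt_of (contDiffOn_rep f) (hm p hp))
    ((hγ.contDiffAt (U'.isOpen.mem_nhds hp)).differentiableAt (by simp))
  refine (ev_pd_of v ((contDiffOn_rep f).comp hγ hm) hp).trans ?_
  rw [h]
  rfl

theorem exists_eq_algebraMap (hU : IsPreconnected (U : Set E)) {f : SmoothFn U}
    (hf : ∀ v, pd v f = 0) : ∃ c : ℝ, f = algebraMap ℝ _ c := by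
  obtain ⟨c, hc⟩ := U.isOpen.exists_is_const_of_fderiv_eq_zero hU
    (fun p hp => (differentiableAt_of (contDiffOn_rep f) hp).differentiableWithinAt)
    (fun p hp => by
      ext v
      simpa [hf v] using (ev_pd v f hp).symm)
  refine ⟨c, ext_ev fun p hp => ?_⟩
  rw [← rep_eq f hp, hc p hp, AlgHom.commutes]
  rfl

theorem contDiffOn_rpow {ℓ : E →L[ℝ] ℝ} (hℓ : ∀ p ∈ U, 0 < ℓ p) (r : ℝ) :
    ContDiffOn ℝ ∞ (fun p => ℓ p ^ r) U := fun p hp =>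
  (ℓ.contDiff.contDiffAt.rpow_const_of_ne (hℓ p hp).ne').contDiffWithinAt

/-- A real power of a positive linear coordinate. -/
def powFn (ℓ : E →L[ℝ] ℝ) (hℓ : ∀ p ∈ U, 0 < ℓ p) (r : ℝ) : SmoothFn U :=
  of (fun p => ℓ p ^ r) (contDiffOn_rpow hℓ r)

variable {ℓ m : E →L[ℝ] ℝ} (hℓ : ∀ p ∈ U, 0 < ℓ p) (hm : ∀ p ∈ U, 0 < m p)

theorem ev_powFn (r : ℝ) {p : E} (hp : p ∈ U) : ev hp (powFn ℓ hℓ r) = ℓ p ^ r := rfl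

theorem powFn_add (r s : ℝ) : powFn ℓ hℓ (r + s) = powFn ℓ hℓ r * powFn ℓ hℓ s :=
  ext_ev fun p hp => by simp [ev_powFn, Real.rpow_add (hℓ p hp)]

theorem powFn_zero : powFn ℓ hℓ 0 = 1 :=
  ext_ev fun p hp => by simp [ev_powFn]

theorem pd_powFn (r : ℝ) (v : E) : pd v (powFn ℓ hℓ r) = (r * ℓ v) • powFn ℓ hℓ (r - 1) := by
  refine ext_ev fun p hp => ?_
  have h : HasFDerivAt (fun p => ℓ p ^ r) ((r * ℓ p ^ (r - 1)) • ℓ) p :=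
    ℓ.hasFDerivAt.rpow_const (Or.inl (hℓ p hp).ne')
  rw [powFn, ev_pd_of, h.fderiv]
  simp only [_root_.smul_apply, smul_eq_mul, map_smul, ev_powFn]
  ring

/-- The conformable derivation `ℓ^{1-α} ∂_v`. -/
def conf (α : ℝ) (ℓ : E →L[ℝ] ℝ) (hℓ : ∀ p ∈ U, 0 < ℓ p) (v : E) :
    Derivation ℝ (SmoothFn U) (SmoothFn U) :=
  powFn ℓ hℓ (1 - α) • pd v

theorem conf_apply (α : ℝ) (v : E) (f : SmoothFn U) :
    conf α ℓ hℓ v f = powFn ℓ hℓ (1 - α) * pd v f := rfl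

theorem ev_conf (α : ℝ) (v : E) (f : SmoothFn U) {p : E} (hp : p ∈ U) :
    ev hp (conf α ℓ hℓ v f) = ℓ p ^ (1 - α) * fderiv ℝ (rep f) p v := by
  rw [conf_apply, map_mul, ev_powFn, ev_pd]

/-- Each weight is constant in the direction of the other derivation, so only the symmetry of second
derivatives is used. -/
theorem conf_comm (α β : ℝ) {v w : E} (hv : m v = 0) (hw : ℓ w = 0) (f : SmoothFn U) :
    conf α ℓ hℓ v (conf β m hm w f) = conf β m hm w (conf α ℓ hℓ v f) := by
  simp only [conf_apply, Derivation.leibniz, pd_powFn, hv, hw, mul_zero, zero_smul,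
    add_zero, smul_eq_mul, pd_comm v w]
  ring

theorem conf_pd_comm (α : ℝ) {v w : E} (hw : ℓ w = 0) (f : SmoothFn U) :
    conf α ℓ hℓ v (pd w f) = pd w (conf α ℓ hℓ v f) := by
  simp only [conf_apply, Derivation.leibniz, pd_powFn, hw, mul_zero, zero_smul,
    add_zero, smul_eq_mul, pd_comm v w]

/-- The straightening coordinate: with `ℓ v = 1`, the conformable derivation acts on `ℓ^α/α` as
`d/dX` acts on `X`. -/
theorem conf_primitive {α : ℝ} (hα : α ≠ 0) (v : E) :
    conf α ℓ hℓ v (α⁻¹ • powFn ℓ hℓ α) = algebraMap ℝ _ (ℓ v) := by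
  rw [conf_apply, Derivation.map_smul, pd_powFn, smul_smul, mul_smul_comm, ← powFn_add,
    show 1 - α + (α - 1) = 0 by ring, powFn_zero, Algebra.algebraMap_eq_smul_one,
    inv_mul_cancel_left₀ hα]

end SmoothFn

end SmoothFn

open SmoothFn

/-! ### Prolongation formulas in a commutative ring with derivations. -/

section Prolongation

variable {R S : Type*} [CommRing R] [Algebra ℝ R] [CommRing S] [Algebra ℝ S]

/-- The first prolongation `D η - u_x D ξ - u_t D τ` along the derivation `D`, for the coefficients
`a`, `b`, `c` of a vector field along `u`. -/
def prolong (dT dX D : Derivation ℝ R R) (u a b c : R) : R :=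
  D c - dX u * D b - dT u * D a

/-- The prolongation of order `n` in the direction of `dX`. -/
def prolongX (dT dX : Derivation ℝ R R) (u a b c : R) : ℕ → R
  | 0 => c
  | n + 1 => prolong dT dX dX (dX^[n] u) a b (prolongX dT dX u a b c n)

/-- The linearization of the Korteweg-de Vries equation along a vector field. -/
def lieForm (dT dX : Derivation ℝ R R) (u a b c : R) : R :=
  6 * c * dX u + prolong dT dX dT u a b c + 6 * u * prolongX dT dX u a b c 1
    + prolongX dT dX u a b c 3

/-- The left-hand side of the Korteweg-de Vries equation. -/
def kdvForm (dT dX : Derivation ℝ R R) (u : R) : R :=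
  dT u + 6 * u * dX u + dX (dX (dX u))

/-- The derivative `∂/∂B` in the coordinates `A`, `B`; `K` is the inverse Jacobian. -/
def newX (dT dX : Derivation ℝ R R) (A _B K : R) : R → R := fun g =>
  K * (dT A * dX g - dX A * dT g)

/-- The derivative `∂/∂A` in the coordinates `A`, `B`; `K` is the inverse Jacobian. -/
def newT (dT dX : Derivation ℝ R R) (_A B K : R) : R → R := fun g =>
  K * (dX B * dT g - dT B * dX g)

/-- The Korteweg-de Vries expression of `C` in the coordinates `A`, `B`. -/
def newKdv (dT dX : Derivation ℝ R R) (A B K C : R) : R :=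
  newT dT dX A B K C + 6 * C * newX dT dX A B K C
    + newX dT dX A B K (newX dT dX A B K (newX dT dX A B K C))

theorem map_newKdv {dT dX : Derivation ℝ R R} {δT δX : Derivation ℝ S S} (ρ : R →ₐ[ℝ] S)
    (hT : ∀ f, ρ (dT f) = δT (ρ f)) (hX : ∀ f, ρ (dX f) = δX (ρ f)) (A B K C : R) :
    ρ (newKdv dT dX A B K C) = newKdv δT δX (ρ A) (ρ B) (ρ K) (ρ C) := by
  simp only [newKdv, newT, newX, map_add, map_sub, map_mul, hT, hX, map_ofNat]

/-- The variation of the Korteweg-de Vries expression under an infinitesimal change of the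
variables is given by the prolongation formula. -/
theorem map_derivation_newKdv {e dT dX : Derivation ℝ R R} {δT δX : Derivation ℝ S S}
    (ρ : R →ₐ[ℝ] S)
    (heT : ∀ f, e (dT f) = dT (e f)) (heX : ∀ f, e (dX f) = dX (e f))
    (hT : ∀ f, ρ (dT f) = δT (ρ f)) (hX : ∀ f, ρ (dX f) = δX (ρ f))
    {A B K : R} (C : R) (hK : K * (dT A * dX B - dX A * dT B) = 1)
    (hTA : δT (ρ A) = 1) (hXA : δX (ρ A) = 0) (hTB : δT (ρ B) = 0) (hXB : δX (ρ B) = 1) :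
    ρ (e (newKdv dT dX A B K C)) = lieForm δT δX (ρ C) (ρ (e A)) (ρ (e B)) (ρ (e C)) := by
  -- At `ε = 0` the new coordinates are the old ones, so the Jacobian is `1`; differentiating `K · J
  -- = 1` then makes the variation of `K` minus the divergence.
  have k0 : ρ K = 1 := by
    have := congrArg ρ hK
    simpa [hT, hX, hTA, hXA, hTB, hXB] using this
  have k1 : ρ (e K) = - (δT (ρ (e A)) + δX (ρ (e B))) := by
    have := congrArg (fun f => ρ (e f)) hK
    simp only [Derivation.leibniz, smul_eq_mul, map_sub, map_add, map_mul, hT, hX, heT, heX, hTA,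
      hXA, hTB, hXB, k0, Derivation.map_one_eq_zero, map_zero] at this
    linear_combination this
  have l0 : ∀ f, ρ (newX dT dX A B K f) = δX (ρ f) := by
    intro f
    simp [newX, hT, hX, hTA, hXA, k0]
  -- The variation of `∂/∂B` is one prolongation step for arbitrary `f`; applying it three times
  -- yields the third-order coefficient.
  have l1 : ∀ f, ρ (e (newX dT dX A B K f))
      = prolong δT δX δX (ρ f) (ρ (e A)) (ρ (e B)) (ρ (e f)) := by
    intro f
    simp only [newX, Derivation.leibniz, smul_eq_mul, map_sub, map_add, map_mul, hT, hX, heT, heX,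
      hTA, hXA, k0, k1, prolong]
    ring
  have m1 : ρ (e (newT dT dX A B K C))
      = prolong δT δX δT (ρ C) (ρ (e A)) (ρ (e B)) (ρ (e C)) := by
    simp only [newT, Derivation.leibniz, smul_eq_mul, map_sub, map_add, map_mul, hT, hX, heT, heX,
      hTB, hXB, k0, k1, prolong]
    ring
  have e6 : e (6 : R) = 0 := by
    simpa only [map_ofNat] using e.map_algebraMap (6 : ℝ)
  simp only [newKdv, lieForm, map_add, map_mul, Derivation.leibniz, smul_eq_mul, m1, l1, l0,
    e6, map_ofNat, map_zero, prolongX, Function.iterate_succ, Function.iterate_zero,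
    Function.comp_apply, id]
  ring

/-- In expanded form the mixed jet coordinates `u_TX`, `u_TXX` occur only with `X`-derivatives of
`a`, which is what isolates `a` in the determining equations. -/
theorem lieForm_eq {dT dX : Derivation ℝ R R} (hc : ∀ f, dX (dT f) = dT (dX f)) (u a b c : R) :
    lieForm dT dX u a b c = 6 * c * dX u + (dT c - dX u * dT b - dT u * dT a)
      + 6 * u * (dX c - dX u * dX b - dT u * dX a)
      + (dX (dX (dX c)) - 3 * dX (dX (dX u)) * dX b - 3 * dX (dX u) * dX (dX b)
        - dX u * dX (dX (dX b)) - 3 * dT (dX (dX u)) * dX a - 3 * dT (dX u) * dX (dX a)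
        - dT u * dX (dX (dX a))) := by
  simp only [lieForm, prolong, prolongX, map_sub, Derivation.leibniz, smul_eq_mul, hc,
    map_add, Function.iterate_succ, Function.iterate_zero, Function.comp_apply, id]
  ring

/-- The total derivatives up to order three of a function on the graph of `u`. -/
theorem total_derivatives {γ : S →ₐ[ℝ] R} {D : Derivation ℝ R R} {DX DU : Derivation ℝ S S} {u : R}
    (hX : ∀ F, D (γ F) = γ (DX F) + D u * γ (DU F)) (hc : ∀ F, DU (DX F) = DX (DU F)) (F : S) :
    D (D (γ F)) = γ (DX (DX F)) + 2 * D u * γ (DX (DU F)) + D u ^ 2 * γ (DU (DU F))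
        + D (D u) * γ (DU F) ∧
      D (D (D (γ F))) = γ (DX (DX (DX F))) + 3 * D u * γ (DX (DX (DU F)))
        + 3 * D u ^ 2 * γ (DX (DU (DU F))) + D u ^ 3 * γ (DU (DU (DU F)))
        + 3 * D (D u) * γ (DX (DU F)) + 3 * D u * D (D u) * γ (DU (DU F))
        + D (D (D u)) * γ (DU F) := by
  constructor <;>
  · simp only [hX, map_add, Derivation.leibniz, smul_eq_mul, hc]
    ring

/-- The affine vector fields are symmetries of the Korteweg-de Vries equation. -/
theorem lieForm_affine {dT dX : Derivation ℝ R R} {u a b c : R} {k₁ k₃ : ℝ}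
    (hTa : dT a = algebraMap ℝ R (-(3 / 2) * k₁)) (hXa : dX a = 0)
    (hTb : dT b = algebraMap ℝ R (6 * k₃)) (hXb : dX b = algebraMap ℝ R (-(1 / 2) * k₁))
    (hc : c = algebraMap ℝ R k₁ * u + algebraMap ℝ R k₃) :
    lieForm dT dX u a b c = algebraMap ℝ R (5 / 2 * k₁) * kdvForm dT dX u := by
  -- Fractions are polynomials in `κ = 1/2` with `2κ = 1`, so that the final identity is one of
  -- commutative rings.
  have h : algebraMap ℝ R (1 / 2) * 2 = 1 := by
    rw [← map_ofNat (algebraMap ℝ R) 2, ← map_mul]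
    norm_num
  -- `5/2 = 1 + 3/2` is the scaling weight of `u_T`: weight `1` for `u` and `3/2` for `∂_T`.
  have h5 : algebraMap ℝ R (5 / 2 * k₁) = 5 * algebraMap ℝ R (1 / 2) * algebraMap ℝ R k₁ := by
    rw [← map_ofNat (algebraMap ℝ R) 5, ← map_mul, ← map_mul]
    norm_num
  have h3 : algebraMap ℝ R (-(3 / 2) * k₁) = -3 * algebraMap ℝ R (1 / 2) * algebraMap ℝ R k₁ := by
    rw [← map_ofNat (algebraMap ℝ R) 3, ← map_neg, ← map_mul, ← map_mul]
    norm_num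
  have h6 : algebraMap ℝ R (6 * k₃) = 6 * algebraMap ℝ R k₃ := by
    rw [← map_ofNat (algebraMap ℝ R) 6, ← map_mul]
  have h1 : algebraMap ℝ R (-(1 / 2) * k₁) = -algebraMap ℝ R (1 / 2) * algebraMap ℝ R k₁ := by
    rw [← map_neg, ← map_mul]
  simp only [lieForm, prolong, prolongX, kdvForm, hTa, hXa, hTb, hXb, hc, map_sub, map_add,
    map_neg, Derivation.leibniz, smul_eq_mul, Derivation.map_algebraMap, h5, h3, h6, h1,
    Function.iterate_succ, Function.iterate_zero, Function.comp_apply, id, mul_zero, map_zero]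
  generalize algebraMap ℝ R (1 / 2) = κ at *
  generalize algebraMap ℝ R k₁ = x at *
  generalize algebraMap ℝ R k₃ = y at *
  linear_combination (-(x * (dT u + 12 * u * dX u + dX (dX (dX u))))) * h

/-- The conformable prolongation coefficients of first order are the prolongation coefficients
with respect to the weighted derivations `s ∂_t` and `w ∂_x`. -/
theorem prolong_weighted {t x dT dX : Derivation ℝ R R} {s w r l u a b c : R}
    (hT : ∀ f, dT f = s * t f) (hX : ∀ f, dX f = w * x f)
    (htw : t w = 0) (hts : t s = l * s * r) :
    prolong dT dX dT u a b c
      = s * prolong t x t u (s * a) (w * b) c + l * (s * a) * (s * r) * t u := by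
  simp only [prolong, hT, hX, Derivation.leibniz, smul_eq_mul, htw, hts]
  ring

/-- The conformable prolongation coefficients in the direction of `x` are the prolongation
coefficients with respect to the weighted derivations `s ∂_t` and `w ∂_x`. -/
theorem prolongX_weighted {t x dT dX : Derivation ℝ R R} {s w r l u a b c : R}
    (hT : ∀ f, dT f = s * t f) (hX : ∀ f, dX f = w * x f)
    (htw : t w = 0) (htr : t r = 0) (hxs : x s = 0) (hxw : x w = l * w * r) (hxr : x r = -r ^ 2)
    (hxl : x l = 0) (htl : t l = 0) :
    prolongX dT dX u a b c 1
        = w * prolongX t x u (s * a) (w * b) c 1 + l * (w * b) * (w * r) * x u ∧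
      prolongX dT dX u a b c 3
        = w ^ 3 * prolongX t x u (s * a) (w * b) c 3
          + 3 * l * (w ^ 3 * r) * prolongX t x u (s * a) (w * b) c 2
          + l * (2 * l - 1) * (w ^ 3 * r ^ 2) * prolongX t x u (s * a) (w * b) c 1
          + 3 * l * (w * b) * (w ^ 3 * r) * x (x (x u))
          + 3 * l * (3 * l - 1) * (w * b) * (w ^ 3 * r ^ 2) * x (x u)
          + l * (2 * l - 1) * (3 * l - 2) * (w * b) * (w ^ 3 * r ^ 3) * x u := by
  constructor
  · simp only [prolong, prolongX, hT, hX, Derivation.leibniz, smul_eq_mul, hxs, hxw,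
      Function.iterate_zero, id]
    ring
  · simp only [prolong, prolongX, hT, hX, Derivation.leibniz, smul_eq_mul, hxs, hxw, hxr, hxl,
      htw, htr, htl, map_add, map_sub, map_neg, Derivation.leibniz_pow, map_zero,
      Function.iterate_succ, Function.iterate_zero, Function.comp_apply, id]
    ring

end Prolongation

/-! ### Conformable derivatives in the `(t, x)` quadrant as derivations. -/

section Plane

/-- The open set of `(t, x)` with `t > 0` and `x > 0`. -/
def quadrantTX : Set (ℝ × ℝ) := {p | 0 < p.1 ∧ 0 < p.2}

/-- The coordinate `t` of `(t, x)`. -/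
abbrev coordT : ℝ × ℝ →L[ℝ] ℝ := ContinuousLinearMap.fst ℝ ℝ ℝ

/-- The coordinate `x` of `(t, x)`. -/
abbrev coordX : ℝ × ℝ →L[ℝ] ℝ := ContinuousLinearMap.snd ℝ ℝ ℝ

variable {W : Opens (ℝ × ℝ)}

theorem coordT_pos (hW : (W : Set (ℝ × ℝ)) ⊆ quadrantTX) : ∀ p ∈ W, 0 < coordT p :=
  fun _ hp => (hW hp).1

theorem coordX_pos (hW : (W : Set (ℝ × ℝ)) ⊆ quadrantTX) : ∀ p ∈ W, 0 < coordX p :=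
  fun _ hp => (hW hp).2

/-- The derivation `∂/∂t`. -/
abbrev pdT : Derivation ℝ (SmoothFn W) (SmoothFn W) := pd (1, 0)

/-- The derivation `∂/∂x`. -/
abbrev pdX : Derivation ℝ (SmoothFn W) (SmoothFn W) := pd (0, 1)

/-- The conformable derivation with respect to `t`. -/
def dT (β : ℝ) (hW : (W : Set (ℝ × ℝ)) ⊆ quadrantTX) : Derivation ℝ (SmoothFn W) (SmoothFn W) :=
  conf β coordT (coordT_pos hW) (1, 0)

/-- The conformable derivation with respect to `x`. -/
def dX (α : ℝ) (hW : (W : Set (ℝ × ℝ)) ⊆ quadrantTX) : Derivation ℝ (SmoothFn W) (SmoothFn W) :=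
  conf α coordX (coordX_pos hW) (0, 1)

theorem dX_dT (α β : ℝ) (hW : (W : Set (ℝ × ℝ)) ⊆ quadrantTX) (f : SmoothFn W) :
    dX α hW (dT β hW f) = dT β hW (dX α hW f) :=
  conf_comm _ _ _ _ (by simp) (by simp) f

/-- The function `g` agrees with `f` on the domain of `f`. -/
def Represents (g : ℝ × ℝ → ℝ) (f : SmoothFn W) : Prop :=
  ∀ p (hp : p ∈ W), g p = ev hp f

theorem represents_of {g : ℝ × ℝ → ℝ} (hg : ContDiffOn ℝ ∞ g W) : Represents g (of g hg) :=
  fun _ _ => rfl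

theorem Represents.mul {g₁ g₂ : ℝ × ℝ → ℝ} {f₁ f₂ : SmoothFn W} (h₁ : Represents g₁ f₁)
    (h₂ : Represents g₂ f₂) : Represents (fun p => g₁ p * g₂ p) (f₁ * f₂) :=
  fun p hp => by simp [h₁ p hp, h₂ p hp]

theorem Represents.sub {g₁ g₂ : ℝ × ℝ → ℝ} {f₁ f₂ : SmoothFn W} (h₁ : Represents g₁ f₁)
    (h₂ : Represents g₂ f₂) : Represents (fun p => g₁ p - g₂ p) (f₁ - f₂) :=
  fun p hp => by simp [h₁ p hp, h₂ p hp]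

theorem Represents.hasFDerivAt {g : ℝ × ℝ → ℝ} {f : SmoothFn W} (h : Represents g f) {p : ℝ × ℝ}
    (hp : p ∈ W) : HasFDerivAt g (fderiv ℝ (rep f) p) p := by
  refine (differentiableAt_of (contDiffOn_rep f) hp).hasFDerivAt.congr_of_eventuallyEq ?_
  filter_upwards [W.isOpen.mem_nhds hp] with q hq
  rw [h q hq, rep_eq f hq]

theorem Represents.partialT {g : ℝ × ℝ → ℝ} {f : SmoothFn W} (h : Represents g f) :
    Represents (partialT g) (pd (1, 0) f) := fun p hp => by
  have hl : HasDerivAt (fun s : ℝ => (s, p.2)) ((1, 0) : ℝ × ℝ) p.1 :=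
    (hasDerivAt_id _).prodMk (hasDerivAt_const _ _)
  exact ((h.hasFDerivAt hp).comp_hasDerivAt (f := fun s : ℝ => (s, p.2)) p.1 hl).deriv

theorem Represents.partialX {g : ℝ × ℝ → ℝ} {f : SmoothFn W} (h : Represents g f) :
    Represents (partialX g) (pd (0, 1) f) := fun p hp => by
  have hl : HasDerivAt (fun s : ℝ => (p.1, s)) ((0, 1) : ℝ × ℝ) p.2 :=
    (hasDerivAt_const _ _).prodMk (hasDerivAt_id _)
  exact ((h.hasFDerivAt hp).comp_hasDerivAt (f := fun s : ℝ => (p.1, s)) p.2 hl).deriv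

/-- The chain rule for the affine map `ε ↦ t + ε t^{1-α}` at `ε = 0`. -/
theorem conformableDeriv_eq {f : ℝ → ℝ} {t f' : ℝ} (α : ℝ) (h : HasDerivAt f f' t) :
    conformableDeriv α f t = t ^ (1 - α) * f' := by
  have hl : HasDerivAt (fun ε : ℝ => t + ε * t ^ (1 - α)) (t ^ (1 - α)) 0 := by
    simpa using ((hasDerivAt_id (0 : ℝ)).mul_const (t ^ (1 - α))).const_add t
  have h' : HasDerivAt f f' (t + 0 * t ^ (1 - α)) := by simpa using h
  rw [mul_comm]
  exact (h'.comp (0 : ℝ) hl).deriv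

theorem Represents.conformableT {g : ℝ × ℝ → ℝ} {f : SmoothFn W} (β : ℝ)
    (hW : (W : Set (ℝ × ℝ)) ⊆ quadrantTX) (h : Represents g f) :
    Represents (conformableT β g) (dT β hW f) := fun p hp => by
  have hl : HasDerivAt (fun s : ℝ => (s, p.2)) ((1, 0) : ℝ × ℝ) p.1 :=
    (hasDerivAt_id _).prodMk (hasDerivAt_const _ _)
  rw [dT, ev_conf]
  exact conformableDeriv_eq β
    ((h.hasFDerivAt hp).comp_hasDerivAt (f := fun s : ℝ => (s, p.2)) p.1 hl)

theorem Represents.conformableX {g : ℝ × ℝ → ℝ} {f : SmoothFn W} (α : ℝ)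
    (hW : (W : Set (ℝ × ℝ)) ⊆ quadrantTX) (h : Represents g f) :
    Represents (conformableX α g) (dX α hW f) := fun p hp => by
  have hl : HasDerivAt (fun s : ℝ => (p.1, s)) ((0, 1) : ℝ × ℝ) p.2 :=
    (hasDerivAt_const _ _).prodMk (hasDerivAt_id _)
  rw [dX, ev_conf]
  exact conformableDeriv_eq α
    ((h.hasFDerivAt hp).comp_hasDerivAt (f := fun s : ℝ => (p.1, s)) p.2 hl)

theorem Represents.kdv {g : ℝ × ℝ → ℝ} {f : SmoothFn W} (α β : ℝ)
    (hW : (W : Set (ℝ × ℝ)) ⊆ quadrantTX) (h : Represents g f) :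
    Represents (kdv α β g) (kdvForm (dT β hW) (dX α hW) f) := fun p hp => by
  have h3 := ((h.conformableX α hW).conformableX α hW).conformableX α hW p hp
  simp only [FracKdV.kdv, kdvForm, map_add, map_mul, map_ofNat, ← h p hp,
    ← h.conformableT β hW p hp, ← h.conformableX α hW p hp, ← h3]
  rfl

theorem isSolution_iff {g : ℝ × ℝ → ℝ} (α β : ℝ) (hW : (W : Set (ℝ × ℝ)) ⊆ quadrantTX)
    (hg : ContDiffOn ℝ ∞ g W) :
    IsSolution α β W g ↔ kdvForm (dT β hW) (dX α hW) (of g hg) = 0 := by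
  have h := (represents_of hg).kdv α β hW
  constructor
  · intro hs
    refine ext_ev fun p hp => ?_
    rw [← h p hp, map_zero]
    exact hs.2 p hp
  · intro hs
    refine ⟨hg, fun p hp => ?_⟩
    rw [h p hp, hs, map_zero]

end Plane

/-! ### Functions of `(t, x, u)`, total derivatives on graphs, and the infinitesimal criterion. -/

section Space

variable {Ω : Opens (ℝ × ℝ × ℝ)} {W : Opens (ℝ × ℝ)}

/-- The coordinate `t` of `(t, x, u)`. -/
abbrev coordT' : ℝ × ℝ × ℝ →L[ℝ] ℝ := ContinuousLinearMap.fst ℝ ℝ (ℝ × ℝ)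

/-- The coordinate `x` of `(t, x, u)`. -/
abbrev coordX' : ℝ × ℝ × ℝ →L[ℝ] ℝ :=
  (ContinuousLinearMap.fst ℝ ℝ ℝ).comp (ContinuousLinearMap.snd ℝ ℝ (ℝ × ℝ))

theorem coordT'_pos (hΩ : (Ω : Set (ℝ × ℝ × ℝ)) ⊆ quadrant) : ∀ p ∈ Ω, 0 < coordT' p :=
  fun _ hp => (hΩ hp).1

theorem coordX'_pos (hΩ : (Ω : Set (ℝ × ℝ × ℝ)) ⊆ quadrant) : ∀ p ∈ Ω, 0 < coordX' p :=
  fun _ hp => (hΩ hp).2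

/-- The conformable derivation with respect to `t` on functions of `(t, x, u)`. -/
def eT (β : ℝ) (hΩ : (Ω : Set (ℝ × ℝ × ℝ)) ⊆ quadrant) :
    Derivation ℝ (SmoothFn Ω) (SmoothFn Ω) :=
  conf β coordT' (coordT'_pos hΩ) (1, 0, 0)

/-- The conformable derivation with respect to `x` on functions of `(t, x, u)`. -/
def eX (α : ℝ) (hΩ : (Ω : Set (ℝ × ℝ × ℝ)) ⊆ quadrant) :
    Derivation ℝ (SmoothFn Ω) (SmoothFn Ω) :=
  conf α coordX' (coordX'_pos hΩ) (0, 1, 0)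

/-- The derivation with respect to `u` on functions of `(t, x, u)`. -/
def eU : Derivation ℝ (SmoothFn Ω) (SmoothFn Ω) := pd (0, 0, 1)

theorem eX_eT (α β : ℝ) (hΩ : (Ω : Set (ℝ × ℝ × ℝ)) ⊆ quadrant) (f : SmoothFn Ω) :
    eX α hΩ (eT β hΩ f) = eT β hΩ (eX α hΩ f) :=
  conf_comm _ _ _ _ (by simp) (by simp) f

theorem eU_eT (β : ℝ) (hΩ : (Ω : Set (ℝ × ℝ × ℝ)) ⊆ quadrant) (f : SmoothFn Ω) :
    eU (eT β hΩ f) = eT β hΩ (eU f) :=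
  (conf_pd_comm _ _ (by simp) f).symm

theorem eU_eX (α : ℝ) (hΩ : (Ω : Set (ℝ × ℝ × ℝ)) ⊆ quadrant) (f : SmoothFn Ω) :
    eU (eX α hΩ f) = eX α hΩ (eU f) :=
  (conf_pd_comm _ _ (by simp) f).symm

theorem contDiffOn_graph {u : ℝ × ℝ → ℝ} (hu : ContDiffOn ℝ ∞ u W) :
    ContDiffOn ℝ ∞ (fun p : ℝ × ℝ => (p.1, p.2, u p)) W :=
  contDiffOn_fst.prodMk (contDiffOn_snd.prodMk hu)

/-- Restriction of functions of `(t, x, u)` to the graph of a function of `(t, x)`. -/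
def onGraph {u : ℝ × ℝ → ℝ} (hu : ContDiffOn ℝ ∞ u W) (hg : ∀ p ∈ W, (p.1, p.2, u p) ∈ Ω) :
    SmoothFn Ω →ₐ[ℝ] SmoothFn W :=
  pull (fun p => (p.1, p.2, u p)) (contDiffOn_graph hu) hg

variable {u : ℝ × ℝ → ℝ} (hu : ContDiffOn ℝ ∞ u W) (hg : ∀ p ∈ W, (p.1, p.2, u p) ∈ Ω)

theorem ev_onGraph (F : SmoothFn Ω) {p : ℝ × ℝ} (hp : p ∈ W) :
    ev hp (onGraph hu hg F) = ev (hg p hp) F :=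
  ev_pull _ _ F hp

theorem ev_pd_onGraph (F : SmoothFn Ω) {p : ℝ × ℝ} (hp : p ∈ W) (v : ℝ × ℝ) :
    ev hp (pd v (onGraph hu hg F))
      = ev (hg p hp) (pd (v.1, v.2, 0) F) + fderiv ℝ u p v * ev (hg p hp) (pd (0, 0, 1) F) := by
  have hd := (differentiableAt_of hu hp).hasFDerivAt
  have h : fderiv ℝ (fun p : ℝ × ℝ => (p.1, p.2, u p)) p v
      = (v.1, v.2, 0) + fderiv ℝ u p v • ((0, 0, 1) : ℝ × ℝ × ℝ) := by
    rw [(hasFDerivAt_fst.prodMk (hasFDerivAt_snd.prodMk hd)).fderiv]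
    simp
  rw [onGraph, ev_pd_pull, h, map_add, map_smul, ev_pd, ev_pd, smul_eq_mul]

/-- The total derivative `D_T F = F_T + u_T F_u`. The weight `t^{1-β}` factors out because the graph
map preserves `t`. -/
theorem dT_onGraph (β : ℝ) (hW : (W : Set (ℝ × ℝ)) ⊆ quadrantTX)
    (hΩ : (Ω : Set (ℝ × ℝ × ℝ)) ⊆ quadrant) (F : SmoothFn Ω) :
    dT β hW (onGraph hu hg F)
      = onGraph hu hg (eT β hΩ F) + dT β hW (of u hu) * onGraph hu hg (eU F) := by
  refine ext_ev fun p hp => ?_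
  simp only [dT, eT, eU, conf_apply, map_mul, map_add, ev_pd_onGraph, ev_onGraph, ev_powFn,
    ev_pd_of]
  simp only [ContinuousLinearMap.coe_fst']
  ring

theorem dX_onGraph (α : ℝ) (hW : (W : Set (ℝ × ℝ)) ⊆ quadrantTX)
    (hΩ : (Ω : Set (ℝ × ℝ × ℝ)) ⊆ quadrant) (F : SmoothFn Ω) :
    dX α hW (onGraph hu hg F)
      = onGraph hu hg (eX α hΩ F) + dX α hW (of u hu) * onGraph hu hg (eU F) := by
  refine ext_ev fun p hp => ?_
  simp only [dX, eX, eU, conf_apply, map_mul, map_add, ev_pd_onGraph, ev_onGraph, ev_powFn,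
    ev_pd_of]
  simp only [ContinuousLinearMap.comp_apply, ContinuousLinearMap.coe_fst',
    ContinuousLinearMap.coe_snd']
  ring

variable {V : ℝ × ℝ × ℝ → ℝ × ℝ × ℝ}

/-- The component `t^{β-1} τ` of a vector field in the coordinate `t^β / β`. -/
def tauFn (β : ℝ) (hΩ : (Ω : Set (ℝ × ℝ × ℝ)) ⊆ quadrant) (hV : ContDiffOn ℝ ∞ V Ω) :
    SmoothFn Ω :=
  powFn coordT' (coordT'_pos hΩ) (β - 1) * of (fun q => (V q).1) hV.fst

/-- The component `x^{α-1} ξ` of a vector field in the coordinate `x^α / α`. -/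
def xiFn (α : ℝ) (hΩ : (Ω : Set (ℝ × ℝ × ℝ)) ⊆ quadrant) (hV : ContDiffOn ℝ ∞ V Ω) :
    SmoothFn Ω :=
  powFn coordX' (coordX'_pos hΩ) (α - 1) * of (fun q => (V q).2.1) hV.snd.fst

/-- The component `η` of a vector field. -/
def etaFn (hV : ContDiffOn ℝ ∞ V Ω) : SmoothFn Ω := of (fun q => (V q).2.2) hV.snd.snd

/-- The linearized Korteweg-de Vries expression of a vector field on the graph of `u`. -/
def lieOn (α β : ℝ) (hW : (W : Set (ℝ × ℝ)) ⊆ quadrantTX)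
    (hΩ : (Ω : Set (ℝ × ℝ × ℝ)) ⊆ quadrant) (hV : ContDiffOn ℝ ∞ V Ω) : SmoothFn W :=
  lieForm (dT β hW) (dX α hW) (of u hu) (onGraph hu hg (tauFn β hΩ hV))
    (onGraph hu hg (xiFn α hΩ hV)) (onGraph hu hg (etaFn hV))

theorem Represents.prolong {f g a b : ℝ × ℝ → ℝ} {A B G U : SmoothFn W} (rf : Represents f U)
    (rτ : Represents a A) (rξ : Represents b B) (rg : Represents g G) :
    Represents (fun p => FracKdV.partialT g p - FracKdV.partialX f p * FracKdV.partialT b p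
        - FracKdV.partialT f p * FracKdV.partialT a p)
        (FracKdV.prolong pdT pdX pdT U A B G) ∧
      Represents (fun p => FracKdV.partialX g p - FracKdV.partialX f p * FracKdV.partialX b p
        - FracKdV.partialT f p * FracKdV.partialX a p)
        (FracKdV.prolong pdT pdX pdX U A B G) :=
  ⟨(rg.partialT.sub (rf.partialX.mul rξ.partialT)).sub (rf.partialT.mul rτ.partialT),
    (rg.partialX.sub (rf.partialX.mul rξ.partialX)).sub (rf.partialT.mul rτ.partialX)⟩

/-- The prolongation coefficients as functions of `(t, x)`. -/
theorem represents_prolong {A B C U : SmoothFn W} (ru : Represents u U)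
    (rτ : Represents (tauOn V u) A) (rξ : Represents (xiOn V u) B) (rη : Represents (etaOn V u) C) :
    Represents (etaT V u) (prolong pdT pdX pdT U A B C) ∧
      Represents (etaX V u) (prolongX pdT pdX U A B C 1) ∧
      Represents (etaXX V u) (prolongX pdT pdX U A B C 2) ∧
      Represents (etaXXX V u) (prolongX pdT pdX U A B C 3) := by
  have r1 := (ru.prolong rτ rξ rη).2
  have r2 := (ru.partialX.prolong rτ rξ r1).2
  have r3 := (ru.partialX.partialX.prolong rτ rξ r2).2
  exact ⟨(ru.prolong rτ rξ rη).1, r1, r2, r3⟩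

theorem represents_tauOn (β : ℝ) (hW : (W : Set (ℝ × ℝ)) ⊆ quadrantTX)
    (hΩ : (Ω : Set (ℝ × ℝ × ℝ)) ⊆ quadrant) (hV : ContDiffOn ℝ ∞ V Ω) :
    Represents (tauOn V u)
      (powFn coordT (coordT_pos hW) (1 - β) * onGraph hu hg (tauFn β hΩ hV)) := fun q hq => by
  have h := (hW hq).1
  simp only [map_mul, ev_onGraph, tauFn, ev_powFn, ev_of, tauOn]
  rw [← mul_assoc]
  simp only [ContinuousLinearMap.coe_fst', ← Real.rpow_add h]
  simp

theorem represents_xiOn (α : ℝ) (hW : (W : Set (ℝ × ℝ)) ⊆ quadrantTX)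
    (hΩ : (Ω : Set (ℝ × ℝ × ℝ)) ⊆ quadrant) (hV : ContDiffOn ℝ ∞ V Ω) :
    Represents (xiOn V u)
      (powFn coordX (coordX_pos hW) (1 - α) * onGraph hu hg (xiFn α hΩ hV)) := fun q hq => by
  have h := (hW hq).2
  simp only [map_mul, ev_onGraph, xiFn, ev_powFn, ev_of, xiOn]
  rw [← mul_assoc]
  simp only [ContinuousLinearMap.comp_apply, ContinuousLinearMap.coe_fst',
    ContinuousLinearMap.coe_snd', ← Real.rpow_add h]
  simp

/-- The lower-order terms of the conformable coefficients are exactly what arises when the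
derivations hit the weights in `t^{1-β}∂_t`, `x^{1-α}∂_x`, `τ = t^{1-β}a` and `ξ = x^{1-α}b`. -/
theorem ev_lieForm {a b c U : SmoothFn W} (ru : Represents u U) (α β : ℝ)
    (hW : (W : Set (ℝ × ℝ)) ⊆ quadrantTX)
    (rτ : Represents (tauOn V u) (powFn coordT (coordT_pos hW) (1 - β) * a))
    (rξ : Represents (xiOn V u) (powFn coordX (coordX_pos hW) (1 - α) * b))
    (rη : Represents (etaOn V u) c) {p : ℝ × ℝ} (hp : p ∈ W) :
    ev hp (lieForm (dT β hW) (dX α hW) U a b c)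
      = 6 * etaOn V u p * conformableX α u p + fracEtaT β V u p + 6 * u p * fracEtaX α V u p
      + fracEtaXXX α V u p := by
  obtain ⟨r0, r1, r2, r3⟩ := represents_prolong ru rτ rξ rη
  have pT : ∀ r : ℝ, pd (0, 1) (powFn coordT (coordT_pos hW) r) = 0 := fun r => by simp [pd_powFn]
  have pX : ∀ r : ℝ, pd (1, 0) (powFn coordX (coordX_pos hW) r) = 0 := fun r => by simp [pd_powFn]
  -- The weight `s = t^{1-β}` satisfies `s' = l s r` with `l = 1 - β` and `r = t⁻¹`; below,
  -- `x^{1-α}` is treated in the same way.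
  have eqT := prolong_weighted (dT := dT β hW) (dX := dX α hW) (r := powFn coordT (coordT_pos hW) (-1))
    (l := algebraMap ℝ _ (1 - β)) (u := U) (a := a) (b := b) (c := c)
    (conf_apply (coordT_pos hW) β (1, 0)) (conf_apply (coordX_pos hW) α (0, 1)) (pX _) (by
      rw [pd_powFn, mul_assoc, ← powFn_add, Algebra.smul_def]
      simp [sub_eq_add_neg])
  obtain ⟨eq1, eq3⟩ := prolongX_weighted (dT := dT β hW) (dX := dX α hW) (r := powFn coordX (coordX_pos hW) (-1))
    (l := algebraMap ℝ _ (1 - α)) (u := U) (a := a) (b := b) (c := c)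
    (conf_apply (coordT_pos hW) β (1, 0)) (conf_apply (coordX_pos hW) α (0, 1))
    (pX _) (pX _) (pT _) (by
      rw [pd_powFn, mul_assoc, ← powFn_add, Algebra.smul_def]
      simp [sub_eq_add_neg]) (by
      rw [pd_powFn, pow_two, ← powFn_add]
      norm_num) (Derivation.map_algebraMap _ _) (Derivation.map_algebraMap _ _)
  have hp1 := (hW hp).1
  have hp2 := (hW hp).2
  have rX : ev hp (dX α hW U) = conformableX α u p := (ru.conformableX α hW p hp).symm
  rw [lieForm, eqT, eq1, eq3]
  simp only [map_add, map_mul, map_ofNat, map_sub, map_one, ← r0 p hp, ← r1 p hp, ← r2 p hp,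
    ← r3 p hp, ← rη p hp, ← rτ p hp, ← rξ p hp, ← ru p hp, map_pow, ← ru.partialX p hp,
    ← ru.partialT p hp, ← ru.partialX.partialX p hp, ← ru.partialX.partialX.partialX p hp,
    AlgHom.commutes, rX, ev_powFn]
  -- Every power of `x` becomes a monomial in `x^{1-α}` and `x⁻¹`, after which the comparison is
  -- polynomial.
  have hw : ∀ (n : ℕ) (e : ℝ), e = 3 - n - 3 * α →
      p.2 ^ e = (p.2 ^ (1 - α)) ^ 3 * (p.2 ^ (-1 : ℝ)) ^ n := by
    rintro n e rfl
    rw [← Real.rpow_mul_natCast hp2.le, ← Real.rpow_mul_natCast hp2.le, ← Real.rpow_add hp2]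
    congr 1
    push_cast
    ring
  have hx : p.2 ^ (-α) = p.2 ^ (1 - α) * p.2 ^ (-1 : ℝ) := by
    rw [← Real.rpow_add hp2]
    congr 1
    ring
  have ht : p.1 ^ (-β) = p.1 ^ (1 - β) * p.1 ^ (-1 : ℝ) := by
    rw [← Real.rpow_add hp1]
    congr 1
    ring
  simp only [fracEtaT, fracEtaX, fracEtaXXX, hx, ht, hw 0 (3 - 3 * α) (by norm_num),
    hw 1 (2 - 3 * α) (by norm_num), hw 2 (1 - 3 * α) (by norm_num), hw 3 (-3 * α) (by norm_num),
    ContinuousLinearMap.coe_fst', ContinuousLinearMap.coe_snd', Algebra.algebraMap_self_apply]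
  ring

/-- The expression in Lie's criterion in terms of weighted derivations. -/
theorem ev_lieOn (α β : ℝ) (hW : (W : Set (ℝ × ℝ)) ⊆ quadrantTX)
    (hΩ : (Ω : Set (ℝ × ℝ × ℝ)) ⊆ quadrant) (hV : ContDiffOn ℝ ∞ V Ω) {p : ℝ × ℝ} (hp : p ∈ W) :
    ev hp (lieOn hu hg α β hW hΩ hV)
      = 6 * etaOn V u p * conformableX α u p + fracEtaT β V u p + 6 * u p * fracEtaX α V u p
      + fracEtaXXX α V u p :=
  ev_lieForm (represents_of hu) α β hW (represents_tauOn hu hg β hW hΩ hV)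
    (represents_xiOn hu hg α hW hΩ hV)
    (fun q hq => by simp only [ev_onGraph, etaFn, ev_of, etaOn]) hp

end Space

/-! ### Local solutions with prescribed jets. -/

section LocalSolutions

/-- A function that is smooth near `p` agrees near `p` with a globally smooth function. -/
theorem exists_contDiff_eqOn {E : Type*} [NormedAddCommGroup E] [NormedSpace ℝ E]
    [FiniteDimensional ℝ E] {U : Set E} (hU : IsOpen U) {g : E → ℝ} (hg : ContDiffOn ℝ ∞ g U)
    {p : E} (hp : p ∈ U) :
    ∃ u : E → ℝ, ContDiff ℝ ∞ u ∧ ∃ W : Opens E, p ∈ W ∧ (W : Set E) ⊆ U ∧ Set.EqOn u g W := by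
  obtain ⟨r, hr, hrU⟩ := Metric.nhds_basis_closedBall.mem_iff.1 (hU.mem_nhds hp)
  let χ : ContDiffBump p := ⟨r / 2, r, by positivity, by linarith⟩
  refine ⟨fun q => χ q * g q, contDiff_iff_contDiffAt.2 fun q => ?_,
    ⟨Metric.ball p (r / 2), Metric.isOpen_ball⟩, Metric.mem_ball_self (by positivity), ?_, ?_⟩
  · by_cases hq : q ∈ U
    · exact χ.contDiff.contDiffAt.mul (hg.contDiffAt (hU.mem_nhds hq))
    · have hq' : q ∉ tsupport χ := by
        rw [χ.tsupport_eq]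
        exact fun h => hq (hrU h)
      have h0 : (fun q => χ q * g q) =ᶠ[nhds q] fun _ => 0 := by
        filter_upwards [notMem_tsupport_iff_eventuallyEq.1 hq'] with z hz
        simp [hz]
      exact contDiffAt_const.congr_of_eventuallyEq h0
  · exact ((Metric.ball_subset_ball (by linarith)).trans Metric.ball_subset_closedBall).trans hrU
  · intro q hq
    have : χ q = 1 := χ.one_of_mem_closedBall (Metric.ball_subset_closedBall hq)
    simp [this]

/-- Integral curves of smooth vector fields are smooth. -/
theorem contDiffOn_integralCurve {E : Type*} [NormedAddCommGroup E] [NormedSpace ℝ E]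
    {F : E → E} (hF : ContDiff ℝ ∞ F) {y : ℝ → E} {I : Set ℝ} (hI : IsOpen I)
    (hy : ∀ s ∈ I, HasDerivAt y (F (y s)) s) : ContDiffOn ℝ ∞ y I := by
  refine contDiffOn_infty.2 fun n => ?_
  -- Bootstrapping: if `y` is `C^n`, then so is `y' = F ∘ y`, hence `y` is `C^{n+1}`.
  induction n with
  | zero =>
    exact contDiffOn_zero.2 fun s hs => (hy s hs).continuousAt.continuousWithinAt
  | succ n ih =>
    have h := (contDiffOn_succ_iff_deriv_of_isOpen (n := n) (f := y) hI).2
      ⟨fun s hs => (hy s hs).differentiableAt.differentiableWithinAt, by simp,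
        ((hF.of_le (by exact_mod_cast le_top)).comp_contDiffOn ih).congr
          fun s hs => (hy s hs).deriv⟩
    exact_mod_cast h

/-- Local solutions of `f''' = v f' - 6 f f' - c` with arbitrary initial values. -/
theorem exists_profile (f₀ f₁ f₂ v c : ℝ) : ∃ r > 0, ∃ f f' f'' : ℝ → ℝ,
    f 0 = f₀ ∧ f' 0 = f₁ ∧ f'' 0 = f₂ ∧
    ContDiffOn ℝ ∞ f (Set.Ioo (-r) r) ∧ ContDiffOn ℝ ∞ f' (Set.Ioo (-r) r) ∧
    ContDiffOn ℝ ∞ f'' (Set.Ioo (-r) r) ∧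
    ∀ s ∈ Set.Ioo (-r) r, HasDerivAt f (f' s) s ∧ HasDerivAt f' (f'' s) s ∧
      HasDerivAt f'' (v * f' s - 6 * f s * f' s - c) s := by
  let F : ℝ × ℝ × ℝ → ℝ × ℝ × ℝ := fun y => (y.2.1, y.2.2, v * y.2.1 - 6 * y.1 * y.2.1 - c)
  have hF : ContDiff ℝ ∞ F := by fun_prop
  obtain ⟨y, hy0, r, hr, hy⟩ :=
    (hF.of_le (by norm_num : (1 : ℕ∞ω) ≤ ∞)).contDiffAt (x := (f₀, f₁, f₂))
      |>.exists_forall_mem_closedBall_exists_eq_forall_mem_Ioo_hasDerivAt₀ 0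
  simp only [zero_sub, zero_add] at hy
  have hs := contDiffOn_integralCurve hF isOpen_Ioo hy
  refine ⟨r, hr, fun s => (y s).1, fun s => (y s).2.1, fun s => (y s).2.2, by simp [hy0],
    by simp [hy0], by simp [hy0], hs.fst, hs.snd.fst, hs.snd.snd, fun s hs => ?_⟩
  have h := (hy s hs).hasFDerivAt
  exact ⟨h.fst.hasDerivAt.congr_deriv (by simp [F]), h.snd.fst.hasDerivAt.congr_deriv (by simp [F]),
    h.snd.snd.hasDerivAt.congr_deriv (by simp [F])⟩

/-- The chain rule for functions of one variable. -/
theorem pd_comp {E : Type*} [NormedAddCommGroup E] [NormedSpace ℝ E] {W : Opens E} {s : E → ℝ}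
    (hs : ContDiffOn ℝ ∞ s W) {g g' : ℝ → ℝ} {I : Set ℝ} (hsI : ∀ p ∈ W, s p ∈ I)
    (hg : ContDiffOn ℝ ∞ g I) (hg' : ContDiffOn ℝ ∞ g' I) (h : ∀ z ∈ I, HasDerivAt g (g' z) z)
    (v : E) :
    pd v (of (fun p => g (s p)) (hg.comp hs hsI))
      = of (fun p => g' (s p)) (hg'.comp hs hsI) * pd v (of s hs) := by
  refine ext_ev fun p hp => ?_
  rw [map_mul, ev_pd_of, ev_pd_of, ev_of]
  have := ((h _ (hsI p hp)).comp_hasFDerivAt p (differentiableAt_of hs hp).hasFDerivAt).fderiv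
  exact (DFunLike.congr_fun this v).trans (by simp)

theorem isOpen_quadrantTX : IsOpen quadrantTX :=
  (isOpen_lt continuous_const continuous_fst).inter (isOpen_lt continuous_const continuous_snd)

/-- Every point and every choice of the jet coordinates `u_x`, `u_xx`, `u_t` extends to a local
solution on which moreover `u_tx = -v u_xx` and `u_txx = -v u_xxx`. -/
theorem exists_solution {Ω : Opens (ℝ × ℝ × ℝ)} {α β : ℝ} (hα : 0 < α) (hβ : 0 < β)
    (hΩ : (Ω : Set (ℝ × ℝ × ℝ)) ⊆ quadrant) {q : ℝ × ℝ × ℝ} (hq : q ∈ Ω) (f₁ f₂ v h : ℝ) :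
    ∃ (W : Opens (ℝ × ℝ)) (hW : (W : Set (ℝ × ℝ)) ⊆ quadrantTX) (u : ℝ × ℝ → ℝ)
      (hu : ContDiff ℝ ∞ u) (_ : ∀ p ∈ W, (p.1, p.2, u p) ∈ Ω) (hp : (q.1, q.2.1) ∈ W),
      kdvForm (dT β hW) (dX α hW) (of u hu.contDiffOn) = 0 ∧
      u (q.1, q.2.1) = q.2.2 ∧
      ev hp (dX α hW (of u hu.contDiffOn)) = f₁ ∧
      ev hp (dX α hW (dX α hW (of u hu.contDiffOn))) = f₂ ∧
      ev hp (dT β hW (of u hu.contDiffOn)) = h ∧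
      ev hp (dT β hW (dX α hW (of u hu.contDiffOn))) = -v * f₂ ∧
      ev hp (dT β hW (dX α hW (dX α hW (of u hu.contDiffOn)))) = v * (h + 6 * q.2.2 * f₁) := by
  -- At the base point the ansatz below has `u_T = c - v f₁`, which is to equal `h`.
  obtain ⟨c, hc⟩ : ∃ c, c = h + v * f₁ := ⟨_, rfl⟩
  obtain ⟨r, hr, f, f', f'', hf0, hf1, hf2, hf, hf', hf'', hd⟩ := exists_profile q.2.2 f₁ f₂ v c
  have hf''' : ContDiffOn ℝ ∞ (fun s => v * f' s - 6 * f s * f' s - c) (Set.Ioo (-r) r) := by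
    fun_prop
  let T : ℝ × ℝ → ℝ := fun p => β⁻¹ * p.1 ^ β - β⁻¹ * q.1 ^ β
  let X : ℝ × ℝ → ℝ := fun p => α⁻¹ * p.2 ^ α - α⁻¹ * q.2.1 ^ α
  -- A travelling wave in a uniformly accelerated frame, `u = cT + f(s)`: the `-6cT f'` contributed
  -- to `u_T` by `3cT²` cancels the part `6cT u_X` of `6uu_X`, leaving `c - v f' + 6ff' + f''' = 0`.
  let s : ℝ × ℝ → ℝ := fun p => X p - v * T p - 3 * c * T p ^ 2
  have hT : ContDiffOn ℝ ∞ T quadrantTX := fun p hp =>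
    ((contDiffAt_const.mul (contDiffAt_fst.rpow_const_of_ne hp.1.ne')).sub
      contDiffAt_const).contDiffWithinAt
  have hX : ContDiffOn ℝ ∞ X quadrantTX := fun p hp =>
    ((contDiffAt_const.mul (contDiffAt_snd.rpow_const_of_ne hp.2.ne')).sub
      contDiffAt_const).contDiffWithinAt
  have hs : ContDiffOn ℝ ∞ s quadrantTX := by fun_prop
  have hs0 : s (q.1, q.2.1) = 0 := by simp [s, T, X]
  have hqQ : (q.1, q.2.1) ∈ quadrantTX := hΩ hq
  have hW₁ := hs.continuousOn.isOpen_inter_preimage isOpen_quadrantTX (isOpen_Ioo (a := -r) (b := r))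
  have hqW₁ : (q.1, q.2.1) ∈ quadrantTX ∩ s ⁻¹' Set.Ioo (-r) r :=
    ⟨hqQ, by rw [Set.mem_preimage, hs0]; constructor <;> linarith⟩
  have hu₀ : ContDiffOn ℝ ∞ (fun p => c * T p + f (s p)) (quadrantTX ∩ s ⁻¹' Set.Ioo (-r) r) :=
    (contDiffOn_const.mul (hT.mono Set.inter_subset_left)).add
      (hf.comp (hs.mono Set.inter_subset_left) fun p hp => hp.2)
  -- The criterion is tested on globally smooth functions, so the local solution is extended,
  -- keeping its values near the base point.
  obtain ⟨u, hu, W₂, hqW₂, hW₂, huW⟩ := exists_contDiff_eqOn hW₁ hu₀ hqW₁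
  have hgo : IsOpen ((fun p : ℝ × ℝ => (p.1, p.2, u p)) ⁻¹' (Ω : Set (ℝ × ℝ × ℝ))) :=
    Ω.isOpen.preimage (continuous_fst.prodMk (continuous_snd.prodMk hu.continuous))
  have huq : u (q.1, q.2.1) = q.2.2 := by
    rw [huW hqW₂]
    simp only [hs0, hf0]
    simp [T]
  let W : Opens (ℝ × ℝ) := ⟨W₂ ∩ (fun p : ℝ × ℝ => (p.1, p.2, u p)) ⁻¹' Ω, W₂.isOpen.inter hgo⟩
  have hp : (q.1, q.2.1) ∈ W := ⟨hqW₂, by simpa [huq] using hq⟩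
  have hWQ : (W : Set (ℝ × ℝ)) ⊆ quadrantTX := fun p hp => (hW₂ hp.1).1
  have hsI : ∀ p ∈ W, s p ∈ Set.Ioo (-r) r := fun p hp => (hW₂ hp.1).2
  have hsW : ContDiffOn ℝ ∞ s W := hs.mono hWQ
  have hTW : ContDiffOn ℝ ∞ T W := hT.mono hWQ
  have hXW : ContDiffOn ℝ ∞ X W := hX.mono hWQ
  have eT : of T hTW = β⁻¹ • powFn coordT (coordT_pos hWQ) β - algebraMap ℝ _ (β⁻¹ * q.1 ^ β) :=
    ext_ev fun p hp => by simp [T, ev_powFn]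
  have eX : of X hXW = α⁻¹ • powFn coordX (coordX_pos hWQ) α - algebraMap ℝ _ (α⁻¹ * q.2.1 ^ α) :=
    ext_ev fun p hp => by simp [X, ev_powFn]
  have eS : of s hsW = of X hXW - algebraMap ℝ _ v * of T hTW
      - algebraMap ℝ _ (3 * c) * of T hTW ^ 2 :=
    ext_ev fun p hp => by
      simp only [map_sub, map_mul, map_pow, ev_of, AlgHom.commutes, Algebra.algebraMap_self_apply, s]
  have hTT : dT β hWQ (of T hTW) = 1 := by
    rw [eT, map_sub, Derivation.map_algebraMap, sub_zero, dT, conf_primitive _ hβ.ne']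
    simp
  have hXX : dX α hWQ (of X hXW) = 1 := by
    rw [eX, map_sub, Derivation.map_algebraMap, sub_zero, dX, conf_primitive _ hα.ne']
    simp
  have hXT : dX α hWQ (of T hTW) = 0 := by
    rw [eT, map_sub, Derivation.map_algebraMap, sub_zero]
    simp [dX, conf_apply, pd_powFn]
  have hTX : dT β hWQ (of X hXW) = 0 := by
    rw [eX, map_sub, Derivation.map_algebraMap, sub_zero]
    simp [dT, conf_apply, pd_powFn]
  have hSX : dX α hWQ (of s hsW) = 1 := by
    simp [eS, Derivation.leibniz, Derivation.leibniz_pow, hXX, hXT]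
  have hST : dT β hWQ (of s hsW) = - algebraMap ℝ _ v - algebraMap ℝ _ (6 * c) * of T hTW := by
    simp only [eS, map_sub, map_mul, map_ofNat, hTX, Derivation.leibniz, Derivation.leibniz_pow,
      Derivation.map_algebraMap, hTT, smul_eq_mul, nsmul_eq_mul, derivation_ofNat]
    push_cast
    ring
  have comp : ∀ (γ : ℝ) (ℓ : ℝ × ℝ →L[ℝ] ℝ) (hℓ : ∀ p ∈ W, 0 < ℓ p) (e : ℝ × ℝ) {g g' : ℝ → ℝ}
      (hg : ContDiffOn ℝ ∞ g (Set.Ioo (-r) r)) (hg' : ContDiffOn ℝ ∞ g' (Set.Ioo (-r) r))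
      (_ : ∀ z ∈ Set.Ioo (-r) r, HasDerivAt g (g' z) z),
      conf γ ℓ hℓ e (of (fun p => g (s p)) (hg.comp hsW hsI))
        = of (fun p => g' (s p)) (hg'.comp hsW hsI) * conf γ ℓ hℓ e (of s hsW) := by
    intro γ ℓ hℓ e g g' hg hg' h
    rw [conf_apply, pd_comp hsW hsI hg hg' h, conf_apply]
    ring
  have eu : of u hu.contDiffOn = algebraMap ℝ _ c * of T hTW
      + of (fun p => f (s p)) (hf.comp hsW hsI) := ext_ev fun p hp => by
    simp only [map_add, map_mul, ev_of, AlgHom.commutes, Algebra.algebraMap_self_apply]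
    exact huW hp.1
  set F := of (fun p => f (s p)) (hf.comp hsW hsI)
  set F' := of (fun p => f' (s p)) (hf'.comp hsW hsI)
  set F'' := of (fun p => f'' (s p)) (hf''.comp hsW hsI)
  set F''' := of (fun p => v * f' (s p) - 6 * f (s p) * f' (s p) - c) (hf'''.comp hsW hsI)
  have eF : F''' = algebraMap ℝ _ v * F' - 6 * F * F' - algebraMap ℝ _ c := ext_ev fun p hp => by
    simp only [map_sub, map_mul, map_ofNat, ev_of, AlgHom.commutes, Algebra.algebraMap_self_apply,
      F, F', F''']
  have c1 := fun γ ℓ hℓ e => comp γ ℓ hℓ e hf hf' fun z hz => (hd z hz).1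
  have c2 := fun γ ℓ hℓ e => comp γ ℓ hℓ e hf' hf'' fun z hz => (hd z hz).2.1
  have c3 := fun γ ℓ hℓ e => comp γ ℓ hℓ e hf'' hf''' fun z hz => (hd z hz).2.2
  have x1 : dX α hWQ F = F' :=
    (c1 _ _ _ _).trans ((congrArg (F' * ·) hSX).trans (mul_one _))
  have x2 : dX α hWQ F' = F'' :=
    (c2 _ _ _ _).trans ((congrArg (F'' * ·) hSX).trans (mul_one _))
  have x3 : dX α hWQ F'' = F''' :=
    (c3 _ _ _ _).trans ((congrArg (F''' * ·) hSX).trans (mul_one _))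
  have t1 : dT β hWQ F = F' * dT β hWQ (of s hsW) := c1 _ _ _ _
  have t2 : dT β hWQ F' = F'' * dT β hWQ (of s hsW) := c2 _ _ _ _
  have t3 : dT β hWQ F'' = F''' * dT β hWQ (of s hsW) := c3 _ _ _ _
  have ux : dX α hWQ (of u hu.contDiffOn) = F' := by
    simp [eu, Derivation.leibniz, hXT, x1]
  have ut : dT β hWQ (of u hu.contDiffOn) = algebraMap ℝ _ c + F' * dT β hWQ (of s hsW) := by
    simp [eu, Derivation.leibniz, hTT, t1]
  have eT0 : ev hp (of T hTW) = 0 := by simp [T]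
  have eS0 : ev hp (dT β hWQ (of s hsW)) = -v := by
    simp only [hST, map_sub, map_neg, map_mul, AlgHom.commutes, Algebra.algebraMap_self_apply, eT0]
    ring
  have e1 : ev hp F' = f₁ := by simp only [F', ev_of, hs0, hf1]
  have e2 : ev hp F'' = f₂ := by simp only [F'', ev_of, hs0, hf2]
  have e3 : ev hp F''' = v * f₁ - 6 * q.2.2 * f₁ - c := by simp only [F''', ev_of, hs0, hf0, hf1]
  refine ⟨W, hWQ, u, hu, fun p hp => hp.2, hp, ?_, huq, ?_, ?_, ?_, ?_, ?_⟩
  · rw [kdvForm, ut, ux, x2, x3, eF, eu, hST]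
    have : algebraMap ℝ (SmoothFn W) (6 * c) = 6 * algebraMap ℝ _ c := by
      rw [map_mul, map_ofNat]
    rw [this]
    ring
  · rw [ux, e1]
  · rw [ux, x2, e2]
  · simp only [ut, map_add, map_mul, AlgHom.commutes, Algebra.algebraMap_self_apply, eS0, e1, hc]
    ring
  · rw [ux, t2, map_mul, e2, eS0]
    ring
  · rw [ux, x2, t3, map_mul, e3, eS0, hc]
    ring

end LocalSolutions

/-! ### The determining equations and their general solution. -/

section Determining

variable {Ω : Opens (ℝ × ℝ × ℝ)} {V : ℝ × ℝ × ℝ → ℝ × ℝ × ℝ}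

/-- The linearized equation holds along every solution whose graph lies in `Ω`. -/
def CriticalOnSolutions (α β : ℝ) (hΩ : (Ω : Set (ℝ × ℝ × ℝ)) ⊆ quadrant)
    (hV : ContDiffOn ℝ ∞ V Ω) : Prop :=
  ∀ (W : Opens (ℝ × ℝ)) (hW : (W : Set (ℝ × ℝ)) ⊆ quadrantTX) (u : ℝ × ℝ → ℝ)
    (hu : ContDiff ℝ ∞ u) (hg : ∀ p ∈ W, (p.1, p.2, u p) ∈ Ω),
    kdvForm (dT β hW) (dX α hW) (of u hu.contDiffOn) = 0 →
    lieOn hu.contDiffOn hg α β hW hΩ hV = 0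

section

variable (α β : ℝ) (hΩ : (Ω : Set (ℝ × ℝ × ℝ)) ⊆ quadrant) {q : ℝ × ℝ × ℝ} (hq : q ∈ Ω)

/-- The first total `x`-derivative at a jet. -/
def total₁ (f₁ : ℝ) (F : SmoothFn Ω) : ℝ := ev hq (eX α hΩ F) + f₁ * ev hq (eU F)

/-- The second total `x`-derivative at a jet. -/
def total₂ (f₁ f₂ : ℝ) (F : SmoothFn Ω) : ℝ :=
  ev hq (eX α hΩ (eX α hΩ F)) + 2 * f₁ * ev hq (eX α hΩ (eU F)) + f₁ ^ 2 * ev hq (eU (eU F))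
    + f₂ * ev hq (eU F)

/-- The third total `x`-derivative at a jet. -/
def total₃ (f₁ f₂ f₃ : ℝ) (F : SmoothFn Ω) : ℝ :=
  ev hq (eX α hΩ (eX α hΩ (eX α hΩ F))) + 3 * f₁ * ev hq (eX α hΩ (eX α hΩ (eU F)))
    + 3 * f₁ ^ 2 * ev hq (eX α hΩ (eU (eU F))) + f₁ ^ 3 * ev hq (eU (eU (eU F)))
    + 3 * f₂ * ev hq (eX α hΩ (eU F)) + 3 * f₁ * f₂ * ev hq (eU (eU F)) + f₃ * ev hq (eU F)

/-- The first total `t`-derivative at a jet. -/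
def totalT (h : ℝ) (F : SmoothFn Ω) : ℝ := ev hq (eT β hΩ F) + h * ev hq (eU F)

/-- The linearized equation at the jets of the solutions given by `exists_solution`. -/
theorem jet_equation (hα : 0 < α) (hβ : 0 < β) {hV : ContDiffOn ℝ ∞ V Ω}
    (H : CriticalOnSolutions α β hΩ hV) (f₁ f₂ v h : ℝ) :
    let τ := tauFn β hΩ hV
    let ξ := xiFn α hΩ hV
    let η := etaFn hV
    let f₃ := -(h + 6 * q.2.2 * f₁)
    6 * ev hq η * f₁ + (totalT β hΩ hq h η - f₁ * totalT β hΩ hq h ξ - h * totalT β hΩ hq h τ)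
      + 6 * q.2.2 * (total₁ α hΩ hq f₁ η - f₁ * total₁ α hΩ hq f₁ ξ - h * total₁ α hΩ hq f₁ τ)
      + (total₃ α hΩ hq f₁ f₂ f₃ η - 3 * f₃ * total₁ α hΩ hq f₁ ξ
        - 3 * f₂ * total₂ α hΩ hq f₁ f₂ ξ - f₁ * total₃ α hΩ hq f₁ f₂ f₃ ξ
        + 3 * v * f₃ * total₁ α hΩ hq f₁ τ + 3 * v * f₂ * total₂ α hΩ hq f₁ f₂ τ
        - h * total₃ α hΩ hq f₁ f₂ f₃ τ) = 0 := by
  intro τ ξ η f₃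
  obtain ⟨W, hW, u, hu, hg, hp, hs, h0, h1, h2, ht, htx, htxx⟩ :=
    exists_solution hα hβ hΩ hq f₁ f₂ v h
  have key := congrArg (ev hp) (H W hW u hu hg hs)
  have h3 := congrArg (ev hp) hs
  have hqe : ((q.1, q.2.1).1, (q.1, q.2.1).2, u (q.1, q.2.1)) = q := by rw [h0]
  have hev : ∀ F : SmoothFn Ω, ev hp (onGraph hu.contDiffOn hg F) = ev hq F := by
    intro F
    rw [ev_onGraph, ← rep_eq, hqe, rep_eq F hq]
  have hT := dT_onGraph hu.contDiffOn hg β hW hΩ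
  have hX := dX_onGraph hu.contDiffOn hg α hW hΩ
  have h00 : ev hp (of u hu.contDiffOn) = q.2.2 := h0
  simp only [kdvForm, map_add, map_mul, map_ofNat, h1, ht, h00, map_zero] at h3
  -- The equation itself eliminates `u_XXX`.
  have h3' : ev hp (dX α hW (dX α hW (dX α hW (of u hu.contDiffOn)))) = f₃ := by linarith
  have t1 : ∀ F, ev hp (dX α hW (onGraph hu.contDiffOn hg F)) = total₁ α hΩ hq f₁ F := by
    intro F
    simp only [hX, map_add, map_mul, hev, h1, total₁]
  have tT : ∀ F, ev hp (dT β hW (onGraph hu.contDiffOn hg F)) = totalT β hΩ hq h F := by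
    intro F
    simp only [hT, map_add, map_mul, hev, ht, totalT]
  have t2 : ∀ F, ev hp (dX α hW (dX α hW (onGraph hu.contDiffOn hg F)))
      = total₂ α hΩ hq f₁ f₂ F := by
    intro F
    rw [(total_derivatives hX (eU_eX α hΩ) F).1]
    simp only [map_add, map_mul, map_pow, map_ofNat, hev, h1, h2, total₂]
  have t3 : ∀ F, ev hp (dX α hW (dX α hW (dX α hW (onGraph hu.contDiffOn hg F))))
      = total₃ α hΩ hq f₁ f₂ f₃ F := by
    intro F
    rw [(total_derivatives hX (eU_eX α hΩ) F).2]
    simp only [map_add, map_mul, map_pow, map_ofNat, hev, h1, h2, h3', total₃]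
  rw [lieOn, lieForm_eq (dX_dT α β hW)] at key
  simp only [map_add, map_sub, map_mul, map_ofNat, hev, t1, t2, t3, tT, h1, h2, h3', ht, htx, htxx,
    h00, map_zero] at key
  linear_combination key

end

section

variable {α β : ℝ} {hΩ : (Ω : Set (ℝ × ℝ × ℝ)) ⊆ quadrant} {hV : ContDiffOn ℝ ∞ V Ω}

/-- With `f₂ = 0` the jet equation is affine in `v` with slope `3 f₃ (a_X + f₁ a_u)`. Comparing `v =
0` and `v = 1` at `f₁ = 0` and at `f₁ = 1` kills both derivatives. -/
theorem tau_determining (hα : 0 < α) (hβ : 0 < β) (H : CriticalOnSolutions α β hΩ hV) :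
    eX α hΩ (tauFn β hΩ hV) = 0 ∧ eU (tauFn β hΩ hV) = 0 := by
  have key : ∀ q (hq : q ∈ Ω), ev hq (eX α hΩ (tauFn β hΩ hV)) = 0 ∧
      ev hq (eU (tauFn β hΩ hV)) = 0 := by
    intro q hq
    have E := fun f₁ v h => jet_equation α β hΩ hq hα hβ H f₁ 0 v h
    have e1 := E 0 0 1
    have e2 := E 0 1 1
    -- This value of `h` keeps `f₃ = -(h + 6u f₁)` equal to `-1`, as in the case `f₁ = 0`, `h = 1`.
    have e3 := E 1 0 (1 - 6 * q.2.2)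
    have e4 := E 1 1 (1 - 6 * q.2.2)
    have h1 : total₁ α hΩ hq 0 (tauFn β hΩ hV) = 0 := by linarith
    have h2 : total₁ α hΩ hq 1 (tauFn β hΩ hV) = 0 := by linarith
    rw [total₁] at h1 h2
    constructor <;> linarith
  exact ⟨ext_ev fun q hq => by rw [(key q hq).1, map_zero],
    ext_ev fun q hq => by rw [(key q hq).2, map_zero]⟩

/-- At `f₁ = v = h = 0` the jet equation is quadratic in `u_XX` with leading coefficient `-3 b_u`;
the second difference over `f₂ = 0, 1, -1` isolates it. -/
theorem xi_determining (hα : 0 < α) (hβ : 0 < β) (H : CriticalOnSolutions α β hΩ hV) :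
    eU (xiFn α hΩ hV) = 0 := by
  obtain ⟨hτX, hτU⟩ := tau_determining hα hβ H
  refine ext_ev fun q hq => ?_
  have E := fun f₂ => jet_equation α β hΩ hq hα hβ H 0 f₂ 0 0
  have e0 := E 0
  have e1 := E 1
  have e2 := E (-1)
  simp only [totalT, total₁, total₂, total₃] at e0 e1 e2
  rw [map_zero]
  linarith

/-- What remains is a polynomial in the free coordinates `f₁`, `f₂`, `h`. The conjuncts are, in
order, its coefficients of `f₂`, `f₁f₂`, `h`, `1` and `f₁`; that of `f₁f₂` is extracted first
because it simplifies the others. -/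
theorem determining_equations (hα : 0 < α) (hβ : 0 < β) (H : CriticalOnSolutions α β hΩ hV) :
    (∀ q (hq : q ∈ Ω), ev hq (eX α hΩ (eX α hΩ (xiFn α hΩ hV))) = ev hq (eX α hΩ (eU (etaFn hV)))) ∧
    eU (eU (etaFn hV)) = 0 ∧
    eT β hΩ (tauFn β hΩ hV) = 3 * eX α hΩ (xiFn α hΩ hV) ∧
    (∀ q (hq : q ∈ Ω), ev hq (eT β hΩ (etaFn hV)) + 6 * q.2.2 * ev hq (eX α hΩ (etaFn hV))
      + ev hq (eX α hΩ (eX α hΩ (eX α hΩ (etaFn hV)))) = 0) ∧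
    (∀ q (hq : q ∈ Ω), 6 * ev hq (etaFn hV) - ev hq (eT β hΩ (xiFn α hΩ hV))
      + 12 * q.2.2 * ev hq (eX α hΩ (xiFn α hΩ hV)) + 3 * ev hq (eX α hΩ (eX α hΩ (eU (etaFn hV))))
      - ev hq (eX α hΩ (eX α hΩ (eX α hΩ (xiFn α hΩ hV)))) = 0) := by
  obtain ⟨hτX, hτU⟩ := tau_determining hα hβ H
  have hξU := xi_determining hα hβ H
  have E : ∀ q (hq : q ∈ Ω) (f₁ f₂ h : ℝ), _ := fun q hq f₁ f₂ h =>
    jet_equation α β hΩ hq hα hβ H f₁ f₂ 0 h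
  simp only [totalT, total₁, total₂, total₃, hτX, hτU, hξU, map_zero, mul_zero, add_zero,
    sub_zero] at E
  have hηUU : eU (eU (etaFn hV)) = 0 := by
    refine ext_ev fun q hq => ?_
    have a := E q hq 1 1 0
    have b := E q hq 1 0 0
    have c := E q hq 0 1 0
    have d := E q hq 0 0 0
    rw [map_zero]
    linarith
  simp only [hηUU, map_zero, mul_zero, add_zero] at E
  refine ⟨fun q hq => ?_, hηUU, ext_ev fun q hq => ?_, fun q hq => ?_, fun q hq => ?_⟩
  · have c := E q hq 0 1 0
    have d := E q hq 0 0 0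
    linarith
  · have c := E q hq 0 0 1
    have d := E q hq 0 0 0
    rw [map_mul, map_ofNat]
    linarith
  · have d := E q hq 0 0 0
    linarith
  · have b := E q hq 1 0 0
    have c := E q hq (-1) 0 0
    linarith

/-- Since `a_T = 3b_X` and `a_X = 0`, also `b_XX = 0`, and the `f₁`-coefficient then expresses `c`
through `b`. Substituting into the coefficient of `1` gives `b_TT = 6u b_TX`. -/
theorem second_order_equations (hα : 0 < α) (hβ : 0 < β) (H : CriticalOnSolutions α β hΩ hV) :
    eX α hΩ (eX α hΩ (xiFn α hΩ hV)) = 0 ∧ eT β hΩ (eX α hΩ (xiFn α hΩ hV)) = 0 ∧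
    eT β hΩ (eT β hΩ (xiFn α hΩ hV)) = 0 ∧
    ∀ q (hq : q ∈ Ω), 6 * ev hq (etaFn hV)
      = ev hq (eT β hΩ (xiFn α hΩ hV)) - 12 * q.2.2 * ev hq (eX α hΩ (xiFn α hΩ hV)) := by
  obtain ⟨hτX, hτU⟩ := tau_determining hα hβ H
  have hξU := xi_determining hα hβ H
  obtain ⟨h1, h2, h3, h4, h5⟩ := determining_equations hα hβ H
  set ξ := xiFn α hΩ hV
  set η := etaFn hV
  set U : SmoothFn Ω := of (fun q => q.2.2) contDiff_snd.snd.contDiffOn with hU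
  have three : ∀ F : SmoothFn Ω, 3 * F = 0 → F = 0 := fun F hF => ext_ev fun q hq => by
    have := congrArg (ev hq) hF
    rw [map_mul, map_ofNat, map_zero] at this
    rw [map_zero]
    linarith
  have pdU : ∀ v q (hq : q ∈ Ω), ev hq (pd v U) = v.2.2 := by
    intro v q hq
    rw [hU, ev_pd_of]
    have : HasFDerivAt (fun q : ℝ × ℝ × ℝ => q.2.2)
      ((ContinuousLinearMap.snd ℝ ℝ ℝ).comp (ContinuousLinearMap.snd ℝ ℝ (ℝ × ℝ))) q :=
      ((ContinuousLinearMap.snd ℝ ℝ ℝ).comp (ContinuousLinearMap.snd ℝ ℝ (ℝ × ℝ))).hasFDerivAt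
    rw [this.fderiv]
    rfl
  have hUX : eX α hΩ U = 0 := ext_ev fun q hq => by
    simp [eX, conf_apply, pdU]
  have hUT : eT β hΩ U = 0 := ext_ev fun q hq => by
    simp [eT, conf_apply, pdU]
  have hUU : eU U = 1 := ext_ev fun q hq => by
    simp [eU, pdU]
  have hXX : eX α hΩ (eX α hΩ ξ) = 0 := by
    have := congrArg (eX α hΩ) h3
    rw [eX_eT, hτX, map_zero, Derivation.leibniz, derivation_ofNat, smul_zero, add_zero,
      smul_eq_mul] at this
    exact three _ this.symm
  have hη : 6 * η = eT β hΩ ξ - 12 * U * eX α hΩ ξ := ext_ev fun q hq => by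
    have := h5 q hq
    have hXU : eX α hΩ (eU η) = 0 := ext_ev fun q hq => by rw [← h1 q hq, hXX]
    rw [hXU, hXX, map_zero, map_zero] at this
    simp only [map_mul, map_sub, map_ofNat, hU, ev_of]
    linarith
  have hηX : 6 * eX α hΩ η = eT β hΩ (eX α hΩ ξ) := by
    have := congrArg (eX α hΩ) hη
    simp only [Derivation.leibniz, derivation_ofNat, add_zero, smul_eq_mul, map_sub, eX_eT, hXX, hUX,
      mul_zero, sub_zero] at this
    exact this
  have hηXXX : eX α hΩ (eX α hΩ (eX α hΩ η)) = 0 := by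
    have := congrArg (eX α hΩ) hηX
    simp only [Derivation.leibniz, derivation_ofNat, smul_eq_mul, eX_eT, hXX, map_zero, mul_zero,
      add_zero] at this
    have h6 : eX α hΩ (eX α hΩ η) = 0 := ext_ev fun q hq => by
      have := congrArg (ev hq) this
      rw [map_mul, map_ofNat, map_zero] at this
      rw [map_zero]
      linarith
    rw [h6, map_zero]
  have hηT : 6 * eT β hΩ η = eT β hΩ (eT β hΩ ξ) - 12 * U * eT β hΩ (eX α hΩ ξ) := by
    have := congrArg (eT β hΩ) hη
    simp only [Derivation.leibniz, derivation_ofNat, add_zero, smul_eq_mul, map_sub, hUT,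
      mul_zero] at this
    exact this
  have hTT : eT β hΩ (eT β hΩ ξ) = 6 * (U * eT β hΩ (eX α hΩ ξ)) := ext_ev fun q hq => by
    have a := h4 q hq
    have b := congrArg (ev hq) hηX
    have c := congrArg (ev hq) hηT
    simp only [map_mul, map_sub, map_ofNat, hU, ev_of, hηXXX, map_zero] at a b c ⊢
    linear_combination 6 * a - c - 6 * q.2.2 * b
  -- As `b` does not depend on `u`, differentiating `b_TT = 6u b_TX` in `u` leaves `6 b_TX = 0`.
  have hTX : eT β hΩ (eX α hΩ ξ) = 0 := by
    have := congrArg eU hTT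
    simp only [Derivation.leibniz, derivation_ofNat, add_zero, smul_eq_mul, eU_eT, eU_eX, hξU, hUU,
      map_zero, mul_zero, zero_add, mul_one] at this
    refine ext_ev fun q hq => ?_
    have := congrArg (ev hq) this
    rw [map_mul, map_ofNat, map_zero] at this
    rw [map_zero]
    linarith
  refine ⟨hXX, hTX, by rw [hTT, hTX, mul_zero, mul_zero], fun q hq => ?_⟩
  have := congrArg (ev hq) hη
  simpa only [map_mul, map_sub, map_ofNat, hU, ev_of] using this

end

/-- The weights are positive on `Ω`, so the ordinary partial derivatives vanish as well. -/
theorem exists_const (α β : ℝ) (hΩ : (Ω : Set (ℝ × ℝ × ℝ)) ⊆ quadrant)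
    (hc : IsPreconnected (Ω : Set (ℝ × ℝ × ℝ))) {f : SmoothFn Ω} (hT : eT β hΩ f = 0)
    (hX : eX α hΩ f = 0) (hU : eU f = 0) : ∃ c : ℝ, f = algebraMap ℝ _ c := by
  refine exists_eq_algebraMap hc fun v => ext_ev fun q hq => ?_
  have h1 := congrArg (ev hq) hT
  have h2 := congrArg (ev hq) hX
  have h3 := congrArg (ev hq) hU
  have p1 : coordT' q ^ (1 - β) ≠ 0 := (Real.rpow_pos_of_pos (coordT'_pos hΩ q hq) _).ne'
  have p2 : coordX' q ^ (1 - α) ≠ 0 := (Real.rpow_pos_of_pos (coordX'_pos hΩ q hq) _).ne'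
  rw [eT, ev_conf, map_zero, mul_eq_zero, or_iff_right p1] at h1
  rw [eX, ev_conf, map_zero, mul_eq_zero, or_iff_right p2] at h2
  rw [eU, ev_pd, map_zero] at h3
  have hv : v = v.1 • ((1, 0, 0) : ℝ × ℝ × ℝ) + v.2.1 • ((0, 1, 0) : ℝ × ℝ × ℝ)
      + v.2.2 • ((0, 0, 1) : ℝ × ℝ × ℝ) := by
    simp
  rw [ev_pd, hv, map_add, map_add, map_smul, map_smul, map_smul, h1, h2, h3]
  simp

/-- The general solution of the determining equations. -/
theorem CriticalOnSolutions.exists_constants {α β : ℝ} (hα : 0 < α) (hβ : 0 < β)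
    {hΩ : (Ω : Set (ℝ × ℝ × ℝ)) ⊆ quadrant} {hV : ContDiffOn ℝ ∞ V Ω}
    (hc : IsPreconnected (Ω : Set (ℝ × ℝ × ℝ))) (H : CriticalOnSolutions α β hΩ hV) :
    ∃ c₁ c₂ c₃ c₄ : ℝ, ∀ t x u : ℝ, (t, x, u) ∈ Ω →
      V (t, x, u) =
        (-3 * c₁ * t / (2 * β) + c₂ * t ^ (1 - β),
          -c₁ * x / (2 * α) + 6 * c₃ / β * t ^ β * x ^ (1 - α) + c₄ * x ^ (1 - α),
          c₁ * u + c₃) := by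
  obtain ⟨hτX, hτU⟩ := tau_determining hα hβ H
  have hξU := xi_determining hα hβ H
  have hτT := (determining_equations hα hβ H).2.2.1
  obtain ⟨hXX, hTX, hTT, hη⟩ := second_order_equations hα hβ H
  obtain ⟨k, hk⟩ := exists_const α β hΩ hc hTX hXX (by rw [eU_eX, hξU, map_zero])
  obtain ⟨m, hm⟩ := exists_const α β hΩ hc hTT (by rw [eX_eT, hTX]) (by rw [eU_eT, hξU, map_zero])
  obtain ⟨T, hT⟩ : ∃ T : SmoothFn Ω, T = β⁻¹ • powFn coordT' (coordT'_pos hΩ) β := ⟨_, rfl⟩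
  obtain ⟨X, hX⟩ : ∃ X : SmoothFn Ω, X = α⁻¹ • powFn coordX' (coordX'_pos hΩ) α := ⟨_, rfl⟩
  have hT1 : eT β hΩ T = 1 := hT ▸ (conf_primitive _ hβ.ne' _).trans (by simp)
  have hX1 : eX α hΩ X = 1 := hX ▸ (conf_primitive _ hα.ne' _).trans (by simp)
  have hTX0 : eX α hΩ T = 0 := by simp [hT, eX, conf_apply, pd_powFn]
  have hXT0 : eT β hΩ X = 0 := by simp [hX, eT, conf_apply, pd_powFn]
  have hTU0 : eU T = 0 := by simp [hT, eU, pd_powFn]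
  have hXU0 : eU X = 0 := by simp [hX, eU, pd_powFn]
  -- With `b_X = k`, `b_T = m` and `a_T = 3k` constant, the differences `a - 3kT` and `b - kX - mT`
  -- have no derivatives left.
  obtain ⟨c₂, hc₂⟩ := exists_const α β hΩ hc (f := tauFn β hΩ hV - (3 * k) • T)
    (by
      rw [map_sub, hτT, hk, Derivation.map_smul, hT1, Algebra.algebraMap_eq_smul_one, mul_smul,
        Algebra.smul_def (3 : ℝ), map_ofNat, sub_self])
    (by rw [map_sub, hτX, Derivation.map_smul, hTX0, smul_zero, sub_zero])
    (by rw [map_sub, hτU, Derivation.map_smul, hTU0, smul_zero, sub_zero])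
  obtain ⟨c₄, hc₄⟩ := exists_const α β hΩ hc (f := xiFn α hΩ hV - k • X - m • T)
    (by
      rw [map_sub, map_sub, hm, Derivation.map_smul, Derivation.map_smul, hT1, hXT0,
        Algebra.algebraMap_eq_smul_one, smul_zero, sub_zero, sub_self])
    (by
      rw [map_sub, map_sub, hk, Derivation.map_smul, Derivation.map_smul, hX1, hTX0,
        Algebra.algebraMap_eq_smul_one, smul_zero, sub_zero, sub_self])
    (by
      rw [map_sub, map_sub, hξU, Derivation.map_smul, Derivation.map_smul, hXU0, hTU0,
        smul_zero, smul_zero, sub_zero, sub_zero])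
  -- Read off from `6c = m - 12ku`, that is `c = -2k u + m/6`.
  refine ⟨-2 * k, c₂, m / 6, c₄, fun t x u hq => ?_⟩
  have ht : 0 < t := (hΩ hq).1
  have hx : 0 < x := (hΩ hq).2
  have e1 := congrArg (ev hq) hc₂
  have e2 := congrArg (ev hq) hc₄
  have e3 := hη _ hq
  simp only [hk, hm, AlgHom.commutes, Algebra.algebraMap_self_apply, etaFn, ev_of] at e3
  simp only [map_sub, map_smul, hT, hX, tauFn, xiFn, ev_powFn, map_mul, ev_of, smul_eq_mul,
    AlgHom.commutes, Algebra.algebraMap_self_apply, ContinuousLinearMap.comp_apply,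
    ContinuousLinearMap.coe_fst', ContinuousLinearMap.coe_snd'] at e1 e2
  have ht' : t ^ (1 - β) * t ^ (β - 1) = 1 := by
    rw [← Real.rpow_add ht]
    simp
  have hx' : x ^ (1 - α) * x ^ (α - 1) = 1 := by
    rw [← Real.rpow_add hx]
    simp
  have ht'' : t ^ (1 - β) * t ^ β = t := by
    rw [← Real.rpow_add ht]
    simp
  have hx'' : x ^ (1 - α) * x ^ α = x := by
    rw [← Real.rpow_add hx]
    simp
  refine Prod.ext ?_ (Prod.ext ?_ ?_)
  · simp only
    linear_combination t ^ (1 - β) * e1 - (V (t, x, u)).1 * ht' + 3 * k * β⁻¹ * ht''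
  · simp only
    linear_combination x ^ (1 - α) * e2 - (V (t, x, u)).2.1 * hx' + k * α⁻¹ * hx''
  · simp only
    linarith

end Determining

/-! ### The KdV expression under a change of independent variables. -/

section ChangeOfCoordinates

/-- Covers slicing at fixed `ε` and restriction to a smaller set: both preserve the weighted
coordinate and the direction of differentiation. -/
theorem pull_conf {E F : Type*} [NormedAddCommGroup E] [NormedSpace ℝ E]
    [NormedAddCommGroup F] [NormedSpace ℝ F] {U : Opens E} {U' : Opens F} {γ : F → E}
    (hγ : ContDiffOn ℝ ∞ γ U') (hm : ∀ p ∈ U', γ p ∈ U) {ℓ : E →L[ℝ] ℝ} {ℓ' : F →L[ℝ] ℝ}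
    (hℓ : ∀ p ∈ U, 0 < ℓ p) (hℓ' : ∀ p ∈ U', 0 < ℓ' p) {v : E} {v' : F}
    (hv : ∀ p ∈ U', fderiv ℝ γ p v' = v) (he : ∀ p ∈ U', ℓ (γ p) = ℓ' p) (α : ℝ)
    (f : SmoothFn U) :
    pull γ hγ hm (conf α ℓ hℓ v f) = conf α ℓ' hℓ' v' (pull γ hγ hm f) := by
  refine ext_ev fun p hp => ?_
  rw [ev_pull, ev_conf, conf_apply, map_mul, ev_powFn, ev_pd_pull, hv p hp, he p hp]

variable {W W' : Opens (ℝ × ℝ)} {φ : ℝ × ℝ → ℝ × ℝ}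

/-- The function `t^β / β`. -/
def coordFnT (β : ℝ) (hW : (W : Set (ℝ × ℝ)) ⊆ quadrantTX) : SmoothFn W :=
  β⁻¹ • powFn coordT (coordT_pos hW) β

/-- The function `x^α / α`. -/
def coordFnX (α : ℝ) (hW : (W : Set (ℝ × ℝ)) ⊆ quadrantTX) : SmoothFn W :=
  α⁻¹ • powFn coordX (coordX_pos hW) α

/-- The chain rule in the coordinates `T`, `X` of the target: the weights in `dT g`, `dX g` cancel
those from differentiating `t^β/β`, `x^α/α`. -/
theorem pd_pull_eq {α β : ℝ} (hα : α ≠ 0) (hβ : β ≠ 0) (hW' : (W' : Set (ℝ × ℝ)) ⊆ quadrantTX)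
    (hφ : ContDiffOn ℝ ∞ φ W) (hm : ∀ p ∈ W, φ p ∈ W') (e : ℝ × ℝ) (g : SmoothFn W') :
    pd e (pull φ hφ hm g)
      = pull φ hφ hm (dT β hW' g) * pd e (pull φ hφ hm (coordFnT β hW'))
        + pull φ hφ hm (dX α hW' g) * pd e (pull φ hφ hm (coordFnX α hW')) := by
  refine ext_ev fun p hp => ?_
  have h1 : 0 < (φ p).1 := (hW' (hm p hp)).1
  have h2 : 0 < (φ p).2 := (hW' (hm p hp)).2
  simp only [map_add, map_mul, ev_pd_pull, ev_pull, dT, dX, ev_conf]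
  obtain ⟨y, hy⟩ : ∃ y, y = fderiv ℝ φ p e := ⟨_, rfl⟩
  rw [← hy, ← ev_pd y _ (hm p hp), ← ev_pd y _ (hm p hp), ← ev_pd y _ (hm p hp), coordFnT,
    coordFnX, Derivation.map_smul, Derivation.map_smul, pd_powFn, pd_powFn, ev_pd]
  have hL : fderiv ℝ (rep g) (φ p) y = y.1 * fderiv ℝ (rep g) (φ p) (1, 0)
      + y.2 * fderiv ℝ (rep g) (φ p) (0, 1) := by
    have : y = y.1 • ((1, 0) : ℝ × ℝ) + y.2 • ((0, 1) : ℝ × ℝ) := by simp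
    conv_lhs => rw [this]
    rw [map_add, map_smul, map_smul, smul_eq_mul, smul_eq_mul]
  rw [hL]
  simp only [map_smul, ev_powFn, smul_eq_mul, ContinuousLinearMap.coe_fst',
    ContinuousLinearMap.coe_snd']
  have k1 : (φ p).1 ^ (1 - β) * (φ p).1 ^ (β - 1) = 1 := by
    rw [← Real.rpow_add h1]
    simp
  have k2 : (φ p).2 ^ (1 - α) * (φ p).2 ^ (α - 1) = 1 := by
    rw [← Real.rpow_add h2]
    simp
  have b1 : β⁻¹ * β = 1 := inv_mul_cancel₀ hβ
  have b2 : α⁻¹ * α = 1 := inv_mul_cancel₀ hα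
  linear_combination (-(y.1 * fderiv ℝ (rep g) (φ p) (1, 0)) * (β⁻¹ * β)) * k1
    - y.1 * fderiv ℝ (rep g) (φ p) (1, 0) * b1
    + (-(y.2 * fderiv ℝ (rep g) (φ p) (0, 1)) * (α⁻¹ * α)) * k2
    - y.2 * fderiv ℝ (rep g) (φ p) (0, 1) * b2

theorem conf_pull_eq {α β : ℝ} (hα : α ≠ 0) (hβ : β ≠ 0) (hW' : (W' : Set (ℝ × ℝ)) ⊆ quadrantTX)
    (hφ : ContDiffOn ℝ ∞ φ W) (hm : ∀ p ∈ W, φ p ∈ W') (γ : ℝ) (ℓ : ℝ × ℝ →L[ℝ] ℝ)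
    (hℓ : ∀ p ∈ W, 0 < ℓ p) (e : ℝ × ℝ) (g : SmoothFn W') :
    conf γ ℓ hℓ e (pull φ hφ hm g)
      = pull φ hφ hm (dT β hW' g) * conf γ ℓ hℓ e (pull φ hφ hm (coordFnT β hW'))
        + pull φ hφ hm (dX α hW' g) * conf γ ℓ hℓ e (pull φ hφ hm (coordFnX α hW')) := by
  rw [conf_apply, pd_pull_eq hα hβ hW', conf_apply, conf_apply]
  ring

/-- The Korteweg-de Vries expression in new coordinates. -/
theorem map_kdvForm {R S : Type*} [CommRing R] [Algebra ℝ R] [CommRing S] [Algebra ℝ S]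
    {dT dX : Derivation ℝ R R} {δT δX : Derivation ℝ S S} (σ : S →ₐ[ℝ] R) {A B K : R}
    (hT : ∀ g, dT (σ g) = σ (δT g) * dT A + σ (δX g) * dT B)
    (hX : ∀ g, dX (σ g) = σ (δT g) * dX A + σ (δX g) * dX B)
    (hK : K * (dT A * dX B - dX A * dT B) = 1) (g : S) :
    σ (kdvForm δT δX g) = newKdv dT dX A B K (σ g) := by
  -- Cramer's rule for the two chain-rule equations.
  have hx : ∀ g, newX dT dX A B K (σ g) = σ (δX g) := by
    intro g
    rw [newX, hT, hX]
    linear_combination σ (δX g) * hK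
  have ht : ∀ g, newT dT dX A B K (σ g) = σ (δT g) := by
    intro g
    rw [newT, hT, hX]
    linear_combination σ (δT g) * hK
  simp only [kdvForm, newKdv, hx, ht, map_add, map_mul, map_ofNat]

/-- The Korteweg-de Vries expression of a function on `W'` in the coordinates of `W`. -/
theorem pull_kdvForm {α β : ℝ} (hα : α ≠ 0) (hβ : β ≠ 0) (hW : (W : Set (ℝ × ℝ)) ⊆ quadrantTX)
    (hW' : (W' : Set (ℝ × ℝ)) ⊆ quadrantTX) (hφ : ContDiffOn ℝ ∞ φ W) (hm : ∀ p ∈ W, φ p ∈ W')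
    {A B C K : SmoothFn W} (g : SmoothFn W') (hA : pull φ hφ hm (coordFnT β hW') = A)
    (hB : pull φ hφ hm (coordFnX α hW') = B) (hC : pull φ hφ hm g = C)
    (hK : K * (dT β hW A * dX α hW B - dX α hW A * dT β hW B) = 1) :
    pull φ hφ hm (kdvForm (dT β hW') (dX α hW') g) = newKdv (dT β hW) (dX α hW) A B K C := by
  subst hA hB hC
  exact map_kdvForm (pull φ hφ hm) (conf_pull_eq hα hβ hW' hφ hm _ _ _ _)
    (conf_pull_eq hα hβ hW' hφ hm _ _ _ _) hK g

theorem dT_coordFnT {β : ℝ} (hβ : β ≠ 0) (hW : (W : Set (ℝ × ℝ)) ⊆ quadrantTX) :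
    dT β hW (coordFnT β hW) = 1 :=
  (conf_primitive _ hβ _).trans (by simp)

theorem dX_coordFnX {α : ℝ} (hα : α ≠ 0) (hW : (W : Set (ℝ × ℝ)) ⊆ quadrantTX) :
    dX α hW (coordFnX α hW) = 1 :=
  (conf_primitive _ hα _).trans (by simp)

theorem dX_coordFnT (α β : ℝ) (hW : (W : Set (ℝ × ℝ)) ⊆ quadrantTX) :
    dX α hW (coordFnT β hW) = 0 := by
  simp [coordFnT, dX, conf_apply, pd_powFn]

theorem dT_coordFnX (α β : ℝ) (hW : (W : Set (ℝ × ℝ)) ⊆ quadrantTX) :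
    dT β hW (coordFnX α hW) = 0 := by
  simp [coordFnX, dT, conf_apply, pd_powFn]

end ChangeOfCoordinates

/-! ### Local inverses of plane maps. -/

section InverseFunction

/-- A smooth map of the plane with injective differentials has a local inverse `χ`, through which
every smooth function factors. -/
theorem exists_local_factorization {W : Opens (ℝ × ℝ)} {φ : ℝ × ℝ → ℝ × ℝ}
    (hφ : ContDiffOn ℝ ∞ φ W) (hi : ∀ p ∈ W, Function.Injective (fderiv ℝ φ p)) {c : ℝ × ℝ → ℝ}
    (hc : ContDiffOn ℝ ∞ c W) {p₀ : ℝ × ℝ} (hp₀ : p₀ ∈ W) :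
    ∃ (W₁ W₁' : Opens (ℝ × ℝ)) (v : ℝ × ℝ → ℝ), p₀ ∈ W₁ ∧ W₁ ≤ W ∧ φ '' W₁ = W₁' ∧
      ContDiffOn ℝ ∞ v W₁' ∧ ∀ p ∈ W₁, v (φ p) = c p := by
  have hL : ∀ p ∈ W, ∃ L : (ℝ × ℝ) ≃L[ℝ] (ℝ × ℝ),
      (L : (ℝ × ℝ) →L[ℝ] (ℝ × ℝ)) = fderiv ℝ φ p := fun p hp =>
    ⟨(LinearEquiv.ofInjectiveEndo (fderiv ℝ φ p : (ℝ × ℝ) →ₗ[ℝ] (ℝ × ℝ))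
      (hi p hp)).toContinuousLinearEquiv, by ext <;> rfl⟩
  have hd : ∀ p ∈ W, HasFDerivAt φ (fderiv ℝ φ p) p := fun p hp =>
    ((hφ.contDiffAt (W.isOpen.mem_nhds hp)).differentiableAt (by simp)).hasFDerivAt
  obtain ⟨L, hL₀⟩ := hL p₀ hp₀
  have hs : HasStrictFDerivAt φ (L : (ℝ × ℝ) →L[ℝ] (ℝ × ℝ)) p₀ :=
    (hφ.contDiffAt (W.isOpen.mem_nhds hp₀)).hasStrictFDerivAt' (hL₀ ▸ hd p₀ hp₀) (by simp)
  let e := hs.toOpenPartialHomeomorph φ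
  have he : ∀ p, e p = φ p := fun p => rfl
  have hopen : IsOpen (e.source ∩ W) := e.open_source.inter W.isOpen
  refine ⟨⟨e.source ∩ W, hopen⟩,
    ⟨e '' (e.source ∩ W), e.isOpen_image_of_subset_source hopen Set.inter_subset_left⟩,
    fun y => c (e.symm y), ⟨hs.mem_toOpenPartialHomeomorph_source, hp₀⟩, fun p hp => hp.2, rfl,
    ?_, fun p hp => by
      simp only
      rw [← he, e.left_inv hp.1]⟩
  -- The local inverse must be smooth on the whole image, so invertibility of the differential is
  -- used at each `p`, not only at `p₀`.
  rintro _ ⟨p, hp, rfl⟩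
  obtain ⟨Lp, hLp⟩ := hL p hp.2
  have hsymm : e.symm (e p) = p := e.left_inv hp.1
  have h1 : ContDiffAt ℝ ∞ e.symm (e p) := by
    refine e.contDiffAt_symm (f₀' := Lp) (e.map_source hp.1) ?_ ?_
    · rw [hsymm, hLp]
      exact hd p hp.2
    · rw [hsymm]
      exact hφ.contDiffAt (W.isOpen.mem_nhds hp.2)
  have h2 : ContDiffAt ℝ ∞ c (e.symm (e p)) := by
    rw [hsymm]
    exact hc.contDiffAt (W.isOpen.mem_nhds hp.2)
  exact (h2.comp (e p) h1).contDiffWithinAt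

/-- A kernel vector annihilates the differentials of both pulled-back functions; Cramer's rule with
the invertible determinant makes it zero. -/
theorem injective_fderiv_of_jacobian {W W' : Opens (ℝ × ℝ)} {φ : ℝ × ℝ → ℝ × ℝ} {α β : ℝ}
    (hW : (W : Set (ℝ × ℝ)) ⊆ quadrantTX)
    (hφ : ContDiffOn ℝ ∞ φ W) (hm : ∀ p ∈ W, φ p ∈ W') {a b : SmoothFn W'} {K : SmoothFn W}
    (hK : K * (dT β hW (pull φ hφ hm a) * dX α hW (pull φ hφ hm b)
      - dX α hW (pull φ hφ hm a) * dT β hW (pull φ hφ hm b)) = 1) {p : ℝ × ℝ} (hp : p ∈ W) :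
    Function.Injective (fderiv ℝ φ p) := by
  refine (injective_iff_map_eq_zero _).2 fun e he => ?_
  have hpd : ∀ g : SmoothFn W', e.1 * ev hp (pd (1, 0) (pull φ hφ hm g))
      + e.2 * ev hp (pd (0, 1) (pull φ hφ hm g)) = 0 := by
    intro g
    have h : ev hp (pd e (pull φ hφ hm g)) = 0 := by rw [ev_pd_pull, he, map_zero]
    have h' : e = e.1 • ((1, 0) : ℝ × ℝ) + e.2 • ((0, 1) : ℝ × ℝ) := by simp
    rw [ev_pd, h', map_add, map_smul, map_smul] at h
    exact h
  have ha := hpd a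
  have hb := hpd b
  have hJ := congrArg (ev hp) hK
  simp only [dT, dX, conf_apply, map_mul, map_sub, map_one] at hJ
  obtain ⟨s, hs⟩ : ∃ s, s = ev hp (powFn coordT (coordT_pos hW) (1 - β)) := ⟨_, rfl⟩
  obtain ⟨w, hw⟩ : ∃ w, w = ev hp (powFn coordX (coordX_pos hW) (1 - α)) := ⟨_, rfl⟩
  rw [← hs, ← hw] at hJ
  refine Prod.ext ?_ ?_
  · rw [Prod.fst_zero]
    linear_combination (-e.1) * hJ + ev hp K * s * w *
      (ev hp (pd (0, 1) (pull φ hφ hm b)) * ha - ev hp (pd (0, 1) (pull φ hφ hm a)) * hb)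
  · rw [Prod.snd_zero]
    linear_combination (-e.2) * hJ + ev hp K * s * w *
      (ev hp (pd (1, 0) (pull φ hφ hm a)) * hb - ev hp (pd (1, 0) (pull φ hφ hm b)) * ha)

end InverseFunction

/-! ### The flow on a graph as a function of `(ε, t, x)`. -/

section FlowDerivative

variable {Ω : Opens (ℝ × ℝ × ℝ)} {W : Opens (ℝ × ℝ)}

/-- The coordinate `t` of `(ε, (t, x))`. -/
abbrev flowT : ℝ × (ℝ × ℝ) →L[ℝ] ℝ := coordT.comp (ContinuousLinearMap.snd ℝ ℝ (ℝ × ℝ))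

/-- The coordinate `x` of `(ε, (t, x))`. -/
abbrev flowX : ℝ × (ℝ × ℝ) →L[ℝ] ℝ := coordX.comp (ContinuousLinearMap.snd ℝ ℝ (ℝ × ℝ))

section

variable {U : Opens (ℝ × (ℝ × ℝ))}

/-- The conformable derivation with respect to `t` on functions of `(ε, (t, x))`. -/
def gT (β : ℝ) (hU : ∀ z ∈ U, z.2 ∈ quadrantTX) : Derivation ℝ (SmoothFn U) (SmoothFn U) :=
  conf β flowT (fun z hz => (hU z hz).1) (0, (1, 0))

/-- The conformable derivation with respect to `x` on functions of `(ε, (t, x))`. -/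
def gX (α : ℝ) (hU : ∀ z ∈ U, z.2 ∈ quadrantTX) : Derivation ℝ (SmoothFn U) (SmoothFn U) :=
  conf α flowX (fun z hz => (hU z hz).2) (0, (0, 1))

/-- The derivation with respect to `ε` on functions of `(ε, (t, x))`. -/
def gE : Derivation ℝ (SmoothFn U) (SmoothFn U) := pd (1, (0, 0))

theorem gE_gT (β : ℝ) (hU : ∀ z ∈ U, z.2 ∈ quadrantTX) (f : SmoothFn U) :
    gE (gT β hU f) = gT β hU (gE f) :=
  (conf_pd_comm _ _ (by simp) f).symm

theorem gE_gX (α : ℝ) (hU : ∀ z ∈ U, z.2 ∈ quadrantTX) (f : SmoothFn U) :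
    gE (gX α hU f) = gX α hU (gE f) :=
  (conf_pd_comm _ _ (by simp) f).symm

theorem contDiffOn_slice (ε : ℝ) : ContDiffOn ℝ ∞ (fun p : ℝ × ℝ => (ε, p)) W :=
  contDiffOn_const.prodMk contDiffOn_id

/-- Restriction to a fixed value of `ε`. -/
def slice (ε : ℝ) (hs : ∀ p ∈ W, (ε, p) ∈ U) : SmoothFn U →ₐ[ℝ] SmoothFn W :=
  pull (fun p => (ε, p)) (contDiffOn_slice ε) hs

theorem fderiv_slice (ε : ℝ) (p e : ℝ × ℝ) : fderiv ℝ (fun p : ℝ × ℝ => (ε, p)) p e = (0, e) := by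
  have h : HasFDerivAt (fun p : ℝ × ℝ => (ε, p))
      ((0 : ℝ × ℝ →L[ℝ] ℝ).prod (ContinuousLinearMap.id ℝ (ℝ × ℝ))) p :=
    (hasFDerivAt_const ε p).prodMk (hasFDerivAt_id p)
  rw [h.fderiv]
  rfl

theorem slice_gT (β ε : ℝ) (hU : ∀ z ∈ U, z.2 ∈ quadrantTX) (hW : (W : Set (ℝ × ℝ)) ⊆ quadrantTX)
    (hs : ∀ p ∈ W, (ε, p) ∈ U) (f : SmoothFn U) :
    slice ε hs (gT β hU f) = dT β hW (slice ε hs f) :=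
  pull_conf _ _ _ _ (fun p _ => fderiv_slice ε p _) (fun _ _ => rfl) β f

theorem slice_gX (α ε : ℝ) (hU : ∀ z ∈ U, z.2 ∈ quadrantTX) (hW : (W : Set (ℝ × ℝ)) ⊆ quadrantTX)
    (hs : ∀ p ∈ W, (ε, p) ∈ U) (f : SmoothFn U) :
    slice ε hs (gX α hU f) = dX α hW (slice ε hs f) :=
  pull_conf _ _ _ _ (fun p _ => fderiv_slice ε p _) (fun _ _ => rfl) α f

/-- Restriction to a smaller open set. -/
def restrict {U' : Opens (ℝ × (ℝ × ℝ))} (h : U' ≤ U) : SmoothFn U →ₐ[ℝ] SmoothFn U' :=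
  pull id contDiffOn_id h

theorem restrict_gT {U' : Opens (ℝ × (ℝ × ℝ))} (h : U' ≤ U) (β : ℝ)
    (hU : ∀ z ∈ U, z.2 ∈ quadrantTX) (hU' : ∀ z ∈ U', z.2 ∈ quadrantTX) (f : SmoothFn U) :
    restrict h (gT β hU f) = gT β hU' (restrict h f) :=
  pull_conf _ _ _ _ (fun p _ => by simp) (fun _ _ => rfl) β f

theorem restrict_gX {U' : Opens (ℝ × (ℝ × ℝ))} (h : U' ≤ U) (α : ℝ)
    (hU : ∀ z ∈ U, z.2 ∈ quadrantTX) (hU' : ∀ z ∈ U', z.2 ∈ quadrantTX) (f : SmoothFn U) :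
    restrict h (gX α hU f) = gX α hU' (restrict h f) :=
  pull_conf _ _ _ _ (fun p _ => by simp) (fun _ _ => rfl) α f

/-- The open set on which `J` does not vanish. -/
def nonvanishing (J : SmoothFn U) : Opens (ℝ × (ℝ × ℝ)) :=
  ⟨U ∩ rep J ⁻¹' {0}ᶜ, (contDiffOn_rep J).continuousOn.isOpen_inter_preimage U.isOpen
    isOpen_compl_singleton⟩

theorem exists_inverse (J : SmoothFn U) (h : nonvanishing J ≤ U) :
    ∃ K : SmoothFn (nonvanishing J), K * restrict h J = 1 := by
  refine ⟨of (fun z => (rep J z)⁻¹) (((contDiffOn_rep J).mono h).inv fun z hz => hz.2),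
    ext_ev fun z hz => ?_⟩
  rw [map_mul, ev_of, restrict, ev_pull, ← rep_eq, map_one]
  exact inv_mul_cancel₀ hz.2

end

variable {V : ℝ × ℝ × ℝ → ℝ × ℝ × ℝ} {D : Set (ℝ × (ℝ × ℝ × ℝ))}
  {Φ : ℝ × (ℝ × ℝ × ℝ) → ℝ × ℝ × ℝ} {u : ℝ × ℝ → ℝ}

/-- The domain of the flow on the graph of `u`. -/
def graphDomain (hD : IsOpen D) (W : Opens (ℝ × ℝ)) (hu : ContDiff ℝ ∞ u) :
    Opens (ℝ × (ℝ × ℝ)) :=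
  ⟨{z | z.2 ∈ W ∧ (z.1, (z.2.1, z.2.2, u z.2)) ∈ D},
    (W.isOpen.preimage continuous_snd).inter (hD.preimage (by
      have := hu.continuous
      fun_prop))⟩

/-- The flow on the graph of `u`. -/
def graphFlow (Φ : ℝ × (ℝ × ℝ × ℝ) → ℝ × ℝ × ℝ) (u : ℝ × ℝ → ℝ) (z : ℝ × (ℝ × ℝ)) : ℝ × ℝ × ℝ :=
  Φ (z.1, (z.2.1, z.2.2, u z.2))

theorem contDiffOn_graphFlow (hF : IsLocalFlow Ω V D Φ) (hu : ContDiff ℝ ∞ u) :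
    ContDiffOn ℝ ∞ (graphFlow Φ u) (graphDomain hF.isOpen W hu) :=
  hF.smooth.comp (t := D) (f := fun z : ℝ × (ℝ × ℝ) => (z.1, (z.2.1, z.2.2, u z.2)))
    (ContDiff.contDiffOn (by fun_prop)) fun z hz => hz.2

theorem graphFlow_mem (hF : IsLocalFlow Ω V D Φ) (hu : ContDiff ℝ ∞ u) :
    ∀ z ∈ graphDomain hF.isOpen W hu, graphFlow Φ u z ∈ Ω :=
  fun _ hz => hF.target_mem _ _ hz.2

/-- The function `t^β / β` on functions of `(t, x, u)`. -/
def spaceFnT (β : ℝ) (hΩ : (Ω : Set (ℝ × ℝ × ℝ)) ⊆ quadrant) : SmoothFn Ω :=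
  β⁻¹ • powFn coordT' (coordT'_pos hΩ) β

/-- The function `x^α / α` on functions of `(t, x, u)`. -/
def spaceFnX (α : ℝ) (hΩ : (Ω : Set (ℝ × ℝ × ℝ)) ⊆ quadrant) : SmoothFn Ω :=
  α⁻¹ • powFn coordX' (coordX'_pos hΩ) α

/-- The coordinate `u`. -/
def spaceFnU : SmoothFn Ω := of (fun q => q.2.2) contDiff_snd.snd.contDiffOn

section

variable {U : Opens (ℝ × (ℝ × ℝ))}

/-- Functions of `(t, x, u)` along the flow. -/
def alongFlow (hF : IsLocalFlow Ω V D Φ) (hu : ContDiff ℝ ∞ u)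
    (hU : U ≤ graphDomain hF.isOpen W hu) : SmoothFn Ω →ₐ[ℝ] SmoothFn U :=
  pull (graphFlow Φ u) ((contDiffOn_graphFlow hF hu).mono hU)
    fun z hz => graphFlow_mem hF hu z (hU hz)

/-- The Lie equation in the form `∂_ε (F ∘ Φ) = (V F) ∘ Φ`. -/
theorem ev_gE_alongFlow (hF : IsLocalFlow Ω V D Φ) (hu : ContDiff ℝ ∞ u)
    (hU : U ≤ graphDomain hF.isOpen W hu) (F : SmoothFn Ω) {z : ℝ × (ℝ × ℝ)} (hz : z ∈ U) :
    ev hz (gE (alongFlow hF hu hU F))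
      = fderiv ℝ (rep F) (graphFlow Φ u z) (V (graphFlow Φ u z)) := by
  have hz' := hU hz
  have hd : DifferentiableAt ℝ (graphFlow Φ u) z :=
    ((contDiffOn_graphFlow hF hu).contDiffAt
      ((graphDomain hF.isOpen W hu).isOpen.mem_nhds hz')).differentiableAt (by simp)
  have hl : HasDerivAt (fun s : ℝ => (s, z.2)) ((1, (0, 0)) : ℝ × (ℝ × ℝ)) z.1 :=
    (hasDerivAt_id _).prodMk (hasDerivAt_const _ _)
  have h1 := hd.hasFDerivAt.comp_hasDerivAt (f := fun s : ℝ => (s, z.2)) z.1 hl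
  have h2 := hF.lie_equation _ _ hz'.2
  rw [gE, alongFlow, ev_pd_pull, h1.unique h2]
  rfl

/-- Applying `V` to `t^β/β`, `x^α/α`, `u` produces its components in these coordinates. -/
theorem ev_gE_components (hF : IsLocalFlow Ω V D Φ) (hu : ContDiff ℝ ∞ u)
    (hU : U ≤ graphDomain hF.isOpen W hu) {α β : ℝ} (hα : α ≠ 0) (hβ : β ≠ 0)
    (hΩ : (Ω : Set (ℝ × ℝ × ℝ)) ⊆ quadrant) (hV : ContDiffOn ℝ ∞ V Ω) {z : ℝ × (ℝ × ℝ)}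
    (hz : z ∈ U) (hq : graphFlow Φ u z ∈ Ω) :
    ev hz (gE (alongFlow hF hu hU (spaceFnT β hΩ))) = ev hq (tauFn β hΩ hV) ∧
    ev hz (gE (alongFlow hF hu hU (spaceFnX α hΩ))) = ev hq (xiFn α hΩ hV) ∧
    ev hz (gE (alongFlow hF hu hU (spaceFnU))) = ev hq (etaFn hV) := by
  simp only [ev_gE_alongFlow, ← ev_pd _ _ hq]
  refine ⟨?_, ?_, ?_⟩
  · simp only [spaceFnT, Derivation.map_smul, pd_powFn, tauFn, map_smul, map_mul, smul_eq_mul,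
      ev_of, ContinuousLinearMap.coe_fst']
    field_simp
  · simp only [spaceFnX, Derivation.map_smul, pd_powFn, xiFn, map_smul, map_mul, smul_eq_mul,
      ev_of, ContinuousLinearMap.coe_fst', ContinuousLinearMap.coe_snd',
      ContinuousLinearMap.comp_apply]
    field_simp
  · rw [spaceFnU, ev_pd_of, etaFn, ev_of]
    have : HasFDerivAt (fun q : ℝ × ℝ × ℝ => q.2.2)
      ((ContinuousLinearMap.snd ℝ ℝ ℝ).comp (ContinuousLinearMap.snd ℝ ℝ (ℝ × ℝ)))
      (graphFlow Φ u z) :=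
      ((ContinuousLinearMap.snd ℝ ℝ ℝ).comp (ContinuousLinearMap.snd ℝ ℝ (ℝ × ℝ))).hasFDerivAt
    rw [this.fderiv]
    rfl

end

end FlowDerivative

/-! ### Generators of symmetries satisfy the linearized equation on solutions. -/

section SymmetryCriterion

variable {Ω : Opens (ℝ × ℝ × ℝ)} {W : Opens (ℝ × ℝ)} {V : ℝ × ℝ × ℝ → ℝ × ℝ × ℝ}
  {D : Set (ℝ × (ℝ × ℝ × ℝ))} {Φ : ℝ × (ℝ × ℝ × ℝ) → ℝ × ℝ × ℝ} {u : ℝ × ℝ → ℝ}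
  {U : Opens (ℝ × (ℝ × ℝ))}

/-- The quadrant as a bundled open set. -/
def quadrantOpens : Opens (ℝ × ℝ) := ⟨quadrantTX, isOpen_quadrantTX⟩

/-- The transformed independent variables on the graph of `u`. -/
def baseFlow (Φ : ℝ × (ℝ × ℝ × ℝ) → ℝ × ℝ × ℝ) (u : ℝ × ℝ → ℝ) (ε : ℝ) (p : ℝ × ℝ) : ℝ × ℝ :=
  ((graphFlow Φ u (ε, p)).1, (graphFlow Φ u (ε, p)).2.1)

theorem contDiffOn_graphFlow_slice (hF : IsLocalFlow Ω V D Φ) (hu : ContDiff ℝ ∞ u)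
    {W₁ : Opens (ℝ × ℝ)} {ε : ℝ} (hs : ∀ p ∈ W₁, (ε, p) ∈ graphDomain hF.isOpen W hu) :
    ContDiffOn ℝ ∞ (fun p => graphFlow Φ u (ε, p)) W₁ :=
  (contDiffOn_graphFlow hF hu).comp (contDiffOn_slice ε) hs

theorem contDiffOn_baseFlow (hF : IsLocalFlow Ω V D Φ) (hu : ContDiff ℝ ∞ u)
    {W₁ : Opens (ℝ × ℝ)} {ε : ℝ} (hs : ∀ p ∈ W₁, (ε, p) ∈ graphDomain hF.isOpen W hu) :
    ContDiffOn ℝ ∞ (baseFlow Φ u ε) W₁ :=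
  (contDiffOn_graphFlow_slice hF hu hs).fst.prodMk (contDiffOn_graphFlow_slice hF hu hs).snd.fst

theorem slice_alongFlow (hF : IsLocalFlow Ω V D Φ) (hu : ContDiff ℝ ∞ u)
    (hU : U ≤ graphDomain hF.isOpen W hu) (hΩ : (Ω : Set (ℝ × ℝ × ℝ)) ⊆ quadrant) (α β : ℝ)
    {W₁ W₁' : Opens (ℝ × ℝ)} {ε : ℝ} (hs : ∀ p ∈ W₁, (ε, p) ∈ U)
    (hW₁' : (W₁' : Set (ℝ × ℝ)) ⊆ quadrantTX) (hφ : ContDiffOn ℝ ∞ (baseFlow Φ u ε) W₁)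
    (hm : ∀ p ∈ W₁, baseFlow Φ u ε p ∈ W₁') :
    pull (baseFlow Φ u ε) hφ hm (coordFnT β hW₁') = slice ε hs (alongFlow hF hu hU (spaceFnT β hΩ)) ∧
    pull (baseFlow Φ u ε) hφ hm (coordFnX α hW₁') = slice ε hs (alongFlow hF hu hU (spaceFnX α hΩ)) :=
  ⟨ext_ev fun p hp => by
    simp only [slice, alongFlow, ev_pull, coordFnT, spaceFnT, map_smul, ev_powFn]
    rfl, ext_ev fun p hp => by
    simp only [slice, alongFlow, ev_pull, coordFnX, spaceFnX, map_smul, ev_powFn]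
    rfl⟩

/-- If the transformations of a flow map solutions to solutions, then the Korteweg-de Vries
expression in the transformed variables vanishes. -/
theorem newKdv_alongFlow_eq_zero {α β : ℝ} (hα : α ≠ 0) (hβ : β ≠ 0)
    (hΩ : (Ω : Set (ℝ × ℝ × ℝ)) ⊆ quadrant) (hF : IsLocalFlow Ω V D Φ)
    (hM : MapsSolutions α β D Φ) (hu : ContDiff ℝ ∞ u)
    (hsol : IsSolution α β W u) (hU : U ≤ graphDomain hF.isOpen W hu)
    (hUQ : ∀ z ∈ U, z.2 ∈ quadrantTX) {K : SmoothFn U}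
    (hK : K * (gT β hUQ (alongFlow hF hu hU (spaceFnT β hΩ))
        * gX α hUQ (alongFlow hF hu hU (spaceFnX α hΩ))
      - gX α hUQ (alongFlow hF hu hU (spaceFnT β hΩ))
        * gT β hUQ (alongFlow hF hu hU (spaceFnX α hΩ))) = 1)
    {ε : ℝ} {p₀ : ℝ × ℝ} (h₀ : (ε, p₀) ∈ U) :
    ev h₀ (newKdv (gT β hUQ) (gX α hUQ) (alongFlow hF hu hU (spaceFnT β hΩ))
      (alongFlow hF hu hU (spaceFnX α hΩ)) K (alongFlow hF hu hU spaceFnU)) = 0 := by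
  let W₀ : Opens (ℝ × ℝ) := ⟨(fun p => (ε, p)) ⁻¹' U, U.isOpen.preimage (by fun_prop)⟩
  have hs₀ : ∀ p ∈ W₀, (ε, p) ∈ U := fun p hp => hp
  have hK' : ∀ {W₁ : Opens (ℝ × ℝ)} (hs : ∀ p ∈ W₁, (ε, p) ∈ U)
      (hW₁ : (W₁ : Set (ℝ × ℝ)) ⊆ quadrantTX), _ := fun {W₁} hs hW₁ =>
    congrArg (slice ε hs) hK
  simp only [map_mul, map_sub, map_one] at hK'
  have hQ₀ : (W₀ : Set (ℝ × ℝ)) ⊆ quadrantTX := fun p hp => hUQ _ hp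
  have hφ₀ := contDiffOn_baseFlow hF hu fun p hp => hU (hs₀ p hp)
  have hm₀ : ∀ p ∈ W₀, baseFlow Φ u ε p ∈ quadrantOpens := fun p hp =>
    hΩ (graphFlow_mem hF hu _ (hU hp))
  have hinj : ∀ p ∈ W₀, Function.Injective (fderiv ℝ (baseFlow Φ u ε) p) := fun p hp => by
    obtain ⟨e1, e2⟩ := slice_alongFlow hF hu hU hΩ α β hs₀ (W₁' := quadrantOpens) subset_rfl hφ₀ hm₀
    have hk := hK' hs₀ hQ₀
    rw [slice_gT _ _ _ hQ₀, slice_gT _ _ _ hQ₀, slice_gX _ _ _ hQ₀, slice_gX _ _ _ hQ₀, ← e1,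
      ← e2] at hk
    exact injective_fderiv_of_jacobian hQ₀ hφ₀ hm₀ hk hp
  -- Near `p₀` the transformed surface is the graph of a smooth `v`, so the symmetry hypothesis
  -- applies to it.
  obtain ⟨W₁, W₁', v, hp₀, hW₁, himg, hv, hvc⟩ := exists_local_factorization hφ₀ hinj
    (contDiffOn_graphFlow_slice hF hu fun p hp => hU (hs₀ p hp)).snd.snd h₀
  have hs₁ : ∀ p ∈ W₁, (ε, p) ∈ U := fun p hp => hs₀ p (hW₁ hp)
  have hQ₁ : (W₁ : Set (ℝ × ℝ)) ⊆ quadrantTX := fun p hp => hQ₀ (hW₁ hp)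
  have hm₁ : ∀ p ∈ W₁, baseFlow Φ u ε p ∈ W₁' := fun p hp => by
    have : baseFlow Φ u ε p ∈ (W₁' : Set (ℝ × ℝ)) := himg ▸ Set.mem_image_of_mem _ hp
    exact this
  have hQ₁' : (W₁' : Set (ℝ × ℝ)) ⊆ quadrantTX := by
    rw [← himg]
    rintro _ ⟨p, hp, rfl⟩
    exact hm₀ p (hW₁ hp)
  have hφ₁ := hφ₀.mono hW₁
  have hsolv : IsSolution α β W₁' v := by
    refine hM ε W₁ W₁' u v W₁.isOpen W₁'.isOpen
      ⟨hu.contDiffOn, fun p hp => hsol.2 p (hU (hs₁ p hp)).1⟩ hv ?_ ?_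
    · rintro _ ⟨p, hp, rfl⟩
      exact (hU (hs₁ p hp)).2
    · rw [graphOver, graphOver, ← himg, Set.image_image, Set.image_image]
      refine Set.image_congr fun p hp => ?_
      rw [hvc p hp]
      rfl
  obtain ⟨e1, e2⟩ := slice_alongFlow hF hu hU hΩ α β hs₁ hQ₁' hφ₁ hm₁
  have e3 : pull (baseFlow Φ u ε) hφ₁ hm₁ (of v hv) = slice ε hs₁ (alongFlow hF hu hU spaceFnU) :=
    ext_ev fun p hp => by
      simp only [slice, alongFlow, ev_pull, spaceFnU, ev_of]
      exact hvc p hp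
  have hk := hK' hs₁ hQ₁
  rw [slice_gT _ _ _ hQ₁, slice_gT _ _ _ hQ₁, slice_gX _ _ _ hQ₁, slice_gX _ _ _ hQ₁] at hk
  have key := pull_kdvForm hα hβ hQ₁ hQ₁' hφ₁ hm₁ (of v hv) e1 e2 e3 hk
  rw [(isSolution_iff α β hQ₁' hv).1 hsolv, map_zero,
    ← map_newKdv (slice ε hs₁) (slice_gT β ε hUQ hQ₁ hs₁) (slice_gX α ε hUQ hQ₁ hs₁)] at key
  have := congrArg (ev hp₀) key
  rw [map_zero, slice, ev_pull] at this
  exact this.symm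

/-- Generators of symmetries satisfy the linearized equation along solutions. -/
theorem criticalOnSolutions_of_mapsSolutions {α β : ℝ} (hα : α ≠ 0) (hβ : β ≠ 0)
    (hΩ : (Ω : Set (ℝ × ℝ × ℝ)) ⊆ quadrant) (hV : ContDiffOn ℝ ∞ V Ω) (hF : IsLocalFlow Ω V D Φ)
    (hM : MapsSolutions α β D Φ) : CriticalOnSolutions α β hΩ hV := by
  intro W hW u hu hg hsol
  have hsol' := (isSolution_iff α β hW hu.contDiffOn).2 hsol
  refine ext_ev fun p₀ hp₀ => ?_
  let U₀ := graphDomain hF.isOpen W hu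
  have hUQ₀ : ∀ z ∈ U₀, z.2 ∈ quadrantTX := fun z hz => hW hz.1
  have hs₀ : ∀ p ∈ W, ((0 : ℝ), p) ∈ U₀ := fun p hp => ⟨hp, hF.zero_mem _ (hg p hp)⟩
  have hinit : ∀ p ∈ W, graphFlow Φ u (0, p) = (p.1, p.2, u p) := fun p hp =>
    hF.initial _ (hg p hp)
  have sT : ∀ {W₁ : Opens (ℝ × ℝ)} {U : Opens (ℝ × (ℝ × ℝ))} (hU : U ≤ U₀) (hW₁ : W₁ ≤ W)
      (hQ : (W₁ : Set (ℝ × ℝ)) ⊆ quadrantTX) (hs : ∀ p ∈ W₁, ((0 : ℝ), p) ∈ U),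
      slice 0 hs (alongFlow hF hu hU (spaceFnT β hΩ)) = coordFnT β hQ := fun hU hW₁ hQ hs =>
    ext_ev fun p hp => by
      simp only [slice, alongFlow, ev_pull, spaceFnT, coordFnT, map_smul, ev_powFn,
        hinit p (hW₁ hp)]
      rfl
  have sX : ∀ {W₁ : Opens (ℝ × ℝ)} {U : Opens (ℝ × (ℝ × ℝ))} (hU : U ≤ U₀) (hW₁ : W₁ ≤ W)
      (hQ : (W₁ : Set (ℝ × ℝ)) ⊆ quadrantTX) (hs : ∀ p ∈ W₁, ((0 : ℝ), p) ∈ U),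
      slice 0 hs (alongFlow hF hu hU (spaceFnX α hΩ)) = coordFnX α hQ := fun hU hW₁ hQ hs =>
    ext_ev fun p hp => by
      simp only [slice, alongFlow, ev_pull, spaceFnX, coordFnX, map_smul, ev_powFn,
        hinit p (hW₁ hp)]
      rfl
  -- The Jacobian of the new coordinates is `1` at `ε = 0` but may vanish later; the argument is
  -- confined to the open set where it is invertible.
  obtain ⟨J, hJ⟩ : ∃ J, J = gT β hUQ₀ (alongFlow hF hu le_rfl (spaceFnT β hΩ))
        * gX α hUQ₀ (alongFlow hF hu le_rfl (spaceFnX α hΩ))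
      - gX α hUQ₀ (alongFlow hF hu le_rfl (spaceFnT β hΩ))
        * gT β hUQ₀ (alongFlow hF hu le_rfl (spaceFnX α hΩ)) := ⟨_, rfl⟩
  have hJ1 : slice 0 hs₀ J = 1 := by
    rw [hJ]
    simp only [map_sub, map_mul, slice_gT _ _ _ hW, slice_gX _ _ _ hW, sT le_rfl le_rfl hW,
      sX le_rfl le_rfl hW, dT_coordFnT hβ, dX_coordFnX hα, dX_coordFnT, dT_coordFnX]
    simp
  have hU : nonvanishing J ≤ U₀ := fun z hz => hz.1
  have hUQ : ∀ z ∈ nonvanishing J, z.2 ∈ quadrantTX := fun z hz => hUQ₀ z (hU hz)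
  obtain ⟨K, hK⟩ := exists_inverse J hU
  have hr : ∀ F : SmoothFn Ω, restrict hU (alongFlow hF hu le_rfl F) = alongFlow hF hu hU F :=
    fun F => ext_ev fun z hz => by
      simp only [restrict, alongFlow, ev_pull, id_eq]
  have hKJ := congrArg (restrict hU) hJ
  simp only [map_sub, map_mul, restrict_gT hU β hUQ₀ hUQ, restrict_gX hU α hUQ₀ hUQ, hr] at hKJ
  rw [hKJ] at hK
  let W₀ : Opens (ℝ × ℝ) :=
    ⟨(fun p => ((0 : ℝ), p)) ⁻¹' nonvanishing J, (nonvanishing J).isOpen.preimage (by fun_prop)⟩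
  have hs : ∀ p ∈ W₀, ((0 : ℝ), p) ∈ nonvanishing J := fun p hp => hp
  have hW₀ : W₀ ≤ W := fun p hp => (hU (hs p hp)).1
  have hQ : (W₀ : Set (ℝ × ℝ)) ⊆ quadrantTX := fun p hp => hW (hW₀ hp)
  have hp₀' : p₀ ∈ W₀ := by
    refine ⟨hs₀ p₀ hp₀, ?_⟩
    have := congrArg (ev hp₀) hJ1
    rw [slice, ev_pull, ← rep_eq, map_one] at this
    simp only [Set.mem_preimage, Set.mem_compl_iff, Set.mem_singleton_iff]
    rw [this]
    exact one_ne_zero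
  have hg₀ : ∀ p ∈ W₀, (p.1, p.2, u p) ∈ Ω := fun p hp => hg p (hW₀ hp)
  have hcomp : ∀ (F : SmoothFn Ω) (G : SmoothFn Ω),
      (∀ z (hz : z ∈ nonvanishing J) (hq : graphFlow Φ u z ∈ Ω),
        ev hz (gE (alongFlow hF hu hU F)) = ev hq G) →
      slice 0 hs (gE (alongFlow hF hu hU F)) = onGraph hu.contDiffOn hg₀ G := by
    intro F G h
    refine ext_ev fun p hp => ?_
    rw [slice, ev_pull, h _ _ (graphFlow_mem hF hu _ (hU (hs p hp))), ev_onGraph, ← rep_eq,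
      ← rep_eq, hinit p (hW₀ hp)]
  have key := map_derivation_newKdv (slice 0 hs) (gE_gT β hUQ) (gE_gX α hUQ)
    (slice_gT β 0 hUQ hQ hs) (slice_gX α 0 hUQ hQ hs) (alongFlow hF hu hU spaceFnU) hK
    (by rw [sT hU hW₀ hQ, dT_coordFnT hβ]) (by rw [sT hU hW₀ hQ, dX_coordFnT])
    (by rw [sX hU hW₀ hQ, dT_coordFnX]) (by rw [sX hU hW₀ hQ, dX_coordFnX hα])
  rw [hcomp _ (tauFn β hΩ hV) fun z hz hq => (ev_gE_components hF hu hU hα hβ hΩ hV hz hq).1,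
    hcomp _ (xiFn α hΩ hV) fun z hz hq => (ev_gE_components hF hu hU hα hβ hΩ hV hz hq).2.1,
    hcomp _ (etaFn hV) fun z hz hq => (ev_gE_components hF hu hU hα hβ hΩ hV hz hq).2.2,
    show slice 0 hs (alongFlow hF hu hU spaceFnU) = of u hu.contDiffOn from ext_ev fun p hp => by
      simp only [slice, alongFlow, ev_pull, spaceFnU, ev_of, hinit p (hW₀ hp)]] at key
  have hlie := congrArg (ev hp₀') key
  rw [← lieOn, ev_lieOn, slice, ev_pull] at hlie
  rw [ev_lieOn, ← hlie, map_zero, gE, ev_pd]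
  have hz := hs p₀ hp₀'
  have hd := differentiableAt_of (contDiffOn_rep (newKdv (gT β hUQ) (gX α hUQ)
    (alongFlow hF hu hU (spaceFnT β hΩ)) (alongFlow hF hu hU (spaceFnX α hΩ)) K
    (alongFlow hF hu hU spaceFnU))) hz
  have hl : HasDerivAt (fun s : ℝ => (s, p₀)) ((1, (0, 0)) : ℝ × (ℝ × ℝ)) 0 :=
    (hasDerivAt_id _).prodMk (hasDerivAt_const _ _)
  have h1 := hd.hasFDerivAt.comp_hasDerivAt (f := fun s : ℝ => (s, p₀)) 0 hl
  -- The linearized expression is the `ε`-derivative of a function that vanishes for all small `ε`.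
  refine h1.unique ((hasDerivAt_const (0 : ℝ) (0 : ℝ)).congr_of_eventuallyEq ?_)
  have hev : ∀ᶠ s in nhds (0 : ℝ), (s, p₀) ∈ nonvanishing J :=
    ((nonvanishing J).isOpen.preimage (f := fun s : ℝ => (s, p₀)) (by fun_prop)).mem_nhds hz
  filter_upwards [hev] with s hs
  rw [Function.comp_apply, rep_eq _ hs]
  exact newKdv_alongFlow_eq_zero hα hβ hΩ hF hM hu hsol' hU hUQ hK hs

end SymmetryCriterion

/-! ### Scalar linear ODEs and the explicit affine flow. -/

section LinearEquations

theorem exists_primitive {h : ℝ → ℝ} (hh : ContDiff ℝ ∞ h) :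
    ∃ F : ℝ → ℝ, ContDiff ℝ ∞ F ∧ F 0 = 0 ∧ ∀ s, HasDerivAt F (h s) s := by
  have hd : ∀ s, HasDerivAt (fun s => ∫ r in (0 : ℝ)..s, h r) (h s) s := fun s =>
    intervalIntegral.integral_hasDerivAt_right (hh.continuous.intervalIntegrable _ _)
      (hh.continuous.stronglyMeasurableAtFilter _ _) hh.continuous.continuousAt
  refine ⟨_, contDiff_infty_iff_deriv.2 ⟨fun s => (hd s).differentiableAt, ?_⟩, by simp, hd⟩
  rwa [funext fun s => (hd s).deriv]

theorem hasDerivAt_exp_mul (μ s : ℝ) :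
    HasDerivAt (fun s => Real.exp (μ * s)) (μ * Real.exp (μ * s)) s := by
  have := ((hasDerivAt_id s).const_mul μ).exp
  simpa [mul_comm] using this

/-- Variation of constants. -/
theorem exists_linear_solution (μ : ℝ) {h : ℝ → ℝ} (hh : ContDiff ℝ ∞ h) :
    ∃ y : ℝ → ℝ, ContDiff ℝ ∞ y ∧ y 0 = 0 ∧ ∀ s, HasDerivAt y (μ * y s + h s) s := by
  obtain ⟨F, hF, hF0, hFd⟩ := exists_primitive (h := fun s => Real.exp (-μ * s) * h s) (by fun_prop)
  refine ⟨fun s => Real.exp (μ * s) * F s, by fun_prop, by simp [hF0], fun s => ?_⟩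
  refine HasDerivAt.congr_deriv ((hasDerivAt_exp_mul μ s).mul (hFd s)) ?_
  have : Real.exp (μ * s) * Real.exp (-μ * s) = 1 := by
    rw [← Real.exp_add]
    simp
  linear_combination h s * this

/-- On the interval `S`, `e^{-μs}(y - z)` has zero derivative and vanishes at `0`. -/
theorem linear_solution_unique {S : Set ℝ} (hS : IsOpen S) (hc : S.OrdConnected) (h0 : 0 ∈ S)
    {y z h : ℝ → ℝ} {μ : ℝ} (hy : ∀ s ∈ S, HasDerivAt y (μ * y s + h s) s)
    (hz : ∀ s ∈ S, HasDerivAt z (μ * z s + h s) s) (h0' : y 0 = z 0) {s : ℝ} (hs : s ∈ S) :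
    y s = z s := by
  have hd : ∀ s ∈ S, HasDerivAt (fun s => Real.exp (-μ * s) * (y s - z s)) 0 s := fun s hs => by
    refine HasDerivAt.congr_deriv ((hasDerivAt_exp_mul (-μ) s).mul ((hy s hs).sub (hz s hs))) ?_
    ring
  have h := hS.is_const_of_deriv_eq_zero hc.isPreconnected
    (fun s hs => (hd s hs).differentiableAt.differentiableWithinAt) (fun s hs => (hd s hs).deriv)
    hs h0
  simp only [h0', sub_self, mul_zero, mul_eq_zero, Real.exp_ne_zero, false_or] at h
  exact sub_eq_zero.1 h

/-- The inhomogeneous parts of the affine flow which corresponds to the constants `c₁, …, c₄` in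
the variables `t^β / β`, `x^α / α`, `u`. -/
structure FlowCoefficients (c₁ c₂ c₃ c₄ : ℝ) where
  b : ℝ → ℝ
  g : ℝ → ℝ
  m : ℝ → ℝ
  contDiff_b : ContDiff ℝ ∞ b
  contDiff_g : ContDiff ℝ ∞ g
  contDiff_m : ContDiff ℝ ∞ m
  b_zero : b 0 = 0
  g_zero : g 0 = 0
  m_zero : m 0 = 0
  hasDerivAt_b : ∀ s, HasDerivAt b (-(3 / 2 * c₁) * b s + c₂) s
  hasDerivAt_g : ∀ s, HasDerivAt g (-(1 / 2 * c₁) * g s + (6 * c₃ * b s + c₄)) s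
  hasDerivAt_m : ∀ s, HasDerivAt m (c₁ * m s + c₃) s

theorem nonempty_flowCoefficients (c₁ c₂ c₃ c₄ : ℝ) : Nonempty (FlowCoefficients c₁ c₂ c₃ c₄) := by
  obtain ⟨b, hb, hb0, hb'⟩ := exists_linear_solution (-(3 / 2 * c₁)) (contDiff_const (c := c₂))
  obtain ⟨m, hm, hm0, hm'⟩ := exists_linear_solution c₁ (contDiff_const (c := c₃))
  obtain ⟨g, hg, hg0, hg'⟩ := exists_linear_solution (-(1 / 2 * c₁))
    (h := fun s => 6 * c₃ * b s + c₄) (by fun_prop)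
  exact ⟨⟨b, g, m, hb, hg, hm, hb0, hg0, hm0, hb', hg', hm'⟩⟩

namespace FlowCoefficients

variable {c₁ c₂ c₃ c₄ : ℝ} (C : FlowCoefficients c₁ c₂ c₃ c₄)

/-- The affine flow. -/
def flow (s : ℝ) (y : ℝ × ℝ × ℝ) : ℝ × ℝ × ℝ :=
  (Real.exp (-(3 / 2 * c₁) * s) * y.1 + C.b s,
    Real.exp (-(1 / 2 * c₁) * s) * y.2.1 + 6 * Real.exp (-(3 / 2 * c₁) * s) * C.m s * y.1 + C.g s,
    Real.exp (c₁ * s) * y.2.2 + C.m s)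

theorem contDiff_flow : ContDiff ℝ ∞ (fun z : ℝ × (ℝ × ℝ × ℝ) => C.flow z.1 z.2) := by
  have h1 := C.contDiff_b
  have h2 := C.contDiff_g
  have h3 := C.contDiff_m
  unfold flow
  fun_prop

theorem flow_zero (y : ℝ × ℝ × ℝ) : C.flow 0 y = y := by
  simp [flow, C.b_zero, C.g_zero, C.m_zero]

theorem hasDerivAt_flow_fst (y : ℝ × ℝ × ℝ) (s : ℝ) :
    HasDerivAt (fun s => (C.flow s y).1) (-(3 / 2 * c₁) * (C.flow s y).1 + c₂) s := by
  refine HasDerivAt.congr_deriv (((hasDerivAt_exp_mul _ s).mul_const y.1).add (C.hasDerivAt_b s)) ?_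
  simp only [flow]
  ring

/-- The mixed term `6e^{-3c₁s/2} m y₁` has rate `-3/2 + 1 = -1/2` times `c₁`, and the `c₃` in `m'`
supplies the source `6c₃ e^{-3c₁s/2} y₁`. -/
theorem hasDerivAt_flow_snd (y : ℝ × ℝ × ℝ) (s : ℝ) :
    HasDerivAt (fun s => (C.flow s y).2.1)
      (-(1 / 2 * c₁) * (C.flow s y).2.1 + (6 * c₃ * (C.flow s y).1 + c₄)) s := by
  refine HasDerivAt.congr_deriv ((((hasDerivAt_exp_mul _ s).mul_const y.2.1).add ((((hasDerivAt_exp_mul _ s).const_mul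
    6).mul (C.hasDerivAt_m s)).mul_const y.1)).add (C.hasDerivAt_g s)) ?_
  simp only [flow]
  ring

theorem hasDerivAt_flow_thd (y : ℝ × ℝ × ℝ) (s : ℝ) :
    HasDerivAt (fun s => (C.flow s y).2.2) (c₁ * (C.flow s y).2.2 + c₃) s := by
  refine HasDerivAt.congr_deriv (((hasDerivAt_exp_mul _ s).mul_const y.2.2).add (C.hasDerivAt_m s)) ?_
  simp only [flow]
  ring

end FlowCoefficients

end LinearEquations

/-! ### Integrating the fields of the family on `Ω`. -/

section IntegrateFlow

/-- The variables `t^β / β`, `x^α / α`, `u`. -/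
def flatten (α β : ℝ) (q : ℝ × ℝ × ℝ) : ℝ × ℝ × ℝ :=
  (β⁻¹ * q.1 ^ β, α⁻¹ * q.2.1 ^ α, q.2.2)

/-- The variables `t`, `x`, `u` in terms of `t^β / β`, `x^α / α`, `u`. -/
def unflatten (α β : ℝ) (y : ℝ × ℝ × ℝ) : ℝ × ℝ × ℝ :=
  ((β * y.1) ^ β⁻¹, (α * y.2.1) ^ α⁻¹, y.2.2)

/-- The coefficients of the symmetries of the fractional Korteweg-de Vries equation. -/
def symmetryField (α β c₁ c₂ c₃ c₄ : ℝ) (q : ℝ × ℝ × ℝ) : ℝ × ℝ × ℝ :=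
  (-3 * c₁ * q.1 / (2 * β) + c₂ * q.1 ^ (1 - β),
    -c₁ * q.2.1 / (2 * α) + 6 * c₃ / β * q.1 ^ β * q.2.1 ^ (1 - α) + c₄ * q.2.1 ^ (1 - α),
    c₁ * q.2.2 + c₃)

variable {α β c₁ c₂ c₃ c₄ : ℝ}

theorem inv_mul_rpow_unflat {γ y : ℝ} (hγ : 0 < γ) (hy : 0 < y) :
    γ⁻¹ * ((γ * y) ^ γ⁻¹) ^ γ = y := by
  rw [Real.rpow_inv_rpow (by positivity) hγ.ne', inv_mul_cancel_left₀ hγ.ne']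

theorem unflat_flat {γ t : ℝ} (hγ : 0 < γ) (ht : 0 < t) : (γ * (γ⁻¹ * t ^ γ)) ^ γ⁻¹ = t := by
  rw [mul_inv_cancel_left₀ hγ.ne', Real.rpow_rpow_inv ht.le hγ.ne']

theorem unflatten_flatten (hα : 0 < α) (hβ : 0 < β) {q : ℝ × ℝ × ℝ} (hq : q ∈ quadrant) :
    unflatten α β (flatten α β q) = q := by
  simp only [unflatten, flatten, unflat_flat hα hq.2, unflat_flat hβ hq.1]

theorem continuous_flatten (hα : 0 < α) (hβ : 0 < β) : Continuous (flatten α β) := by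
  have h1 : Continuous fun q : ℝ × ℝ × ℝ => q.1 ^ β :=
    continuous_fst.rpow_const fun _ => Or.inr hβ.le
  have h2 : Continuous fun q : ℝ × ℝ × ℝ => q.2.1 ^ α :=
    continuous_snd.fst.rpow_const fun _ => Or.inr hα.le
  unfold flatten
  fun_prop

theorem continuous_unflatten (hα : 0 < α) (hβ : 0 < β) : Continuous (unflatten α β) := by
  have h1 : Continuous fun q : ℝ × ℝ × ℝ => (β * q.1) ^ β⁻¹ :=
    (continuous_fst.const_mul β).rpow_const fun _ => Or.inr (inv_nonneg.2 hβ.le)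
  have h2 : Continuous fun q : ℝ × ℝ × ℝ => (α * q.2.1) ^ α⁻¹ :=
    (continuous_snd.fst.const_mul α).rpow_const fun _ => Or.inr (inv_nonneg.2 hα.le)
  unfold unflatten
  fun_prop

theorem contDiffOn_flatten : ContDiffOn ℝ ∞ (flatten α β) quadrant :=
  ((contDiff_fst.contDiffOn.rpow_const_of_ne fun _ hq => hq.1.ne').const_smul β⁻¹).prodMk
    (((contDiff_snd.fst.contDiffOn.rpow_const_of_ne fun _ hq => hq.2.ne').const_smul α⁻¹).prodMk
      contDiff_snd.snd.contDiffOn)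

theorem contDiffOn_unflatten (hα : 0 < α) (hβ : 0 < β) :
    ContDiffOn ℝ ∞ (unflatten α β) quadrant :=
  (((contDiff_fst.const_smul β).contDiffOn.rpow_const_of_ne
    fun _ hq => (mul_pos hβ hq.1).ne').prodMk
    (((contDiff_snd.fst.const_smul α).contDiffOn.rpow_const_of_ne
      fun _ hq => (mul_pos hα hq.2).ne').prodMk contDiff_snd.snd.contDiffOn))

theorem flatten_mem_quadrant (hα : 0 < α) (hβ : 0 < β) {q : ℝ × ℝ × ℝ} (hq : q ∈ quadrant) :
    flatten α β q ∈ quadrant :=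
  ⟨mul_pos (inv_pos.2 hβ) (Real.rpow_pos_of_pos hq.1 _),
    mul_pos (inv_pos.2 hα) (Real.rpow_pos_of_pos hq.2 _)⟩

/-- The part of `quadrant` which corresponds to `Ω` in the variables `t^β / β`, `x^α / α`, `u`. -/
def flattened (α β : ℝ) (Ω : Set (ℝ × ℝ × ℝ)) : Set (ℝ × ℝ × ℝ) :=
  quadrant ∩ unflatten α β ⁻¹' Ω

theorem isOpen_quadrant : IsOpen quadrant :=
  (isOpen_lt continuous_const continuous_fst).inter
    (isOpen_lt continuous_const continuous_snd.fst)

theorem isOpen_flattened (hα : 0 < α) (hβ : 0 < β) {Ω : Set (ℝ × ℝ × ℝ)} (h : IsOpen Ω) :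
    IsOpen (flattened α β Ω) :=
  isOpen_quadrant.inter (h.preimage (continuous_unflatten hα hβ))

variable (C : FlowCoefficients c₁ c₂ c₃ c₄)

/-- The domain on which the affine flow does not leave `Ω`. -/
def flowDomain (α β : ℝ) (Ω : Set (ℝ × ℝ × ℝ)) : Set (ℝ × (ℝ × ℝ × ℝ)) :=
  {z | z.2 ∈ Ω ∧ ∀ θ ∈ Set.Icc (0 : ℝ) 1, C.flow (θ * z.1) (flatten α β z.2) ∈ flattened α β Ω}

theorem isOpen_flowDomain (hα : 0 < α) (hβ : 0 < β) {Ω : Set (ℝ × ℝ × ℝ)} (h : IsOpen Ω) :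
    IsOpen (flowDomain C α β Ω) := by
  refine (h.preimage continuous_snd).inter (isOpen_iff_eventually.2 fun z hz => ?_)
  -- Staying in an open set over the whole time segment is an open condition because `[0, 1]` is
  -- compact.
  refine isCompact_Icc.eventually_forall_of_forall_eventually fun θ hθ => ?_
  have hc : Continuous fun w : (ℝ × (ℝ × ℝ × ℝ)) × ℝ =>
      C.flow (w.2 * w.1.1) (flatten α β w.1.2) :=
    C.contDiff_flow.continuous.comp ((continuous_snd.mul continuous_fst.fst).prodMk
      ((continuous_flatten hα hβ).comp continuous_fst.snd))
  exact ((isOpen_flattened hα hβ h).preimage hc).mem_nhds (hz θ hθ)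

theorem ordConnected_flowDomain (Ω : Set (ℝ × ℝ × ℝ)) (q : ℝ × ℝ × ℝ) :
    {ε : ℝ | (ε, q) ∈ flowDomain C α β Ω}.OrdConnected := by
  -- The set of admissible times is star-shaped about `0`, hence an interval.
  have key : ∀ ε, (ε, q) ∈ flowDomain C α β Ω → ∀ κ ∈ Set.Icc (0 : ℝ) 1,
      (κ * ε, q) ∈ flowDomain C α β Ω := fun ε hε κ hκ =>
    ⟨hε.1, fun θ hθ => by
      have := hε.2 (θ * κ) ⟨mul_nonneg hθ.1 hκ.1, mul_le_one₀ hθ.2 hκ.1 hκ.2⟩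
      rwa [mul_assoc] at this⟩
  refine ⟨fun x hx y hy z hz => ?_⟩
  rcases le_total 0 z with h | h
  · rcases h.eq_or_lt with rfl | h'
    · simpa using key x hx 0 ⟨le_rfl, zero_le_one⟩
    · have := key y hy (z / y) ⟨div_nonneg h (h.trans hz.2), div_le_one_of_le₀ hz.2 (h.trans hz.2)⟩
      rwa [div_mul_cancel₀ _ (h'.trans_le hz.2).ne'] at this
  · rcases h.eq_or_lt with rfl | h'
    · simpa using key x hx 0 ⟨le_rfl, zero_le_one⟩
    · have := key x hx (z / x) ⟨div_nonneg_of_nonpos h (hz.1.trans h),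
        div_le_one_of_ge hz.1 (hz.1.trans h)⟩
      rwa [div_mul_cancel₀ _ (hz.1.trans_lt h').ne] at this

theorem hasDerivAt_unflat {γ : ℝ} (hγ : 0 < γ) {y : ℝ → ℝ} {y' s : ℝ} (hy : HasDerivAt y y' s)
    (h : 0 < y s) :
    HasDerivAt (fun s => (γ * y s) ^ γ⁻¹) (((γ * y s) ^ γ⁻¹) ^ (1 - γ) * y') s := by
  refine ((hy.const_mul γ).rpow_const (p := γ⁻¹) (Or.inl (mul_pos hγ h).ne')).congr_deriv ?_
  rw [← Real.rpow_mul (mul_pos hγ h).le, mul_sub, inv_mul_cancel₀ hγ.ne', mul_one]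
  field_simp

theorem rpow_one_sub_mul_unflat {γ y : ℝ} (hγ : 0 < γ) (hy : 0 < y) :
    ((γ * y) ^ γ⁻¹) ^ (1 - γ) * y = γ⁻¹ * (γ * y) ^ γ⁻¹ := by
  have h := Real.rpow_pos_of_pos (mul_pos hγ hy) γ⁻¹
  nth_rw 2 [← inv_mul_rpow_unflat hγ hy]
  rw [mul_left_comm, ← Real.rpow_add h]
  simp

theorem hasDerivAt_flat {γ : ℝ} (hγ : 0 < γ) {t : ℝ → ℝ} {t' s : ℝ} (ht : HasDerivAt t t' s)
    (h : 0 < t s) :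
    HasDerivAt (fun s => γ⁻¹ * t s ^ γ) (t s ^ (γ - 1) * t') s := by
  refine ((ht.rpow_const (p := γ) (Or.inl h.ne')).const_mul γ⁻¹).congr_deriv ?_
  field_simp

theorem rpow_mul_rpow_one_sub {t : ℝ} (ht : 0 < t) (γ : ℝ) : t ^ (γ - 1) * t ^ (1 - γ) = 1 := by
  rw [← Real.rpow_add ht]
  simp

theorem rpow_sub_one_mul {t : ℝ} (ht : 0 < t) (γ : ℝ) : t ^ (γ - 1) * t = t ^ γ := by
  rw [Real.rpow_sub_one ht.ne', div_mul_cancel₀ _ ht.ne']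

theorem exists_isLocalFlow (hα : 0 < α) (hβ : 0 < β) {Ω : Set (ℝ × ℝ × ℝ)} (hO : IsOpen Ω)
    (hΩ : Ω ⊆ quadrant) {V : ℝ × ℝ × ℝ → ℝ × ℝ × ℝ}
    (hV : ∀ q ∈ Ω, V q = symmetryField α β c₁ c₂ c₃ c₄ q) :
    IsLocalFlow Ω V (flowDomain C α β Ω)
      fun z => unflatten α β (C.flow z.1 (flatten α β z.2)) := by
  have hmem : ∀ ε q, (ε, q) ∈ flowDomain C α β Ω → C.flow ε (flatten α β q) ∈ flattened α β Ω :=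
    fun ε q h => by simpa using h.2 1 ⟨zero_le_one, le_rfl⟩
  refine ⟨isOpen_flowDomain C hα hβ hO, fun q hq => ⟨hq, fun θ _ => ?_⟩, fun ε q h => h.1,
    fun ε q h => (hmem ε q h).2, ordConnected_flowDomain C Ω, ?_, fun q hq => ?_,
    fun ε q h => ?_⟩
  · rw [mul_zero, C.flow_zero]
    refine ⟨flatten_mem_quadrant hα hβ (hΩ hq), ?_⟩
    rwa [Set.mem_preimage, unflatten_flatten hα hβ (hΩ hq)]
  · exact (contDiffOn_unflatten hα hβ).comp (C.contDiff_flow.comp_contDiffOn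
      (contDiff_fst.contDiffOn.prodMk (contDiffOn_flatten.comp contDiff_snd.contDiffOn
        fun z hz => hΩ hz.1))) fun z hz => (hmem z.1 z.2 hz).1
  · simp only [C.flow_zero, unflatten_flatten hα hβ (hΩ hq)]
  · obtain ⟨⟨h1, h2⟩, h3⟩ := hmem ε q h
    simp only [hV _ h3]
    refine ((hasDerivAt_unflat hβ (C.hasDerivAt_flow_fst _ ε) h1).prodMk
      ((hasDerivAt_unflat hα (C.hasDerivAt_flow_snd _ ε) h2).prodMk
        (C.hasDerivAt_flow_thd _ ε))).congr_deriv ?_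
    simp only [symmetryField, unflatten]
    generalize C.flow ε (flatten α β q) = y at *
    have et := rpow_one_sub_mul_unflat hβ h1
    have ex := rpow_one_sub_mul_unflat hα h2
    rw [Real.rpow_inv_rpow (mul_pos hβ h1).le hβ.ne']
    refine Prod.ext ?_ (Prod.ext ?_ rfl)
    · simp only
      field_simp at et ⊢
      linear_combination -(3 * c₁) * et
    · simp only
      field_simp at ex ⊢
      linear_combination -c₁ * ex

/-- Symmetry is demanded of every local flow, so each is identified with the affine one: its
flattened components solve a triangular linear system on an interval of times containing `0`. -/
theorem flatten_flow_eq (hα : 0 < α) (hβ : 0 < β) {Ω : Set (ℝ × ℝ × ℝ)}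
    (hΩ : Ω ⊆ quadrant) {V : ℝ × ℝ × ℝ → ℝ × ℝ × ℝ}
    (hV : ∀ q ∈ Ω, V q = symmetryField α β c₁ c₂ c₃ c₄ q) {D : Set (ℝ × (ℝ × ℝ × ℝ))}
    {Φ : ℝ × (ℝ × ℝ × ℝ) → ℝ × ℝ × ℝ} (hF : IsLocalFlow Ω V D Φ) {ε : ℝ} {q : ℝ × ℝ × ℝ}
    (h : (ε, q) ∈ D) : flatten α β (Φ (ε, q)) = C.flow ε (flatten α β q) := by
  have hq := hF.source_mem _ _ h
  have hS : IsOpen {s : ℝ | (s, q) ∈ D} := hF.isOpen.preimage (f := fun s => (s, q)) (by fun_prop)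
  have hc := hF.ordConnected q
  have h0 : (0 : ℝ) ∈ {s : ℝ | (s, q) ∈ D} := hF.zero_mem q hq
  have hi : flatten α β (Φ (0, q)) = C.flow 0 (flatten α β q) := by
    rw [hF.initial q hq, C.flow_zero]
  have hpos : ∀ s, (s, q) ∈ D → Φ (s, q) ∈ quadrant := fun s hs => hΩ (hF.target_mem _ _ hs)
  have hd : ∀ s, (s, q) ∈ D →
      HasDerivAt (fun s => Φ (s, q)) (symmetryField α β c₁ c₂ c₃ c₄ (Φ (s, q))) s := fun s hs => by
    rw [← hV _ (hF.target_mem _ _ hs)]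
    exact hF.lie_equation s q hs
  have e1 : ∀ s, (s, q) ∈ D → (flatten α β (Φ (s, q))).1 = (C.flow s (flatten α β q)).1 :=
    fun s hs => linear_solution_unique (y := fun s => (flatten α β (Φ (s, q))).1) hS hc h0
      (fun s hs => (hasDerivAt_flat hβ (hd s hs).fst (hpos s hs).1).congr_deriv (by
        have h1 := rpow_mul_rpow_one_sub (hpos s hs).1 β
        have h2 := rpow_sub_one_mul (hpos s hs).1 β
        simp only [symmetryField, flatten]
        rw [← h2]
        field_simp
        linear_combination 2 * β * c₂ * h1))
      (fun s _ => C.hasDerivAt_flow_fst _ s) (by rw [hi]) hs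
  have e3 : ∀ s, (s, q) ∈ D → (flatten α β (Φ (s, q))).2.2 = (C.flow s (flatten α β q)).2.2 :=
    fun s hs => linear_solution_unique (y := fun s => (flatten α β (Φ (s, q))).2.2) hS hc h0
      (fun s hs => (hd s hs).snd.snd)
      (fun s _ => C.hasDerivAt_flow_thd _ s) (by rw [hi]) hs
  have e2 : ∀ s, (s, q) ∈ D → (flatten α β (Φ (s, q))).2.1 = (C.flow s (flatten α β q)).2.1 :=
    fun s hs => linear_solution_unique (y := fun s => (flatten α β (Φ (s, q))).2.1) hS hc h0
      (fun s hs => (hasDerivAt_flat hα (hd s hs).snd.fst (hpos s hs).2).congr_deriv (by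
        have h1 := rpow_mul_rpow_one_sub (hpos s hs).2 α
        have h2 := rpow_sub_one_mul (hpos s hs).2 α
        -- The first component, already identified, is the source term in the equation for the
        -- second.
        rw [← e1 s hs]
        simp only [symmetryField, flatten]
        rw [← h2]
        field_simp
        linear_combination (2 * α * 6 * c₃ * (Φ (s, q)).1 ^ β + 2 * α * β * c₄) * h1))
      (fun s _ => C.hasDerivAt_flow_snd _ s) (by rw [hi]) hs
  exact Prod.ext (e1 ε h) (Prod.ext (e2 ε h) (e3 ε h))

end IntegrateFlow

/-! ### Finite transformations map solutions to solutions. -/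

section AffineChange

/-- The relations `r³ = a` and `k r² = 1` are the KdV scaling and give all three terms the factor
`κrk`; the shift `m` of `u` is cancelled by the Galilean drift `6am` in `B`. -/
theorem newKdv_affine {R : Type*} [CommRing R] [Algebra ℝ R] {dT dX : Derivation ℝ R R}
    {a r k m κ : ℝ} (hr : r ^ 3 = a) (hk : k * r ^ 2 = 1) (hκ : κ * (a * r) = 1) {A B u : R}
    (hTA : dT A = algebraMap ℝ R a) (hXA : dX A = 0) (hTB : dT B = algebraMap ℝ R (6 * a * m))
    (hXB : dX B = algebraMap ℝ R r) :
    newKdv dT dX A B (algebraMap ℝ R κ) (algebraMap ℝ R k * u + algebraMap ℝ R m)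
      = algebraMap ℝ R (κ * r * k) * kdvForm dT dX u := by
  have h1 : a * k = r := by linear_combination r * hk - k * hr
  have h2 : κ ^ 2 * a ^ 3 = r := by
    linear_combination r * (κ * a * r + 1) * hκ - κ ^ 2 * a ^ 2 * hr
  have h1' := congrArg (algebraMap ℝ R) h1
  have h2' := congrArg (algebraMap ℝ R) h2
  simp only [newKdv, newX, newT, kdvForm, hTA, hXA, hTB, hXB, Derivation.leibniz, smul_eq_mul,
    map_add, map_mul, map_pow, map_ofNat, Derivation.map_algebraMap] at h1' h2' ⊢
  simp only [zero_mul, mul_zero, sub_zero, add_zero, Derivation.leibniz, smul_eq_mul,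
    Derivation.map_algebraMap]
  linear_combination 6 * algebraMap ℝ R κ * algebraMap ℝ R k * u * dX u * h1'
    + algebraMap ℝ R κ * algebraMap ℝ R k * dX (dX (dX u)) * h2'

variable {α β c₁ c₂ c₃ c₄ : ℝ}

theorem mapsSolutions_of_symmetryField (hα : 0 < α) (hβ : 0 < β) {Ω : Set (ℝ × ℝ × ℝ)}
    (hΩ : Ω ⊆ quadrant) {V : ℝ × ℝ × ℝ → ℝ × ℝ × ℝ}
    (hV : ∀ q ∈ Ω, V q = symmetryField α β c₁ c₂ c₃ c₄ q) {D : Set (ℝ × (ℝ × ℝ × ℝ))}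
    {Φ : ℝ × (ℝ × ℝ × ℝ) → ℝ × ℝ × ℝ} (hF : IsLocalFlow Ω V D Φ) : MapsSolutions α β D Φ := by
  intro ε W₀ W₀' u v hWo hWo' hu hv hD himg
  obtain ⟨C⟩ := nonempty_flowCoefficients c₁ c₂ c₃ c₄
  obtain ⟨W, rfl⟩ : ∃ W : Opens (ℝ × ℝ), (W : Set (ℝ × ℝ)) = W₀ := ⟨⟨W₀, hWo⟩, rfl⟩
  obtain ⟨W', rfl⟩ : ∃ W : Opens (ℝ × ℝ), (W : Set (ℝ × ℝ)) = W₀' := ⟨⟨W₀', hWo'⟩, rfl⟩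
  have hD' : ∀ p ∈ W, (ε, (p.1, p.2, u p)) ∈ D := fun p hp => hD _ ⟨p, hp, rfl⟩
  have hW : (W : Set (ℝ × ℝ)) ⊆ quadrantTX := fun p hp => hΩ (hF.source_mem _ _ (hD' p hp))
  have hW' : (W' : Set (ℝ × ℝ)) ⊆ quadrantTX := fun p hp => by
    have : (p.1, p.2, v p) ∈ graphOver W' v := ⟨p, hp, rfl⟩
    rw [← himg] at this
    obtain ⟨_, ⟨p', hp', rfl⟩, e⟩ := this
    have := hΩ (hF.target_mem _ _ (hD' p' hp'))
    simp only at e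
    rw [e] at this
    exact this
  let φ : ℝ × ℝ → ℝ × ℝ := fun p => ((Φ (ε, (p.1, p.2, u p))).1, (Φ (ε, (p.1, p.2, u p))).2.1)
  have hφv : ∀ p ∈ W, φ p ∈ W' ∧ Φ (ε, (p.1, p.2, u p)) = ((φ p).1, (φ p).2, v (φ p)) := by
    intro p hp
    have : Φ (ε, (p.1, p.2, u p)) ∈ graphOver W' v := himg ▸ ⟨_, ⟨p, hp, rfl⟩, rfl⟩
    obtain ⟨p', hp', e⟩ := this
    have : φ p = p' := by simp only [φ, ← e]
    rw [this]
    exact ⟨hp', e.symm⟩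
  -- The identity obtained below lives on `W`; surjectivity of `φ` carries the vanishing to all of
  -- `W'`, and no inverse of `φ` is needed.
  have hsurj : ∀ p' ∈ W', ∃ p ∈ W, φ p = p' := by
    intro p' hp'
    have : (p'.1, p'.2, v p') ∈ graphOver W' v := ⟨p', hp', rfl⟩
    rw [← himg] at this
    obtain ⟨_, ⟨p, hp, rfl⟩, e⟩ := this
    refine ⟨p, hp, ?_⟩
    simp only [φ] at e ⊢
    rw [e]
  have hsm : ContDiffOn ℝ ∞ (fun p => Φ (ε, (p.1, p.2, u p))) W :=
    hF.smooth.comp (t := D) (f := fun p : ℝ × ℝ => (ε, (p.1, p.2, u p)))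
      (contDiffOn_const.prodMk (contDiff_fst.contDiffOn.prodMk (contDiff_snd.contDiffOn.prodMk
        hu.1))) hD'
  have hφ : ContDiffOn ℝ ∞ φ W := hsm.fst.prodMk hsm.snd.fst
  have hm : ∀ p ∈ W, φ p ∈ W' := fun p hp => (hφv p hp).1
  have hflow : ∀ p ∈ W, flatten α β (Φ (ε, (p.1, p.2, u p)))
      = C.flow ε (flatten α β (p.1, p.2, u p)) := fun p hp =>
    flatten_flow_eq C hα hβ hΩ hV hF (hD' p hp)
  obtain ⟨a, ha⟩ : ∃ a, a = Real.exp (-(3 / 2 * c₁) * ε) := ⟨_, rfl⟩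
  obtain ⟨r, hr⟩ : ∃ r, r = Real.exp (-(1 / 2 * c₁) * ε) := ⟨_, rfl⟩
  obtain ⟨k, hk⟩ : ∃ k, k = Real.exp (c₁ * ε) := ⟨_, rfl⟩
  have hr3 : r ^ 3 = a := by
    rw [hr, ha, ← Real.exp_nat_mul]
    congr 1
    push_cast
    ring
  have hk2 : k * r ^ 2 = 1 := by
    rw [hr, hk, ← Real.exp_nat_mul, ← Real.exp_add]
    refine Real.exp_eq_one_iff _ |>.2 ?_
    push_cast
    ring
  have hκ : (a * r)⁻¹ * (a * r) = 1 := inv_mul_cancel₀ (by rw [ha, hr]; positivity)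
  simp only [FlowCoefficients.flow, ← ha, ← hr, ← hk] at hflow
  let A : SmoothFn W := algebraMap ℝ _ a * coordFnT β hW + algebraMap ℝ _ (C.b ε)
  let B : SmoothFn W := algebraMap ℝ _ r * coordFnX α hW
    + algebraMap ℝ _ (6 * a * C.m ε) * coordFnT β hW + algebraMap ℝ _ (C.g ε)
  have hA : pull φ hφ hm (coordFnT β hW') = A := ext_ev fun p hp => by
    have := congrArg Prod.fst (hflow p hp)
    simp only [A, ev_pull, coordFnT, map_smul, ev_powFn, map_add, map_mul, AlgHom.commutes,
      Algebra.algebraMap_self_apply, smul_eq_mul]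
    exact this
  have hB : pull φ hφ hm (coordFnX α hW') = B := ext_ev fun p hp => by
    have := congrArg (fun q => q.2.1) (hflow p hp)
    simp only [B, ev_pull, coordFnT, coordFnX, map_smul, ev_powFn, map_add, AlgHom.commutes,
      Algebra.algebraMap_self_apply, smul_eq_mul, map_mul (ev hp)]
    exact this
  have hC : pull φ hφ hm (of v hv)
      = algebraMap ℝ _ k * of u hu.1 + algebraMap ℝ _ (C.m ε) := ext_ev fun p hp => by
    have := congrArg (fun q => q.2.2) (hflow p hp)
    rw [(hφv p hp).2] at this
    simp only [ev_pull, ev_of, map_add, map_mul, AlgHom.commutes,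
      Algebra.algebraMap_self_apply]
    exact this
  have hTA : dT β hW A = algebraMap ℝ _ a := by
    simp only [A, map_add, Derivation.leibniz, smul_eq_mul, Derivation.map_algebraMap,
      dT_coordFnT hβ.ne']
    ring
  have hXA : dX α hW A = 0 := by
    simp only [A, map_add, Derivation.leibniz, smul_eq_mul, Derivation.map_algebraMap,
      dX_coordFnT]
    ring
  have hTB : dT β hW B = algebraMap ℝ _ (6 * a * C.m ε) := by
    simp only [B, map_add, Derivation.leibniz, smul_eq_mul, Derivation.map_algebraMap,
      dT_coordFnT hβ.ne', dT_coordFnX]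
    ring
  have hXB : dX α hW B = algebraMap ℝ _ r := by
    simp only [B, map_add, Derivation.leibniz, smul_eq_mul, Derivation.map_algebraMap,
      dX_coordFnX hα.ne', dX_coordFnT]
    ring
  have key := pull_kdvForm hα.ne' hβ.ne' hW hW' hφ hm (of v hv) hA hB hC
    (K := algebraMap ℝ _ (a * r)⁻¹) (by
      rw [hTA, hXA, hXB, zero_mul, sub_zero, ← map_mul, ← map_mul, hκ, map_one])
  rw [newKdv_affine hr3 hk2 hκ hTA hXA hTB hXB, (isSolution_iff α β hW hu.1).1 hu, mul_zero] at key
  refine (isSolution_iff α β hW' hv).2 (ext_ev fun p' hp' => ?_)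
  obtain ⟨p, hp, rfl⟩ := hsurj p' hp'
  have := congrArg (ev hp) key
  rw [ev_pull, map_zero] at this
  rw [this, map_zero]

theorem generatesSymmetry_of_symmetryField (hα : 0 < α) (hβ : 0 < β) {Ω : Set (ℝ × ℝ × ℝ)}
    (hO : IsOpen Ω) (hΩ : Ω ⊆ quadrant) {V : ℝ × ℝ × ℝ → ℝ × ℝ × ℝ}
    (hV : ∀ q ∈ Ω, V q = symmetryField α β c₁ c₂ c₃ c₄ q) : GeneratesSymmetry α β Ω V := by
  obtain ⟨C⟩ := nonempty_flowCoefficients c₁ c₂ c₃ c₄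
  exact ⟨⟨_, _, exists_isLocalFlow C hα hβ hO hΩ hV⟩,
    fun _ _ hF => mapsSolutions_of_symmetryField hα hβ hΩ hV hF⟩

end AffineChange

/-! ### The equivalence, the span and the commutators. -/

section Main

variable {α β : ℝ}

theorem symmetryField_eq (α β c₁ c₂ c₃ c₄ : ℝ) (q : ℝ × ℝ × ℝ) :
    symmetryField α β c₁ c₂ c₃ c₄ q
      = c₂ • V₁ β q + (c₄ • V₂ α q + (c₃ • V₃ α β q + c₁ • V₄ α β q)) := by
  refine Prod.ext ?_ (Prod.ext ?_ ?_)
  · simp [symmetryField, V₁, V₂, V₃, V₄]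
    ring
  · simp [symmetryField, V₁, V₂, V₃, V₄]
    ring
  · simp [symmetryField, V₁, V₂, V₃, V₄]
    ring

theorem contDiffOn_symmetryField (α β c₁ c₂ c₃ c₄ : ℝ) :
    ContDiffOn ℝ ∞ (symmetryField α β c₁ c₂ c₃ c₄) quadrant := by
  have h1 : ∀ γ : ℝ, ContDiffOn ℝ ∞ (fun q : ℝ × ℝ × ℝ => q.1 ^ γ) quadrant := fun γ =>
    contDiff_fst.contDiffOn.rpow_const_of_ne fun _ hq => hq.1.ne'
  have h2 : ∀ γ : ℝ, ContDiffOn ℝ ∞ (fun q : ℝ × ℝ × ℝ => q.2.1 ^ γ) quadrant := fun γ =>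
    contDiff_snd.fst.contDiffOn.rpow_const_of_ne fun _ hq => hq.2.ne'
  have h3 := h1 (1 - β)
  have h4 := h1 β
  have h5 := h2 (1 - α)
  unfold symmetryField
  fun_prop

/-- Here `u` satisfies the equation at a single point only. This suffices because `lieForm` is a
constant multiple of the KdV expression for every `u`. -/
theorem lieCriterion_of_symmetryField (hα : 0 < α) (hβ : 0 < β) {Ω : Opens (ℝ × ℝ × ℝ)}
    (hΩ : (Ω : Set (ℝ × ℝ × ℝ)) ⊆ quadrant) {V : ℝ × ℝ × ℝ → ℝ × ℝ × ℝ}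
    (hVs : ContDiffOn ℝ ∞ V Ω) {c₁ c₂ c₃ c₄ : ℝ}
    (hV : ∀ q ∈ Ω, V q = symmetryField α β c₁ c₂ c₃ c₄ q) : LieCriterion α β Ω V := by
  intro u p hu hp h0
  let W : Opens (ℝ × ℝ) := ⟨(fun p : ℝ × ℝ => (p.1, p.2, u p)) ⁻¹' Ω, Ω.isOpen.preimage (by
    have := hu.continuous
    fun_prop)⟩
  have hg : ∀ p ∈ W, (p.1, p.2, u p) ∈ Ω := fun p hp => hp
  have hW : (W : Set (ℝ × ℝ)) ⊆ quadrantTX := fun p hp => hΩ (hg p hp)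
  have ha : onGraph hu.contDiffOn hg (tauFn β hΩ hVs)
      = algebraMap ℝ _ (-(3 / 2) * c₁) * coordFnT β hW + algebraMap ℝ _ c₂ := ext_ev fun q hq => by
    have h1 := rpow_sub_one_mul (hW hq).1 β
    have h2 := rpow_mul_rpow_one_sub (hW hq).1 β
    simp only [ev_onGraph, tauFn, map_mul (ev _), ev_powFn, ev_of, hV _ (hg q hq), symmetryField,
      map_add, AlgHom.commutes, Algebra.algebraMap_self_apply, coordFnT, map_smul, smul_eq_mul]
    change q.1 ^ (β - 1) * _ = _ * (β⁻¹ * q.1 ^ β) + _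
    rw [← h1]
    field_simp
    linear_combination 2 * β * c₂ * h2
  have hb : onGraph hu.contDiffOn hg (xiFn α hΩ hVs)
      = algebraMap ℝ _ (-(1 / 2) * c₁) * coordFnX α hW + algebraMap ℝ _ (6 * c₃) * coordFnT β hW
        + algebraMap ℝ _ c₄ := ext_ev fun q hq => by
    have h1 := rpow_sub_one_mul (hW hq).2 α
    have h2 := rpow_mul_rpow_one_sub (hW hq).2 α
    simp only [ev_onGraph, xiFn, map_mul (ev _), ev_powFn, ev_of, hV _ (hg q hq), symmetryField,
      map_add, AlgHom.commutes, Algebra.algebraMap_self_apply, coordFnT, coordFnX, map_smul,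
      smul_eq_mul]
    change q.2 ^ (α - 1) * _ = _ * (α⁻¹ * q.2 ^ α) + _ * (β⁻¹ * q.1 ^ β) + _
    rw [← h1]
    field_simp
    linear_combination (2 * α * 6 * c₃ * q.1 ^ β + 2 * α * β * c₄) * h2
  have key := lieForm_affine (dT := dT β hW) (dX := dX α hW) (u := of u hu.contDiffOn)
    (a := onGraph hu.contDiffOn hg (tauFn β hΩ hVs))
    (b := onGraph hu.contDiffOn hg (xiFn α hΩ hVs))
    (c := onGraph hu.contDiffOn hg (etaFn hVs)) (k₁ := c₁) (k₃ := c₃)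
    (by
      rw [ha]
      simp only [map_add, Derivation.leibniz, smul_eq_mul, Derivation.map_algebraMap,
        dT_coordFnT hβ.ne']
      ring)
    (by
      rw [ha]
      simp only [map_add, Derivation.leibniz, smul_eq_mul, Derivation.map_algebraMap,
        dX_coordFnT]
      ring)
    (by
      rw [hb]
      simp only [map_add, Derivation.leibniz, smul_eq_mul, Derivation.map_algebraMap,
        dT_coordFnT hβ.ne', dT_coordFnX]
      ring)
    (by
      rw [hb]
      simp only [map_add, Derivation.leibniz, smul_eq_mul, Derivation.map_algebraMap,
        dX_coordFnX hα.ne', dX_coordFnT]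
      ring)
    (ext_ev fun q hq => by
      simp only [ev_onGraph, etaFn, ev_of, hV _ (hg q hq), symmetryField, map_add, map_mul,
        AlgHom.commutes, Algebra.algebraMap_self_apply])
  have hp' : p ∈ W := hp
  have := congrArg (ev hp') key
  rw [← lieOn, ev_lieOn, map_mul,
    ← (represents_of hu.contDiffOn).kdv α β hW p hp', h0, mul_zero] at this
  exact this

theorem LieCriterion.criticalOnSolutions {Ω : Opens (ℝ × ℝ × ℝ)}
    (hΩ : (Ω : Set (ℝ × ℝ × ℝ)) ⊆ quadrant) {V : ℝ × ℝ × ℝ → ℝ × ℝ × ℝ}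
    (hV : ContDiffOn ℝ ∞ V Ω) (H : LieCriterion α β Ω V) : CriticalOnSolutions α β hΩ hV := by
  intro W hW u hu hg hsol
  refine ext_ev fun p hp => ?_
  rw [ev_lieOn, map_zero]
  exact H u p hu (hg p hp) (((isSolution_iff α β hW hu.contDiffOn).2 hsol).2 p hp)

theorem symmetry_tfae (hα : 0 < α) (hβ : 0 < β) {Ω : Set (ℝ × ℝ × ℝ)} (hO : IsOpen Ω)
    (hc : IsPreconnected Ω) (hΩ : Ω ⊆ quadrant) {V : ℝ × ℝ × ℝ → ℝ × ℝ × ℝ}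
    (hV : ContDiffOn ℝ ∞ V Ω) :
    [GeneratesSymmetry α β Ω V, LieCriterion α β Ω V,
      ∃ c₁ c₂ c₃ c₄ : ℝ, ∀ t x u : ℝ, (t, x, u) ∈ Ω →
        V (t, x, u) = symmetryField α β c₁ c₂ c₃ c₄ (t, x, u)].TFAE := by
  obtain ⟨Ω, rfl⟩ : ∃ O : Opens (ℝ × ℝ × ℝ), (O : Set (ℝ × ℝ × ℝ)) = Ω := ⟨⟨Ω, hO⟩, rfl⟩
  tfae_have 1 → 3 := fun ⟨⟨_, _, hF⟩, hM⟩ =>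
    (criticalOnSolutions_of_mapsSolutions hα.ne' hβ.ne' hΩ hV hF (hM _ _ hF)).exists_constants
      hα hβ hc
  tfae_have 2 → 3 := fun H => (H.criticalOnSolutions hΩ hV).exists_constants hα hβ hc
  tfae_have 3 → 1 := fun ⟨_, _, _, _, h⟩ =>
    generatesSymmetry_of_symmetryField hα hβ hO hΩ fun q hq => h q.1 q.2.1 q.2.2 hq
  tfae_have 3 → 2 := fun ⟨_, _, _, _, h⟩ =>
    lieCriterion_of_symmetryField hα hβ hΩ hV fun q hq => h q.1 q.2.1 q.2.2 hq
  tfae_finish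

theorem symmetryAlgebra_eq_span (hα : 0 < α) (hβ : 0 < β) {Ω : Set (ℝ × ℝ × ℝ)} (hO : IsOpen Ω)
    (hc : IsPreconnected Ω) (hΩ : Ω ⊆ quadrant) :
    symmetryAlgebra α β Ω = (Submodule.span ℝ {Ω.domRestrict (V₁ β), Ω.domRestrict (V₂ α),
      Ω.domRestrict (V₃ α β), Ω.domRestrict (V₄ α β)} : Set (Ω → ℝ × ℝ × ℝ)) := by
  ext X
  simp only [SetLike.mem_coe, Submodule.mem_span_insert, Submodule.mem_span_singleton]
  constructor
  · rintro ⟨V, hV, hG, rfl⟩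
    obtain ⟨c₁, c₂, c₃, c₄, h⟩ := ((symmetry_tfae hα hβ hO hc hΩ hV).out 0 2).1 hG
    refine ⟨c₂, _, ⟨c₄, _, ⟨c₃, _, ⟨c₁, rfl⟩, rfl⟩, rfl⟩, funext fun q => ?_⟩
    exact (h _ _ _ q.2).trans (symmetryField_eq _ _ _ _ _ _ _)
  · rintro ⟨c₂, _, ⟨c₄, _, ⟨c₃, _, ⟨c₁, rfl⟩, rfl⟩, rfl⟩, rfl⟩
    exact ⟨symmetryField α β c₁ c₂ c₃ c₄, (contDiffOn_symmetryField _ _ _ _ _ _).mono hΩ,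
      generatesSymmetry_of_symmetryField hα hβ hO hΩ fun _ _ => rfl,
      funext fun q => symmetryField_eq _ _ _ _ _ _ _⟩

section Bracket

variable {p : ℝ × ℝ × ℝ}

theorem hasFDerivAt_fst_rpow (hp : p ∈ quadrant) (γ : ℝ) : HasFDerivAt (fun q : ℝ × ℝ × ℝ => q.1 ^ γ)
    ((γ * p.1 ^ (γ - 1)) • ContinuousLinearMap.fst ℝ ℝ (ℝ × ℝ)) p :=
  hasFDerivAt_fst.rpow_const (Or.inl hp.1.ne')

theorem hasFDerivAt_snd_rpow (hp : p ∈ quadrant) (γ : ℝ) : HasFDerivAt (fun q : ℝ × ℝ × ℝ => q.2.1 ^ γ)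
    ((γ * p.2.1 ^ (γ - 1)) •
      (ContinuousLinearMap.fst ℝ ℝ ℝ).comp (ContinuousLinearMap.snd ℝ ℝ (ℝ × ℝ))) p :=
  hasFDerivAt_snd.fst.rpow_const (Or.inl hp.2.ne')

theorem fderiv_V₁ (hp : p ∈ quadrant) (β : ℝ) (v : ℝ × ℝ × ℝ) :
    fderiv ℝ (V₁ β) p v = ((1 - β) * p.1 ^ (1 - β - 1) * v.1, 0, 0) := by
  have h : HasFDerivAt (V₁ β) _ p := (hasFDerivAt_fst_rpow hp (1 - β)).prodMk
    ((hasFDerivAt_const (0 : ℝ) p).prodMk (hasFDerivAt_const (0 : ℝ) p))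
  rw [h.fderiv]
  rfl

theorem fderiv_V₂ (hp : p ∈ quadrant) (α : ℝ) (v : ℝ × ℝ × ℝ) :
    fderiv ℝ (V₂ α) p v = (0, (1 - α) * p.2.1 ^ (1 - α - 1) * v.2.1, 0) := by
  have h : HasFDerivAt (V₂ α) _ p := (hasFDerivAt_const (0 : ℝ) p).prodMk
    ((hasFDerivAt_snd_rpow hp (1 - α)).prodMk (hasFDerivAt_const (0 : ℝ) p))
  rw [h.fderiv]
  rfl

theorem fderiv_V₃ (hp : p ∈ quadrant) (α β : ℝ) (v : ℝ × ℝ × ℝ) :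
    fderiv ℝ (V₃ α β) p v = (0, (6 * (β * p.1 ^ (β - 1) * v.1) * p.2.1 ^ (1 - α)
      + 6 * p.1 ^ β * ((1 - α) * p.2.1 ^ (1 - α - 1) * v.2.1)) / β, 0) := by
  have h : HasFDerivAt (V₃ α β) _ p := (hasFDerivAt_const (0 : ℝ) p).prodMk
    (((((hasFDerivAt_fst_rpow hp β).const_mul 6).mul
      (hasFDerivAt_snd_rpow hp (1 - α))).mul_const β⁻¹).prodMk (hasFDerivAt_const (1 : ℝ) p))
  rw [h.fderiv]
  refine Prod.ext rfl (Prod.ext ?_ rfl)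
  simp
  ring

theorem fderiv_V₄ (α β : ℝ) (p v : ℝ × ℝ × ℝ) :
    fderiv ℝ (V₄ α β) p v = V₄ α β v := by
  have h1 : HasFDerivAt (fun q : ℝ × ℝ × ℝ => q.2.1)
      ((ContinuousLinearMap.fst ℝ ℝ ℝ).comp (ContinuousLinearMap.snd ℝ ℝ (ℝ × ℝ))) p :=
    hasFDerivAt_snd.fst
  have h2 : HasFDerivAt (fun q : ℝ × ℝ × ℝ => q.2.2)
      ((ContinuousLinearMap.snd ℝ ℝ ℝ).comp (ContinuousLinearMap.snd ℝ ℝ (ℝ × ℝ))) p :=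
    hasFDerivAt_snd.snd
  have h : HasFDerivAt (V₄ α β) _ p := ((hasFDerivAt_fst.const_mul (-3)).mul_const
    (2 * β)⁻¹).prodMk ((h1.fun_neg.mul_const (2 * α)⁻¹).prodMk h2)
  rw [h.fderiv]
  refine Prod.ext ?_ (Prod.ext ?_ rfl)
  · simp [V₄]
    ring
  · simp [V₄]
    ring

/-- `VectorField.lieBracket` of `ρ`, `σ` is `Dσ·ρ - Dρ·σ`, the coefficient vector of `ρσ - σρ`, so
the signs agree. -/
theorem lieBrackets (hα : 0 < α) (hβ : 0 < β) (hp : p ∈ quadrant) :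
    VectorField.lieBracket ℝ (V₁ β) (V₂ α) p = 0 ∧
      VectorField.lieBracket ℝ (V₁ β) (V₃ α β) p = (6 : ℝ) • V₂ α p ∧
      VectorField.lieBracket ℝ (V₁ β) (V₄ α β) p = (-3 / 2 : ℝ) • V₁ β p ∧
      VectorField.lieBracket ℝ (V₂ α) (V₃ α β) p = 0 ∧
      VectorField.lieBracket ℝ (V₂ α) (V₄ α β) p = (-1 / 2 : ℝ) • V₂ α p ∧
      VectorField.lieBracket ℝ (V₃ α β) (V₄ α β) p = V₃ α β p := by
  have t1 := rpow_mul_rpow_one_sub hp.1 β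
  have t2 := rpow_sub_one_mul hp.1 (1 - β)
  have t3 := rpow_sub_one_mul hp.1 β
  have x2 := rpow_sub_one_mul hp.2 (1 - α)
  simp only [VectorField.lieBracket, fderiv_V₁ hp, fderiv_V₂ hp, fderiv_V₃ hp, fderiv_V₄]
  simp only [V₁, V₂, V₃, V₄, Prod.mk_sub_mk, Prod.smul_mk, smul_eq_mul, Prod.mk_eq_zero,
    Prod.mk.injEq, mul_zero, zero_mul, sub_self, zero_div, add_zero, zero_add, sub_zero,
    neg_zero, and_true, true_and]
  obtain ⟨t, x, u⟩ := p
  simp only at t1 t2 t3 x2 ⊢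
  -- Only the multiplicative relations `t1`, `t2`, `t3`, `x2` between the powers matter from here
  -- on.
  generalize t ^ (β - 1) = a, t ^ (1 - β) = b, t ^ β = c, t ^ (1 - β - 1) = d, x ^ (1 - α) = e,
    x ^ (1 - α - 1) = f at *
  refine ⟨?_, ⟨?_, rfl⟩, ?_, ?_, ?_⟩
  · field_simp
    linear_combination e * t1
  · field_simp
    linear_combination (1 - β) * t2
  · ring
  · field_simp
    linear_combination (1 - α) * x2
  · field_simp
    linear_combination 3 * α * e * t3 + c * (1 - α) * x2

end Bracket

end Main

end FracKdV

end

theorem mainTheorem1 (α β : ℝ) (hα : 0 < α ∧ α ≤ 1) (hβ : 0 < β ∧ β ≤ 1)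
    (Ω : Set (ℝ × ℝ × ℝ)) (hΩ_open : IsOpen Ω) (hΩ_conn : IsConnected Ω)
    (hΩ : Ω ⊆ FracKdV.quadrant) :
    (∀ V : ℝ × ℝ × ℝ → ℝ × ℝ × ℝ, ContDiffOn ℝ ∞ V Ω →
      [ FracKdV.GeneratesSymmetry α β Ω V,
        FracKdV.LieCriterion α β Ω V,
        ∃ c₁ c₂ c₃ c₄ : ℝ, ∀ t x u : ℝ, (t, x, u) ∈ Ω →
          V (t, x, u) =
            (-3 * c₁ * t / (2 * β) + c₂ * t ^ (1 - β),
             -c₁ * x / (2 * α) + 6 * c₃ / β * t ^ β * x ^ (1 - α) + c₄ * x ^ (1 - α),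
             c₁ * u + c₃) ].TFAE) ∧
    FracKdV.symmetryAlgebra α β Ω =
      (Submodule.span ℝ {Ω.domRestrict (FracKdV.V₁ β), Ω.domRestrict (FracKdV.V₂ α),
        Ω.domRestrict (FracKdV.V₃ α β), Ω.domRestrict (FracKdV.V₄ α β)} : Set (Ω → ℝ × ℝ × ℝ)) ∧
    (∀ p ∈ FracKdV.quadrant,
      VectorField.lieBracket ℝ (FracKdV.V₁ β) (FracKdV.V₂ α) p = 0 ∧
      VectorField.lieBracket ℝ (FracKdV.V₁ β) (FracKdV.V₃ α β) p = (6 : ℝ) • FracKdV.V₂ α p ∧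
      VectorField.lieBracket ℝ (FracKdV.V₁ β) (FracKdV.V₄ α β) p
        = (-3 / 2 : ℝ) • FracKdV.V₁ β p ∧
      VectorField.lieBracket ℝ (FracKdV.V₂ α) (FracKdV.V₃ α β) p = 0 ∧
      VectorField.lieBracket ℝ (FracKdV.V₂ α) (FracKdV.V₄ α β) p
        = (-1 / 2 : ℝ) • FracKdV.V₂ α p ∧
      VectorField.lieBracket ℝ (FracKdV.V₃ α β) (FracKdV.V₄ α β) p = FracKdV.V₃ α β p) := by
  exact ⟨fun V hV => FracKdV.symmetry_tfae hα.1 hβ.1 hΩ_open hΩ_conn.isPreconnected hΩ hV,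
    FracKdV.symmetryAlgebra_eq_span hα.1 hβ.1 hΩ_open hΩ_conn.isPreconnected hΩ,
    fun p hp => FracKdV.lieBrackets hα.1 hβ.1 hp⟩
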